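/- **Setting.** Let $d\in\{1,2\}$, $H,g,N,T>0$, $s\ge 0$, $\mathcal S=\mathbb R^d\times(-H,0)$ with points $(X,z)$; $\nabla,\Delta$ are taken in $X\in\mathbb R^d$. Let $H^{s,0}=L^2((-H,0);H^s(\mathbb R^d))$. Let $\rho_{\rm eq}\in W^{1,\infty}(-H,0)$ with $\inf\rho_{\rm eq}>0$ be such that the Brunt–Väisälä frequency is the constant $N$, i.e. $N^2=-g\,\rho_{\rm eq}'/\rho_{\rm eq}$ a.e. on $(-H,0)$. Let $(f_n)_{n\ge1}$ be the orthonormal basis of $L^2((-H,0),\rho_{\rm eq}N^2dz)$ formed by the eigenfunctions of $$(\rho_{\rm eq}f_n')'+\frac{\rho_{\rm eq}N^2}{c_n^2}f_n=0,\qquad f_n(-H)=f_n(0)=0,\qquad c_1>c_2>\dots>0,$$ and put $g_0=\alpha\rho_{\rm eq}^{-1}$ with $\alpha=\big(\int_{-H}^0\rho_{\rm eq}^{-1}\big)^{-1/2}$, and $g_n=c_nf_n'$ for $n\ge1$. (Then $(g_n)_{n\ge0}$, $(\rho_{\rm eq}g_n)_{n\ge0}$ and $(\rho_{\rm eq}N^2f_n)_{n\ge1}$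 are orthonormal bases of $L^2((-H,0))$ with the weights $\rho_{\rm eq}$, $\rho_{\rm eq}^{-1}$ and $(\rho_{\rm eq}N^2)^{-1}$ respectively.) Let $V$ (with values in $\mathbb R^d$), $w$, $\rho$ be in $C([0,T];H^{s,0})$ and let $P\in L^1((0,T);L^2(\mathcal S))$ (this fixes the function of time up to which the pressure is determined) be such that $$\rho_{\rm eq}\partial_tV+\nabla P=0,\quad \rho_{\rm eq}\partial_tw+\partial_zP+g\rho=0,\quad \partial_t\rho+w\rho_{\rm eq}'=0,\quad \nabla\cdot V+\partial_zw=0$$ in the sense of distributions in $(0,T)\times\mathcal S$, with $w_{|z=-H}=w_{|z=0}=0$ (in the sense of normal traces of divergence-free $L^2$ fields), with initial data $V_{|t=0}=V^0$, $\rho_{|t=0}=\rho^0$. Assume that the vertical component of the vorticity of $V^0$ vanishes: $\partial_1V^0_2-\partial_2V^0_1=0$ if $d=2$ (no condition if $d=1$). Define the modal coefficients, which are functions of $(t,X)$, by the expansions $$V=\sum_{n\ge0}V_n\,g_n,\quad w=\sum_{n\ge1}w_n\,f_n,\quad \rho=\sum_{n\ge1}\tfrac1g\rho_n\,\rho_{\rm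 eq}N^2f_n,\quad P=\sum_{n\ge0}P_n\,\rho_{\rm eq}g_n,$$ i.e. as the weighted $L^2((-H,0))$ inner products of $V,w,g\rho,P$ with the corresponding basis vectors. **Proposition.** For every $n\ge1$ one has $V_n,w_n,\rho_n\in C([0,T];H^s(\mathbb R^d))$ and, in the sense of distributions in $(0,T)\times\mathbb R^d$, $$\Big(1-\frac{c_n^2}{N^2}\Delta\Big)\partial_tV_n+c_n\nabla\rho_n=0,\qquad \partial_t\rho_n+c_n\nabla\cdot V_n=0,$$ the initial values of $V_n$ and $\rho_n$ being the corresponding coefficients of $V^0$ and $\rho^0$; moreover $$w_n=-c_n\nabla\cdot V_n\ \text{ for every } t\in[0,T],\qquad P_n=c_n\rho_n+\frac{c_n}{N^2}\partial_tw_n .$$ For $n=0$, $P_0=0$ (for almost every $t$) and $V_0=0$ (for every $t\in[0,T]$). Finally, for every $t\in[0,T]$, $$\sum_{n=1}^\infty\big[|\rho_n(t)|_{H^s}^2+|V_n(t)|_{H^s}^2+|w_n(t)|_{H^s}^2\big]<\infty .$$ -/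

import Mathlib

open MeasureTheory Set Filter Topology
open scoped ENNReal ContDiff FourierTransform

noncomputable section

namespace InternalWaves

/-- The horizontal space `ℝ^d`. -/
abbrev Horiz (d : ℕ) := EuclideanSpace ℝ (Fin d)

/-- The `j`-th unit vector of `ℝ^d`. -/
def unitVec {d : ℕ} (j : Fin d) : Horiz d := EuclideanSpace.single j 1

/-- Lebesgue measure on the interval `(-H, 0)`. -/
abbrev depthMeasure (H : ℝ) : Measure ℝ := volume.restrict (Ioo (-H) 0)

/-- Lebesgue measure on the strip `ℝ^d × (-H, 0)`; its points are written `(x, z)`. -/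
abbrev stripMeasure (d : ℕ) (H : ℝ) : Measure (Horiz d × ℝ) :=
  (volume : Measure (Horiz d)).prod (depthMeasure H)

/-! ### Test functions -/

/-- Smooth real functions with compact support contained in `Ω`. -/
def IsTest {E : Type*} [NormedAddCommGroup E] [NormedSpace ℝ E] (Ω : Set E) (φ : E → ℝ) : Prop :=
  ContDiff ℝ ∞ φ ∧ HasCompactSupport φ ∧ tsupport φ ⊆ Ω

/-- The derivative of `φ` in the direction `v`. -/
def pd {E : Type*} [NormedAddCommGroup E] [NormedSpace ℝ E] (v : E) (φ : E → ℝ) : E → ℝ :=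
  fun p => fderiv ℝ φ p v

/-! ### Sobolev norms -/

/-- `|f|_{H^s}^2 = ∫ (1 + |2πξ|^2)^s |f̂(ξ)|^2 dξ` for a real function `f ∈ L^2(ℝ^d)`
(Fourier transform `f̂(ξ) = ∫ exp(-2πi x·ξ) f(x) dx`, extended to `L^2`),
and `∞` if `f ∉ L^2(ℝ^d)`.  Used for `s ≥ 0` only. -/
def hsSq {d : ℕ} (s : ℝ) (f : Horiz d → ℝ) : ℝ≥0∞ :=
  open Classical in
  if h : MemLp (fun x => (f x : ℂ)) 2 volume then
    ∫⁻ ξ : Horiz d, ENNReal.ofReal ((1 + (2 * Real.pi * ‖ξ‖) ^ 2) ^ s) *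
      ‖(𝓕 (h.toLp (fun x => (f x : ℂ))) : Lp ℂ 2 (volume : Measure (Horiz d))) ξ‖ₑ ^ 2
  else ⊤

/-- `‖u‖_{H^{s,0}}^2 = ∫_{-H}^0 |u(·,z)|_{H^s}^2 dz`. -/
def hs0Sq {d : ℕ} (H s : ℝ) (u : Horiz d × ℝ → ℝ) : ℝ≥0∞ :=
  ∫⁻ z, hsSq s (fun x => u (x, z)) ∂(depthMeasure H)

/-- `u ∈ H^{s,0} = L^2((-H,0); H^s(ℝ^d))`. -/
def MemHs0 {d : ℕ} (H s : ℝ) (u : Horiz d × ℝ → ℝ) : Prop :=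
  MemLp u 2 (stripMeasure d H) ∧ hs0Sq H s u < ⊤

/-- `u ∈ C([0,T]; H^s(ℝ^d))`. -/
def ContHs {d : ℕ} (T s : ℝ) (u : ℝ → Horiz d → ℝ) : Prop :=
  (∀ t ∈ Icc 0 T, hsSq s (u t) < ⊤) ∧
  ∀ t₀ ∈ Icc 0 T, Tendsto (fun t => hsSq s (u t - u t₀)) (𝓝[Icc 0 T] t₀) (𝓝 0)

/-- `u ∈ C([0,T]; H^{s,0})`. -/
def ContHs0 {d : ℕ} (H T s : ℝ) (u : ℝ → Horiz d × ℝ → ℝ) : Prop :=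
  (∀ t ∈ Icc 0 T, MemHs0 H s (u t)) ∧
  ∀ t₀ ∈ Icc 0 T, Tendsto (fun t => hs0Sq H s (u t - u t₀)) (𝓝[Icc 0 T] t₀) (𝓝 0)

/-- `P ∈ L^1((0,T); L^2(ℝ^d × (-H,0)))`. -/
def MemL1L2 {d : ℕ} (H T : ℝ) (P : ℝ → Horiz d × ℝ → ℝ) : Prop :=
  AEStronglyMeasurable (fun q : ℝ × (Horiz d × ℝ) => P q.1 q.2)
    ((volume.restrict (Ioo 0 T)).prod (stripMeasure d H)) ∧
  ∫⁻ t in Ioo 0 T, eLpNorm (P t) 2 (stripMeasure d H) < ⊤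

/-! ### The stratification and the Sturm-Liouville modes -/

/-- `ρ_eq ∈ W^{1,∞}(-H,0)` (that is, `ρ_eq` is Lipschitz), `inf ρ_eq > 0`, and the Brunt-Väisälä
frequency is the constant `N`: `N^2 = -g ρ_eq' / ρ_eq` almost everywhere in `(-H,0)`. -/
structure IsStratification (H g N : ℝ) (ρeq : ℝ → ℝ) : Prop where
  lipschitz : ∃ K, LipschitzOnWith K ρeq (Ioo (-H) 0)
  pos : ∃ m > 0, ∀ z ∈ Ioo (-H) 0, m ≤ ρeq z
  brunt : ∀ᵐ z ∂(depthMeasure H), N ^ 2 = -(deriv ρeq z / ρeq z) * g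

/-- `(f_n)_{n ≥ 1}` is the orthonormal basis of `L^2((-H,0), ρ_eq N^2 dz)` made of the
eigenfunctions of `(ρ_eq f')' + (ρ_eq N^2 / c^2) f = 0`, `f(-H) = f(0) = 0`, with speeds
`c_1 > c_2 > ⋯ > 0`.  The entries `c 0` and `f 0` play no role. -/
structure IsModalBasis (H N : ℝ) (ρeq : ℝ → ℝ) (c : ℕ → ℝ) (f : ℕ → ℝ → ℝ) : Prop where
  speed_pos : ∀ n ≥ 1, 0 < c n
  speed_anti : ∀ m ≥ 1, ∀ n > m, c n < c m
  continuousOn : ∀ n ≥ 1, ContinuousOn (f n) (Icc (-H) 0)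
  differentiableAt : ∀ n ≥ 1, ∀ z ∈ Ioo (-H) 0, DifferentiableAt ℝ (f n) z
  eigen : ∀ n ≥ 1, ∀ z ∈ Ioo (-H) 0,
    HasDerivAt (fun y => ρeq y * deriv (f n) y) (-(ρeq z * N ^ 2 / c n ^ 2 * f n z)) z
  bottom : ∀ n ≥ 1, f n (-H) = 0
  top : ∀ n ≥ 1, f n 0 = 0
  orthonormal : ∀ m ≥ 1, ∀ n ≥ 1,
    ∫ z, f m z * f n z * (ρeq z * N ^ 2) ∂(depthMeasure H) = if m = n then 1 else 0
  complete : ∀ h : ℝ → ℝ, MemLp h 2 (depthMeasure H) →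
    (∀ n ≥ 1, ∫ z, h z * f n z * (ρeq z * N ^ 2) ∂(depthMeasure H) = 0) →
    h =ᵐ[depthMeasure H] 0

/-- `g_0 = α / ρ_eq` with `α = (∫_{-H}^0 1/ρ_eq)^{-1/2}`, and `g_n = c_n f_n'` for `n ≥ 1`. -/
def gMode (H : ℝ) (ρeq : ℝ → ℝ) (c : ℕ → ℝ) (f : ℕ → ℝ → ℝ) (n : ℕ) (z : ℝ) : ℝ :=
  if n = 0 then (Real.sqrt (∫ y, (ρeq y)⁻¹ ∂(depthMeasure H)))⁻¹ * (ρeq z)⁻¹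
  else c n * deriv (f n) z

/-! ### Modal coefficients

Coefficients in the expansions `V = ∑ V_n g_n`, `w = ∑ w_n f_n`,
`ρ = ∑ (1/g) ρ_n ρ_eq N^2 f_n`, `P = ∑ P_n ρ_eq g_n`, in which `(g_n)`, `(f_n)`,
`(ρ_eq N^2 f_n)`, `(ρ_eq g_n)` are orthonormal for the weights `ρ_eq`, `ρ_eq N^2`,
`(ρ_eq N^2)⁻¹`, `ρ_eq⁻¹` respectively. -/

/-- `(u(x,·), e)_{L^2((-H,0), ϖ dz)}`. -/
def coeff {d : ℕ} (H : ℝ) (ϖ e : ℝ → ℝ) (u : Horiz d × ℝ → ℝ) (x : Horiz d) : ℝ :=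
  ∫ z, u (x, z) * e z * ϖ z ∂(depthMeasure H)

/-- `V_n`, component by component. -/
def coeffV {d : ℕ} (H : ℝ) (ρeq : ℝ → ℝ) (c : ℕ → ℝ) (f : ℕ → ℝ → ℝ) (n : ℕ)
    (V : Horiz d × ℝ → Horiz d) (j : Fin d) : Horiz d → ℝ :=
  coeff H ρeq (gMode H ρeq c f n) (fun q => V q j)

/-- `w_n`. -/
def coeffW {d : ℕ} (H N : ℝ) (ρeq : ℝ → ℝ) (f : ℕ → ℝ → ℝ) (n : ℕ)
    (w : Horiz d × ℝ → ℝ) : Horiz d → ℝ :=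
  coeff H (fun z => ρeq z * N ^ 2) (f n) w

/-- `ρ_n`. -/
def coeffR {d : ℕ} (H g N : ℝ) (ρeq : ℝ → ℝ) (f : ℕ → ℝ → ℝ) (n : ℕ)
    (ρ : Horiz d × ℝ → ℝ) : Horiz d → ℝ :=
  coeff H (fun z => (ρeq z * N ^ 2)⁻¹) (fun z => ρeq z * N ^ 2 * f n z) (fun q => g * ρ q)

/-- `P_n`. -/
def coeffP {d : ℕ} (H : ℝ) (ρeq : ℝ → ℝ) (c : ℕ → ℝ) (f : ℕ → ℝ → ℝ) (n : ℕ)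
    (P : Horiz d × ℝ → ℝ) : Horiz d → ℝ :=
  coeff H (fun z => (ρeq z)⁻¹) (fun z => ρeq z * gMode H ρeq c f n z) P

/-! ### The linearized equations in the strip -/

/-- `∂_i V_j - ∂_j V_i = 0` in the sense of distributions in `ℝ^d × (-H,0)`: the vertical component
of the vorticity vanishes (an empty condition if `d = 1`). -/
def ZeroVerticalVorticity {d : ℕ} (H : ℝ) (V : Horiz d × ℝ → Horiz d) : Prop :=
  ∀ i j : Fin d, ∀ φ : Horiz d × ℝ → ℝ, IsTest (univ ×ˢ Ioo (-H) 0) φ →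
    ∫ q, (V q j * pd (unitVec i, 0) φ q - V q i * pd (unitVec j, 0) φ q) ∂(stripMeasure d H) = 0

/-- Weak solutions on `[0,T]` of
`ρ_eq ∂_t V + ∇P = 0`, `ρ_eq ∂_t w + ∂_z P + g ρ = 0`, `∂_t ρ + ρ_eq' w = 0`,
`∇·V + ∂_z w = 0`, with `w = 0` on `z = -H` and `z = 0`.
The first three equations hold in the sense of distributions in `(0,T) × ℝ^d × (-H,0)`, the fourth
one in `ℝ^d × (-H,0)` for every `t ∈ [0,T]`.  The boundary condition is Green's formula: as
`V` and `w` are in `L^2` and `∇·V + ∂_z w = 0`, the traces of `w` on `z = -H` and `z = 0` vanish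
if and only if `∫ (V·∇φ + w ∂_z φ) = 0` also for the test functions `φ` that do not vanish there. -/
structure SolvesLinearized {d : ℕ} (H g T : ℝ) (ρeq : ℝ → ℝ) (V : ℝ → Horiz d × ℝ → Horiz d)
    (w ρ P : ℝ → Horiz d × ℝ → ℝ) : Prop where
  horizontal_momentum : ∀ j : Fin d, ∀ φ : ℝ × (Horiz d × ℝ) → ℝ,
    IsTest (Ioo 0 T ×ˢ (univ ×ˢ Ioo (-H) 0)) φ →
    ∫ t in Ioo 0 T, ∫ q, (ρeq q.2 * V t q j * pd (1, (0, 0)) φ (t, q)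
      + P t q * pd (0, (unitVec j, 0)) φ (t, q)) ∂(stripMeasure d H) = 0
  vertical_momentum : ∀ φ : ℝ × (Horiz d × ℝ) → ℝ,
    IsTest (Ioo 0 T ×ˢ (univ ×ˢ Ioo (-H) 0)) φ →
    ∫ t in Ioo 0 T, ∫ q, (ρeq q.2 * w t q * pd (1, (0, 0)) φ (t, q)
      + P t q * pd (0, (0, 1)) φ (t, q) - g * ρ t q * φ (t, q)) ∂(stripMeasure d H) = 0
  mass : ∀ φ : ℝ × (Horiz d × ℝ) → ℝ,
    IsTest (Ioo 0 T ×ˢ (univ ×ˢ Ioo (-H) 0)) φ →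
    ∫ t in Ioo 0 T, ∫ q, (ρ t q * pd (1, (0, 0)) φ (t, q)
      - w t q * deriv ρeq q.2 * φ (t, q)) ∂(stripMeasure d H) = 0
  incompressible : ∀ t ∈ Icc 0 T, ∀ φ : Horiz d × ℝ → ℝ, IsTest (univ ×ˢ Ioo (-H) 0) φ →
    ∫ q, (∑ j, V t q j * pd (unitVec j, 0) φ q + w t q * pd (0, 1) φ q) ∂(stripMeasure d H) = 0
  impermeable : ∀ t ∈ Icc 0 T, ∀ φ : Horiz d × ℝ → ℝ, IsTest univ φ →
    ∫ q, (∑ j, V t q j * pd (unitVec j, 0) φ q + w t q * pd (0, 1) φ q) ∂(stripMeasure d H) = 0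

/-! ### The equations for the modes, on `(0,T) × ℝ^d` -/

/-- `(1 - (c^2/N^2) Δ) ∂_t V + c ∇ρ = 0` and `∂_t ρ + c ∇·V = 0` in the sense of distributions in
`(0,T) × ℝ^d`. -/
structure SolvesBoussinesq {d : ℕ} (T N c : ℝ) (V : ℝ → Fin d → Horiz d → ℝ)
    (ρ : ℝ → Horiz d → ℝ) : Prop where
  momentum : ∀ j : Fin d, ∀ φ : ℝ × Horiz d → ℝ, IsTest (Ioo 0 T ×ˢ univ) φ →
    ∫ t in Ioo 0 T, ∫ x, (V t j x * (pd (1, 0) φ (t, x)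
        - c ^ 2 / N ^ 2 * ∑ k, pd (0, unitVec k) (pd (0, unitVec k) (pd (1, 0) φ)) (t, x))
      + c * ρ t x * pd (0, unitVec j) φ (t, x)) = 0
  mass : ∀ φ : ℝ × Horiz d → ℝ, IsTest (Ioo 0 T ×ˢ univ) φ →
    ∫ t in Ioo 0 T, ∫ x, (ρ t x * pd (1, 0) φ (t, x)
      + c * ∑ j, V t j x * pd (0, unitVec j) φ (t, x)) = 0

/-- `w = a ∇·V` in the sense of distributions in `ℝ^d`. -/
def EqMulDiv {d : ℕ} (a : ℝ) (V : Fin d → Horiz d → ℝ) (w : Horiz d → ℝ) : Prop :=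
  ∀ φ : Horiz d → ℝ, IsTest univ φ →
    ∫ x, w x * φ x = -(a * ∫ x, ∑ j, V j x * pd (unitVec j) φ x)

/-- `P = c ρ + (c/N^2) ∂_t w` in the sense of distributions in `(0,T) × ℝ^d`. -/
def PressureLaw {d : ℕ} (T N c : ℝ) (ρ w P : ℝ → Horiz d → ℝ) : Prop :=
  ∀ φ : ℝ × Horiz d → ℝ, IsTest (Ioo 0 T ×ˢ univ) φ →
    ∫ t in Ioo 0 T, ∫ x, P t x * φ (t, x)
      = ∫ t in Ioo 0 T, ∫ x, (c * ρ t x * φ (t, x) - c / N ^ 2 * w t x * pd (1, 0) φ (t, x))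

end InternalWaves

end

open InternalWaves

noncomputable section

namespace InternalWaves

/-! ### Slices and weighted averages of square integrable functions on a product -/

section Slices

variable {X Z : Type*} [MeasurableSpace X] [MeasurableSpace Z] {μ : Measure X} {ν : Measure Z}

/-! Since `N` is constant, `ρeq` solves `ρeq' = -β ρeq` with `β = N ^ 2 / g`, so it is an
exponential `A e^{-βz}` (`IsStratification.exists_eq_exp`). The mode equation then has constant
coefficients, and each `f n` is the restriction of a function `F` smooth on the whole line
(`IsModalBasis.exists_smoothMode`). Multiplied by cutoffs in `z`, the modes become admissible test
functions.

Testing the equations with `φ(t,x) κ(z)` gives equations in `(t,x)` for vertical averages. In the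
horizontal momentum and mass equations no derivative falls on `κ`, so removing the cutoff is
harmless. In the vertical momentum equation `κ'` is paired with `P`; there `κ` has to vanish at both
ends, as the modes do. Green's formula gives the divergence equation for every smooth `κ`.

Write `v, y, r, p` for the integrals in `z` of `ρeq F' V`, `ρeq F w`, `F ρ`, `F' P`. The eigenvalue
equation `(ρeq F')' = -(N²/c²) ρeq F` closes the system (`SolvesLinearized.modalSystem`): `∂ₜv + ∇p
= 0`, `p = ∂ₜy + g r`, `∂ₜr = β y`, `y = -(c²/N²) ∇·v`. Moreover `v` stays curl free, because `∂ₜv`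
is a gradient (`SolvesLinearized.avg_curl`), so that `∇(∇·v) = Δv`. Eliminating `p` and `y` gives
the Boussinesq system for `Vₙ = c v`, `ρₙ = g r`; `wₙ = N² y` and `Pₙ = c p` give the two remaining
laws.

For `n = 0` the choice `κ = 1/ρeq` makes `ρeq κ = 1`, whose derivative is zero: the barotropic
velocity is divergence free and curl free, hence harmonic, and a harmonic function in `L²(ℝ^d)`
vanishes (`ae_eq_zero_of_weakly_harmonic`). Then `∇P₀ = 0`, and `P₀` is harmonic in its turn.

Continuity in time and summability in `H^s` both come from Bessel's inequality for `L²`-valued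
functions of `z`, applied to truncated Fourier multipliers (`sum_hsSq_coeff_le`). -/

lemma enorm_integral_mul_le {f g : X → ℝ} (hf : AEStronglyMeasurable f μ)
    (hg : AEStronglyMeasurable g μ) :
    ‖∫ x, f x * g x ∂μ‖ₑ ≤ eLpNorm f 2 μ * eLpNorm g 2 μ := by
  refine (enorm_integral_le_lintegral_enorm _).trans ?_
  rw [← eLpNorm_one_eq_lintegral_enorm]
  have h : eLpNorm (f • g) 1 μ ≤ eLpNorm f 2 μ * eLpNorm g 2 μ :=
    eLpNorm_smul_le_mul_eLpNorm hg hf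
  exact h

lemma eLpNorm_two_sq {E : Type*} [NormedAddCommGroup E] (f : X → E) :
    eLpNorm f 2 μ ^ 2 = ∫⁻ x, ‖f x‖ₑ ^ 2 ∂μ := by
  have := eLpNorm_nnreal_pow_eq_lintegral (f := f) (μ := μ) (p := 2) (by norm_num)
  simpa using this

lemma integrable_mul_of_memLp_two {𝕜 : Type*} [RCLike 𝕜] {f g : X → 𝕜} (hf : MemLp f 2 μ)
    (hg : MemLp g 2 μ) : Integrable (fun x => f x * g x) μ :=
  memLp_one_iff_integrable.1 (hg.mul (r := 1) hf)

variable {𝕜 : Type*} [RCLike 𝕜]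

lemma memLp_slice_right [SFinite ν] [SFinite μ] {u : X × Z → 𝕜} (hu : MemLp u 2 (μ.prod ν)) :
    ∀ᵐ x ∂μ, MemLp (fun z => u (x, z)) 2 ν := by
  have h1 := hu.1.prodMk_left
  have h2 := ((memLp_two_iff_integrable_sq_norm hu.1).1 hu).prod_right_ae
  filter_upwards [h1, h2] with x hx1 hx2
  exact (memLp_two_iff_integrable_sq_norm hx1).2 hx2

lemma memLp_slice_left [SFinite ν] [SFinite μ] {u : X × Z → 𝕜} (hu : MemLp u 2 (μ.prod ν)) :
    ∀ᵐ z ∂ν, MemLp (fun x => u (x, z)) 2 μ := by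
  have hu' : MemLp (fun p : Z × X => u p.swap) 2 (ν.prod μ) :=
    hu.comp_measurePreserving Measure.measurePreserving_swap
  exact memLp_slice_right hu'

/-- Cauchy–Schwarz in `z` on almost every slice, then integration in `x`. -/
lemma memLp_slice_integral [SFinite ν] [SFinite μ] {u : X × Z → ℝ} (hu : MemLp u 2 (μ.prod ν))
    {κ : Z → ℝ} (hκ : MemLp κ 2 ν) : MemLp (fun x => ∫ z, u (x, z) * κ z ∂ν) 2 μ := by
  have hm : AEStronglyMeasurable (fun x => ∫ z, u (x, z) * κ z ∂ν) μ :=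
    (hu.1.mul (hκ.1.comp_snd)).integral_prod_right'
  refine ⟨hm, ?_⟩
  have key : eLpNorm (fun x => ∫ z, u (x, z) * κ z ∂ν) 2 μ ^ 2
      ≤ eLpNorm u 2 (μ.prod ν) ^ 2 * eLpNorm κ 2 ν ^ 2 := by
    rw [eLpNorm_two_sq, eLpNorm_two_sq u, lintegral_prod _ (hu.1.enorm.pow_const 2),
      ← lintegral_mul_const'' _ (hu.1.enorm.pow_const 2).lintegral_prod_right']
    refine lintegral_mono_ae ?_
    filter_upwards [hu.1.prodMk_left] with x hx
    rw [← eLpNorm_two_sq (fun z => u (x, z)), ← mul_pow]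
    gcongr
    exact enorm_integral_mul_le hx hκ.1
  have hfin : eLpNorm u 2 (μ.prod ν) ^ 2 * eLpNorm κ 2 ν ^ 2 < ⊤ :=
    ENNReal.mul_lt_top (ENNReal.pow_lt_top hu.2) (ENNReal.pow_lt_top hκ.2)
  by_contra h
  rw [not_lt, top_le_iff] at h
  rw [h] at key
  simp at key
  exact absurd key hfin.ne

lemma memLp_tensor [SFinite ν] [SFinite μ] {a : X → 𝕜} (ha : MemLp a 2 μ) {κ : Z → 𝕜}
    (hκ : MemLp κ 2 ν) : MemLp (fun q : X × Z => a q.1 * κ q.2) 2 (μ.prod ν) := by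
  have hm : AEStronglyMeasurable (fun q : X × Z => a q.1 * κ q.2) (μ.prod ν) :=
    ha.1.comp_fst.mul hκ.1.comp_snd
  rw [memLp_two_iff_integrable_sq_norm hm]
  simp only [norm_mul, mul_pow]
  exact ((memLp_two_iff_integrable_sq_norm ha.1).1 ha).mul_prod
    ((memLp_two_iff_integrable_sq_norm hκ.1).1 hκ)

lemma integrable_mul_tensor [SFinite ν] [SFinite μ] {u : X × Z → 𝕜} (hu : MemLp u 2 (μ.prod ν))
    {a : X → 𝕜} (ha : MemLp a 2 μ) {κ : Z → 𝕜} (hκ : MemLp κ 2 ν) :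
    Integrable (fun q => u q * (a q.1 * κ q.2)) (μ.prod ν) :=
  integrable_mul_of_memLp_two hu (memLp_tensor ha hκ)

lemma integral_mul_tensor [SFinite ν] [SFinite μ] {u : X × Z → 𝕜} (hu : MemLp u 2 (μ.prod ν))
    {a : X → 𝕜} (ha : MemLp a 2 μ) {κ : Z → 𝕜} (hκ : MemLp κ 2 ν) :
    ∫ q, u q * (a q.1 * κ q.2) ∂(μ.prod ν) = ∫ x, (∫ z, u (x, z) * κ z ∂ν) * a x ∂μ := by
  rw [integral_prod _ (integrable_mul_tensor hu ha hκ)]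
  congr 1 with x
  rw [← integral_mul_const]
  congr 1 with z
  ring

lemma integral_mul_tensor_symm [SFinite ν] [SFinite μ] {u : X × Z → 𝕜}
    (hu : MemLp u 2 (μ.prod ν)) {a : X → 𝕜} (ha : MemLp a 2 μ) {κ : Z → 𝕜} (hκ : MemLp κ 2 ν) :
    ∫ q, u q * (a q.1 * κ q.2) ∂(μ.prod ν) = ∫ z, (∫ x, u (x, z) * a x ∂μ) * κ z ∂ν := by
  rw [integral_prod_symm _ (integrable_mul_tensor hu ha hκ)]
  congr 1 with z
  rw [← integral_mul_const]
  congr 1 with x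
  ring

end Slices

/-! ### Bessel's inequality for Hilbert space valued functions -/

section Bessel

variable {X Z : Type*} [MeasurableSpace X] [MeasurableSpace Z] {μ : Measure X} {ν : Measure Z}

lemma ofReal_integral_le_lintegral_ofReal {h : Z → ℝ} (hh : Integrable h ν) :
    ENNReal.ofReal (∫ z, h z ∂ν) ≤ ∫⁻ z, ENNReal.ofReal (h z) ∂ν := by
  have h1 : ∫ z, h z ∂ν ≤ ∫ z, max (h z) 0 ∂ν :=
    integral_mono hh hh.pos_part fun z => le_max_left _ _
  refine (ENNReal.ofReal_le_ofReal h1).trans ?_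
  rw [ofReal_integral_eq_lintegral_ofReal hh.pos_part (ae_of_all _ fun z => le_max_right _ _)]
  simp [ENNReal.ofReal_max]

open Classical in
/-- The slice `u(·, z)` as an element of the complex space `L²`, and `0` if it is not in `L²`. -/
def sliceLp (μ : Measure X) (u : X × Z → ℝ) (z : Z) : Lp ℂ 2 μ :=
  if h : MemLp (fun x => (u (x, z) : ℂ)) 2 μ then h.toLp _ else 0

variable {K : Type*} [NormedAddCommGroup K] [InnerProductSpace ℂ K] [CompleteSpace K]

open scoped ComplexConjugate InnerProductSpace

/-- `T` is commuted with the average in `z` weakly: with `θ = T*ψ`, the product `⟪ψ, T u(·,z)⟫` is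
the scalar integral of `u(x,z)` against the conjugate of `θ`, and scalar Fubini suffices.
Measurability of `z ↦ T u(·,z)` as a Hilbert space valued map is never needed. -/
lemma norm_sq_clm_average_eq [SFinite ν] [SFinite μ] (T : Lp ℂ 2 μ →L[ℂ] K) {u : X × Z → ℝ}
    (hu : MemLp u 2 (μ.prod ν)) {κ : Z → ℝ} (hκ : MemLp κ 2 ν)
    (hn : MemLp (fun x => ((∫ z, u (x, z) * κ z ∂ν : ℝ) : ℂ)) 2 μ) :
    Integrable (fun z => ⟪T (hn.toLp _), T (sliceLp μ u z)⟫_ℂ * (κ z : ℂ)) ν ∧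
    ∫ z, ⟪T (hn.toLp _), T (sliceLp μ u z)⟫_ℂ * (κ z : ℂ) ∂ν = (‖T (hn.toLp _)‖ : ℂ) ^ 2 := by
  set ψ := T (hn.toLp _) with hψ
  set θ := ContinuousLinearMap.adjoint T ψ with hθ
  have hθ2 : MemLp (fun x => conj (θ x)) 2 μ := (Lp.memLp θ).star
  have hu' : MemLp (fun q => (u q : ℂ)) 2 (μ.prod ν) := hu.ofReal
  have hκ' : MemLp (fun z => (κ z : ℂ)) 2 ν := hκ.ofReal
  have hslice : ∀ᵐ z ∂ν, (∫ x, (u (x, z) : ℂ) * conj (θ x) ∂μ) = ⟪ψ, T (sliceLp μ u z)⟫_ℂ := by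
    filter_upwards [memLp_slice_left hu'] with z hz
    rw [← ContinuousLinearMap.adjoint_inner_left, ← hθ, L2.inner_def]
    refine integral_congr_ae ?_
    have : sliceLp μ u z = hz.toLp _ := by rw [sliceLp, dif_pos hz]
    rw [this]
    filter_upwards [hz.coeFn_toLp] with x hx
    rw [hx, RCLike.inner_apply]
  constructor
  · have h1 := (integrable_mul_tensor hu' hθ2 hκ').integral_prod_right
    refine h1.congr ?_
    filter_upwards [hslice] with z hz
    rw [← hz, ← integral_mul_const]
    congr 1 with x
    ring
  · have h1 := integral_mul_tensor_symm hu' hθ2 hκ'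
    rw [integral_mul_tensor hu' hθ2 hκ'] at h1
    have h2 : ∫ z, ⟪ψ, T (sliceLp μ u z)⟫_ℂ * (κ z : ℂ) ∂ν
        = ∫ z, (∫ x, (u (x, z) : ℂ) * conj (θ x) ∂μ) * (κ z : ℂ) ∂ν := by
      refine integral_congr_ae ?_
      filter_upwards [hslice] with z hz
      rw [hz]
    rw [h2, ← h1]
    have h3 : ⟪ψ, ψ⟫_ℂ = ⟪θ, hn.toLp _⟫_ℂ := by
      rw [hθ, ContinuousLinearMap.adjoint_inner_left]
    have h4 : (‖ψ‖ : ℂ) ^ 2 = ⟪ψ, ψ⟫_ℂ := (inner_self_eq_norm_sq_to_K ψ).symm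
    rw [h4, h3, L2.inner_def]
    refine integral_congr_ae ?_
    filter_upwards [hn.coeFn_toLp] with x hx
    rw [hx, RCLike.inner_apply, ← integral_complex_ofReal]
    simp only [Complex.ofReal_mul]

/-- Bessel's inequality. With `ψ n` the image of the `n`-th average, `W z` that of the slice and `G
= ∑ eₙ ψ n`, both `∫ Re⟪G, W⟫ ϖ` and `∫ ‖G‖² ϖ` equal `A = ∑ ‖ψ n‖²`. Since `Re⟪G, W⟫ ≤ (‖G‖² +
‖W‖²)/2`, this gives `A ≤ A/2 + ½ ∫ ‖W‖² ϖ`. -/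
theorem sum_enorm_sq_clm_average_le [SFinite ν] [SFinite μ] (T : Lp ℂ 2 μ →L[ℂ] K)
    {u : X × Z → ℝ} (hu : MemLp u 2 (μ.prod ν)) {ι : Type*} [DecidableEq ι] (S : Finset ι)
    {ϖ : Z → ℝ} (hϖ : ∀ᵐ z ∂ν, 0 ≤ ϖ z) (e : ι → Z → ℝ)
    (hκ : ∀ n ∈ S, MemLp (fun z => e n z * ϖ z) 2 ν)
    (hint : ∀ m ∈ S, ∀ n ∈ S, Integrable (fun z => e m z * e n z * ϖ z) ν)
    (horth : ∀ m ∈ S, ∀ n ∈ S, ∫ z, e m z * e n z * ϖ z ∂ν = if m = n then 1 else 0)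
    (hn : ∀ n, MemLp (fun x => ((∫ z, u (x, z) * (e n z * ϖ z) ∂ν : ℝ) : ℂ)) 2 μ) :
    ∑ n ∈ S, ‖T ((hn n).toLp _)‖ₑ ^ 2 ≤ ∫⁻ z, ‖T (sliceLp μ u z)‖ₑ ^ 2 * ENNReal.ofReal (ϖ z) ∂ν := by
  set ψ : ι → K := fun n => T ((hn n).toLp _) with hψ
  set W : Z → K := fun z => T (sliceLp μ u z) with hW
  set A : ℝ := ∑ n ∈ S, ‖ψ n‖ ^ 2 with hA
  have hA0 : 0 ≤ A := Finset.sum_nonneg fun n _ => by positivity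
  have hlhs : ∑ n ∈ S, ‖ψ n‖ₑ ^ 2 = ENNReal.ofReal A := by
    rw [hA, ENNReal.ofReal_sum_of_nonneg (fun n _ => by positivity)]
    refine Finset.sum_congr rfl fun n _ => ?_
    rw [← ofReal_norm, ENNReal.ofReal_pow (norm_nonneg _)]
  set G : Z → K := fun z => ∑ n ∈ S, (e n z : ℂ) • ψ n with hG
  set h : Z → ℝ := fun z => RCLike.re ⟪G z, W z⟫_ℂ * ϖ z with hh
  have hterm : ∀ z, h z = ∑ n ∈ S, RCLike.re (⟪ψ n, W z⟫_ℂ * ((e n z * ϖ z : ℝ) : ℂ)) := by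
    intro z
    simp only [hh, hG, sum_inner, inner_smul_left, map_sum, Finset.sum_mul]
    refine Finset.sum_congr rfl fun n _ => ?_
    simp
    ring
  have hI : Integrable h ν := by
    have : h = fun z => ∑ n ∈ S, RCLike.re (⟪ψ n, W z⟫_ℂ * ((e n z * ϖ z : ℝ) : ℂ)) :=
      funext hterm
    rw [this]
    exact integrable_finsetSum _ fun n hnS => (norm_sq_clm_average_eq T hu (hκ n hnS) (hn n)).1.re
  have hval : ∫ z, h z ∂ν = A := by
    simp only [hterm]
    rw [integral_finsetSum _ fun n hnS => (norm_sq_clm_average_eq T hu (hκ n hnS) (hn n)).1.re]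
    refine Finset.sum_congr rfl fun n hnS => ?_
    have h1 := norm_sq_clm_average_eq T hu (hκ n hnS) (hn n)
    rw [integral_re h1.1, h1.2]
    simp [ψ, ← Complex.ofReal_pow]
  have hGsq : ∀ z, ‖G z‖ ^ 2 * ϖ z
      = ∑ m ∈ S, ∑ n ∈ S, (e m z * e n z * ϖ z) * RCLike.re ⟪ψ m, ψ n⟫_ℂ := by
    intro z
    rw [← inner_self_eq_norm_sq (𝕜 := ℂ)]
    simp only [hG, sum_inner, inner_sum, inner_smul_left, inner_smul_right, Finset.mul_sum,
      map_sum, Finset.sum_mul]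
    refine Finset.sum_congr rfl fun m _ => Finset.sum_congr rfl fun n _ => ?_
    rw [inner_re_symm (ψ m)]
    simp
    ring
  have hGI : Integrable (fun z => ‖G z‖ ^ 2 * ϖ z) ν := by
    simp only [hGsq]
    exact integrable_finsetSum _ fun m hm => integrable_finsetSum _ fun n hnS =>
      (hint m hm n hnS).mul_const _
  have hGval : ∫ z, ‖G z‖ ^ 2 * ϖ z ∂ν = A := by
    simp only [hGsq]
    rw [integral_finsetSum _ fun m hm => integrable_finsetSum _ fun n hnS =>
      (hint m hm n hnS).mul_const _]
    refine Finset.sum_congr rfl fun m hm => ?_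
    rw [integral_finsetSum _ fun n hnS => (hint m hm n hnS).mul_const _]
    rw [Finset.sum_eq_single_of_mem m hm]
    · rw [integral_mul_const, horth m hm m hm, if_pos rfl, one_mul]
      exact inner_self_eq_norm_sq (𝕜 := ℂ) _
    · intro n hnS hne
      rw [integral_mul_const, horth m hm n hnS, if_neg (Ne.symm hne), zero_mul]
  -- The term in `W` stays a lower integral, possibly infinite; the sum is split using the
  -- measurability of the term in `G` alone.
  have hle : ENNReal.ofReal A ≤ ENNReal.ofReal (A / 2)
      + (1 / 2) * ∫⁻ z, ‖W z‖ₑ ^ 2 * ENNReal.ofReal (ϖ z) ∂ν := by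
    calc ENNReal.ofReal A = ENNReal.ofReal (∫ z, h z ∂ν) := by rw [hval]
      _ ≤ ∫⁻ z, ENNReal.ofReal (h z) ∂ν := ofReal_integral_le_lintegral_ofReal hI
      _ ≤ ∫⁻ z, (ENNReal.ofReal (‖G z‖ ^ 2 * ϖ z / 2)
          + (1 / 2) * (‖W z‖ₑ ^ 2 * ENNReal.ofReal (ϖ z))) ∂ν := by
        refine lintegral_mono_ae ?_
        filter_upwards [hϖ] with z hz
        have e1 : (1 / 2 : ℝ≥0∞) * (‖W z‖ₑ ^ 2 * ENNReal.ofReal (ϖ z))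
            = ENNReal.ofReal (‖W z‖ ^ 2 * ϖ z / 2) := by
          rw [div_eq_inv_mul, ENNReal.ofReal_mul (by positivity),
            ENNReal.ofReal_mul (by positivity), ENNReal.ofReal_pow (norm_nonneg _), ofReal_norm,
            ENNReal.ofReal_inv_of_pos (by norm_num)]
          simp
        rw [e1, ← ENNReal.ofReal_add (by positivity) (by positivity)]
        refine ENNReal.ofReal_le_ofReal ?_
        have h1 : RCLike.re ⟪G z, W z⟫_ℂ ≤ ‖G z‖ * ‖W z‖ := re_inner_le_norm _ _
        have h2 : RCLike.re ⟪G z, W z⟫_ℂ ≤ (‖G z‖ ^ 2 + ‖W z‖ ^ 2) / 2 := by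
          nlinarith [sq_nonneg (‖G z‖ - ‖W z‖)]
        have := mul_le_mul_of_nonneg_right h2 hz
        simp only [hh]
        linarith
      _ = _ := by
        rw [lintegral_add_left' (hGI.div_const 2).1.aemeasurable.ennreal_ofReal,
          lintegral_const_mul' _ _ (by simp),
          ← ofReal_integral_eq_lintegral_ofReal (hGI.div_const 2), integral_div, hGval]
        filter_upwards [hϖ] with z hz
        positivity
  rw [hlhs]
  have h3 : ENNReal.ofReal A = ENNReal.ofReal (A / 2) + ENNReal.ofReal (A / 2) := by
    rw [← ENNReal.ofReal_add (by positivity) (by positivity)]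
    congr 1
    ring
  rw [h3] at hle
  have h4 := (ENNReal.add_le_add_iff_left ENNReal.ofReal_ne_top).1 hle
  have h5 : ENNReal.ofReal A = 2 * ENNReal.ofReal (A / 2) := by rw [h3, two_mul]
  rw [h5]
  calc 2 * ENNReal.ofReal (A / 2)
      ≤ 2 * ((1 / 2) * ∫⁻ z, ‖W z‖ₑ ^ 2 * ENNReal.ofReal (ϖ z) ∂ν) := by gcongr
    _ = _ := by
      rw [← mul_assoc, one_div, ENNReal.mul_inv_cancel (by norm_num) (by norm_num), one_mul]

end Bessel

/-! ### Sobolev norms of modal coefficients -/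

section Sobolev

variable {d : ℕ}

/-- The Sobolev weight `(1 + |2πξ|^2)^s`. -/
def sobolevWeight (d : ℕ) (s : ℝ) (ξ : Horiz d) : ℝ := (1 + (2 * Real.pi * ‖ξ‖) ^ 2) ^ s

lemma sobolevWeight_pos (s : ℝ) (ξ : Horiz d) : 0 < sobolevWeight d s ξ := by
  unfold sobolevWeight; positivity

lemma continuous_sobolevWeight (s : ℝ) : Continuous (sobolevWeight d s) := by
  unfold sobolevWeight
  refine Continuous.rpow_const (by fun_prop) fun ξ => Or.inl ?_
  positivity

lemma one_le_sobolevWeight {s : ℝ} (hs : 0 ≤ s) (ξ : Horiz d) : 1 ≤ sobolevWeight d s ξ :=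
  Real.one_le_rpow (by nlinarith [sq_nonneg (2 * Real.pi * ‖ξ‖)]) hs

/-- The square root of the Sobolev weight, truncated to a ball. -/
def truncWeight (d : ℕ) (s : ℝ) (R : ℕ) : Horiz d → ℂ :=
  (Metric.closedBall 0 R).indicator fun ξ => (Real.sqrt (sobolevWeight d s ξ) : ℂ)

lemma memLp_truncWeight (s : ℝ) (R : ℕ) : MemLp (truncWeight d s R) ⊤ volume := by
  have hc : Continuous fun ξ : Horiz d => (Real.sqrt (sobolevWeight d s ξ) : ℂ) :=
    Complex.continuous_ofReal.comp (continuous_sobolevWeight s).sqrt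
  obtain ⟨C, hC⟩ := (isCompact_closedBall (0 : Horiz d) R).exists_bound_of_continuousOn
    hc.continuousOn
  refine memLp_top_of_bound
    (hc.aestronglyMeasurable.indicator Metric.isClosed_closedBall.measurableSet) (max C 0)
    (ae_of_all _ fun ξ => ?_)
  unfold truncWeight
  by_cases h : ξ ∈ Metric.closedBall (0 : Horiz d) R
  · rw [indicator_of_mem h]
    exact (hC ξ h).trans (le_max_left _ _)
  · rw [indicator_of_notMem h]
    simp

/-- The truncated Fourier multiplier `f ↦ (1 + |2πξ|^2)^{s/2} 1_{|ξ| ≤ R} f̂`. -/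
def truncMultiplier (d : ℕ) (s : ℝ) (R : ℕ) :
    Lp ℂ 2 (volume : Measure (Horiz d)) →L[ℂ] Lp ℂ 2 (volume : Measure (Horiz d)) :=
  (ContinuousLinearMap.holderL volume ⊤ 2 2 (ContinuousLinearMap.mul ℂ ℂ)
    ((memLp_truncWeight s R).toLp _)).comp
    (Lp.fourierTransformₗᵢ (Horiz d) ℂ).toContinuousLinearEquiv.toContinuousLinearMap

lemma enorm_sq_Lp_two {X : Type*} [MeasurableSpace X] {μ : Measure X} (f : Lp ℂ 2 μ) :
    ‖f‖ₑ ^ 2 = ∫⁻ x, ‖f x‖ₑ ^ 2 ∂μ := by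
  rw [Lp.enorm_def, eLpNorm_two_sq]

lemma enorm_sq_truncMultiplier (s : ℝ) (R : ℕ) (f : Lp ℂ 2 (volume : Measure (Horiz d))) :
    ‖truncMultiplier d s R f‖ₑ ^ 2
      = ∫⁻ ξ, (Metric.closedBall 0 (R : ℝ)).indicator (fun ξ => ENNReal.ofReal (sobolevWeight d s ξ)
        * ‖(𝓕 f : Lp ℂ 2 (volume : Measure (Horiz d))) ξ‖ₑ ^ 2) ξ := by
  rw [enorm_sq_Lp_two]
  refine lintegral_congr_ae ?_
  have h1 := (ContinuousLinearMap.mul ℂ ℂ).coeFn_holder (r := 2)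
    ((memLp_truncWeight (d := d) s R).toLp _) (𝓕 f : Lp ℂ 2 (volume : Measure (Horiz d)))
  filter_upwards [h1, (memLp_truncWeight (d := d) s R).coeFn_toLp] with ξ h1 h2
  have h3 : truncMultiplier d s R f = (ContinuousLinearMap.mul ℂ ℂ).holder 2
    ((memLp_truncWeight (d := d) s R).toLp _) (𝓕 f : Lp ℂ 2 (volume : Measure (Horiz d))) := rfl
  rw [h3, h1, h2]
  unfold truncWeight
  by_cases h : ξ ∈ Metric.closedBall (0 : Horiz d) R
  · rw [indicator_of_mem h, indicator_of_mem h, ContinuousLinearMap.mul_apply', enorm_mul, mul_pow]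
    congr 1
    rw [← ofReal_norm, Complex.norm_real, Real.norm_of_nonneg (Real.sqrt_nonneg _),
      ← ENNReal.ofReal_pow (Real.sqrt_nonneg _), Real.sq_sqrt (sobolevWeight_pos s ξ).le]
  · rw [indicator_of_notMem h, indicator_of_notMem h]
    simp

lemma monotone_truncMultiplier (s : ℝ) (f : Lp ℂ 2 (volume : Measure (Horiz d))) :
    Monotone fun R => ‖truncMultiplier d s R f‖ₑ ^ 2 := by
  intro R R' h
  simp only [enorm_sq_truncMultiplier]
  refine lintegral_mono fun ξ => ?_
  exact indicator_le_indicator_of_subset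
    (Metric.closedBall_subset_closedBall (by exact_mod_cast h)) (fun _ => zero_le) ξ

lemma iSup_truncMultiplier (s : ℝ) (f : Lp ℂ 2 (volume : Measure (Horiz d))) :
    ⨆ R, ‖truncMultiplier d s R f‖ₑ ^ 2 = ∫⁻ ξ, ENNReal.ofReal (sobolevWeight d s ξ)
        * ‖(𝓕 f : Lp ℂ 2 (volume : Measure (Horiz d))) ξ‖ₑ ^ 2 := by
  simp only [enorm_sq_truncMultiplier]
  rw [← lintegral_iSup']
  · refine lintegral_congr fun ξ => le_antisymm (iSup_le fun R => indicator_le_self _ _ _) ?_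
    obtain ⟨R, hR⟩ := exists_nat_ge ‖ξ‖
    refine le_iSup_of_le R ?_
    rw [indicator_of_mem (by simpa using hR)]
  · intro R
    refine AEMeasurable.indicator ?_ Metric.isClosed_closedBall.measurableSet
    exact (continuous_sobolevWeight s).measurable.ennreal_ofReal.aemeasurable.mul
      ((Lp.aestronglyMeasurable _).enorm.pow_const 2)
  · refine ae_of_all _ fun ξ R R' h => ?_
    exact indicator_le_indicator_of_subset
      (Metric.closedBall_subset_closedBall (by exact_mod_cast h)) (fun _ => zero_le) ξ

/-- The `H^s` norm is not a bounded functional on `L²`, so it is reached as an increasing limit of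
norms of bounded multipliers, to each of which Bessel's inequality applies; the limit is monotone
convergence. -/
lemma hsSq_eq_iSup (s : ℝ) {f : Horiz d → ℝ} (hf : MemLp (fun x => (f x : ℂ)) 2 volume) :
    hsSq s f = ⨆ R, ‖truncMultiplier d s R (hf.toLp _)‖ₑ ^ 2 := by
  rw [iSup_truncMultiplier, hsSq, dif_pos hf]
  rfl

lemma hsSq_congr (s : ℝ) {f h : Horiz d → ℝ} (hfh : f =ᵐ[volume] h) : hsSq s f = hsSq s h := by
  have hc : (fun x => (f x : ℂ)) =ᵐ[volume] fun x => (h x : ℂ) := by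
    filter_upwards [hfh] with x hx
    rw [hx]
  by_cases hf : MemLp (fun x => (f x : ℂ)) 2 volume
  · have hh := (memLp_congr_ae hc).1 hf
    rw [hsSq, hsSq, dif_pos hf, dif_pos hh, (MemLp.toLp_eq_toLp_iff hf hh).2 hc]
  · have hh : ¬ MemLp (fun x => (h x : ℂ)) 2 volume := fun hh => hf ((memLp_congr_ae hc).2 hh)
    rw [hsSq, hsSq, dif_neg hf, dif_neg hh]

lemma eLpNorm_sq_le_hsSq {s : ℝ} (hs : 0 ≤ s) (f : Horiz d → ℝ) :
    eLpNorm f 2 volume ^ 2 ≤ hsSq s f := by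
  by_cases hf : MemLp (fun x => (f x : ℂ)) 2 volume
  · have h1 : eLpNorm f 2 volume ^ 2 = ‖hf.toLp _‖ₑ ^ 2 := by
      rw [Lp.enorm_toLp, eLpNorm_two_sq, eLpNorm_two_sq]
      refine lintegral_congr fun x => ?_
      rw [← ofReal_norm, ← ofReal_norm, Complex.norm_real]
    have h2 : ‖hf.toLp _‖ₑ = ‖(𝓕 (hf.toLp (fun x => (f x : ℂ))) :
        Lp ℂ 2 (volume : Measure (Horiz d)))‖ₑ := by
      rw [← ofReal_norm, ← ofReal_norm, Lp.norm_fourier_eq]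
    rw [h1, h2, enorm_sq_Lp_two, hsSq, dif_pos hf]
    refine lintegral_mono fun ξ => ?_
    refine le_mul_of_one_le_left (zero_le) ?_
    rw [← ENNReal.ofReal_one]
    exact ENNReal.ofReal_le_ofReal (one_le_sobolevWeight hs ξ)
  · rw [hsSq, dif_neg hf]
    exact le_top

lemma eLpNorm_sq_le_hs0Sq {H s : ℝ} (hs : 0 ≤ s) {u : Horiz d × ℝ → ℝ}
    (hu : AEStronglyMeasurable u (stripMeasure d H)) :
    eLpNorm u 2 (stripMeasure d H) ^ 2 ≤ hs0Sq H s u := by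
  rw [eLpNorm_two_sq, lintegral_prod_symm _ (hu.enorm.pow_const 2)]
  refine lintegral_mono fun z => ?_
  rw [← eLpNorm_two_sq (fun x => u (x, z))]
  exact eLpNorm_sq_le_hsSq hs _

/-- The two default values agree with the inequality: on a slice outside `L²` the left side is `0`
and the right side is `∞`. -/
lemma sliceLp_enorm_le_hsSq (s : ℝ) (R : ℕ) (u : Horiz d × ℝ → ℝ) (z : ℝ) :
    ‖truncMultiplier d s R (sliceLp volume u z)‖ₑ ^ 2 ≤ hsSq s (fun x => u (x, z)) := by
  by_cases h : MemLp (fun x => (u (x, z) : ℂ)) 2 (volume : Measure (Horiz d))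
  · rw [sliceLp, dif_pos h, hsSq_eq_iSup s h]
    exact le_iSup (fun R => ‖truncMultiplier d s R (h.toLp _)‖ₑ ^ 2) R
  · rw [hsSq, dif_neg h]
    exact le_top

/-- Bessel's inequality for the modal coefficients in `H^s`. -/
theorem sum_hsSq_coeff_le {H s : ℝ} {u : Horiz d × ℝ → ℝ} (hu : MemLp u 2 (stripMeasure d H))
    {ι : Type*} [DecidableEq ι] (S : Finset ι) {ϖ : ℝ → ℝ} (hϖ : ∀ᵐ z ∂(depthMeasure H), 0 ≤ ϖ z)
    {C : ℝ} (hϖC : ∀ᵐ z ∂(depthMeasure H), ϖ z ≤ C)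
    (e : ι → ℝ → ℝ) (hκ : ∀ n ∈ S, MemLp (fun z => e n z * ϖ z) 2 (depthMeasure H))
    (hint : ∀ m ∈ S, ∀ n ∈ S, Integrable (fun z => e m z * e n z * ϖ z) (depthMeasure H))
    (horth : ∀ m ∈ S, ∀ n ∈ S,
      ∫ z, e m z * e n z * ϖ z ∂(depthMeasure H) = if m = n then 1 else 0) :
    ∑ n ∈ S, hsSq s (coeff H ϖ (e n) u) ≤ ENNReal.ofReal C * hs0Sq H s u := by
  have hcoeff : ∀ n, coeff H ϖ (e n) u
      = fun x => ∫ z, u (x, z) * (e n z * ϖ z) ∂(depthMeasure H) := by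
    intro n
    ext x
    simp only [coeff, mul_assoc]
  -- The index is the subtype `S`, because the averages are known to be in `L²` only for `n ∈ S`,
  -- while the abstract inequality asks for it at every index.
  have hn : ∀ n : S, MemLp (fun x => ((∫ z, u (x, z) * (e n z * ϖ z) ∂(depthMeasure H) : ℝ) : ℂ))
      2 (volume : Measure (Horiz d)) := fun n =>
    (memLp_slice_integral hu (hκ n n.2)).ofReal
  have hR : ∀ R : ℕ, ∑ n : S, ‖truncMultiplier d s R ((hn n).toLp _)‖ₑ ^ 2
      ≤ ENNReal.ofReal C * hs0Sq H s u := by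
    intro R
    refine (sum_enorm_sq_clm_average_le (truncMultiplier d s R) hu Finset.univ hϖ
      (fun n : S => e n) (fun n _ => hκ n n.2) (fun m _ n _ => hint m m.2 n n.2)
      (fun m _ n _ => ?_) hn).trans ?_
    · rw [horth m m.2 n n.2]
      exact if_congr Subtype.ext_iff.symm rfl rfl
    · rw [hs0Sq, ← lintegral_const_mul' _ _ ENNReal.ofReal_ne_top]
      refine lintegral_mono_ae ?_
      filter_upwards [hϖC] with z hz
      rw [mul_comm]
      exact mul_le_mul' (ENNReal.ofReal_le_ofReal hz) (sliceLp_enorm_le_hsSq s R u z)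
  have hsum : ∑ n ∈ S, hsSq s (coeff H ϖ (e n) u)
      = ∑ n : S, ⨆ R, ‖truncMultiplier d s R ((hn n).toLp _)‖ₑ ^ 2 := by
    rw [← Finset.sum_coe_sort]
    refine Finset.sum_congr rfl fun n _ => ?_
    rw [← hsSq_eq_iSup s (hn n), hcoeff]
  rw [hsum, ENNReal.finsetSum_iSup_of_monotone fun n => monotone_truncMultiplier s _]
  exact iSup_le hR

end Sobolev

/-! ### The stratification and the modes are smooth up to the boundary -/

section Modes

lemma hasDerivAt_exp_mul_const (β z : ℝ) :
    HasDerivAt (fun y => Real.exp (β * y)) (β * Real.exp (β * z)) z := by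
  have := ((hasDerivAt_id z).const_mul β).exp
  simpa [mul_comm] using this

lemma deriv_eq_of_brunt {g N r r' : ℝ} (hg : 0 < g) (hr : 0 < r) (h : N ^ 2 = -(r' / r) * g) :
    r' = -(N ^ 2 / g) * r := by
  rw [h]
  field_simp

/-- A Lipschitz stratification with constant Brunt-Väisälä frequency is exponential. -/
theorem IsStratification.exists_eq_exp {H g N : ℝ} (hH : 0 < H) (hg : 0 < g) {ρeq : ℝ → ℝ}
    (h : IsStratification H g N ρeq) :
    ∃ A > 0, ∀ z ∈ Ioo (-H) 0, ρeq z = A * Real.exp (-(N ^ 2 / g) * z) := by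
  obtain ⟨K, hK⟩ := h.lipschitz
  obtain ⟨m, hm, hpos⟩ := h.pos
  set β := N ^ 2 / g with hβ
  -- `q` is absolutely continuous with derivative zero almost everywhere, hence constant; its value
  -- at the midpoint is `A`.
  set q : ℝ → ℝ := fun z => ρeq z * Real.exp (β * z) with hq
  have hb := (ae_restrict_iff' measurableSet_Ioo).1 h.brunt
  have hconst : ∀ a ∈ Ioo (-H) 0, ∀ b ∈ Ioo (-H) 0, q a = q b := by
    intro a ha b hb'
    have hsub : uIcc a b ⊆ Ioo (-H) 0 := ordConnected_Ioo.uIcc_subset ha hb'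
    have h1 : AbsolutelyContinuousOnInterval ρeq a b :=
      (hK.mono hsub).absolutelyContinuousOnInterval
    have h2 : AbsolutelyContinuousOnInterval (fun z => Real.exp (β * z)) a b := by
      refine ContDiffOn.absolutelyContinuousOnInterval (ContDiff.contDiffOn ?_)
      fun_prop
    have h3 : AbsolutelyContinuousOnInterval q a b := h1.mul h2
    obtain ⟨C, hC⟩ := h3.const_of_ae_hasDerivAt_zero (by
      filter_upwards [h1.ae_differentiableAt, hb] with z hz1 hz2 hz
      have hd := (hz1 hz).hasDerivAt
      have hval := deriv_eq_of_brunt hg (hm.trans_le (hpos z (hsub hz))) (hz2 (hsub hz))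
      have := hd.mul (hasDerivAt_exp_mul_const β z)
      refine this.congr_deriv ?_
      rw [hval]
      ring)
    rw [hC a left_mem_uIcc, hC b right_mem_uIcc]
  have hmid : -H / 2 ∈ Ioo (-H) 0 := ⟨by linarith, by linarith⟩
  refine ⟨q (-H / 2), mul_pos (hm.trans_le (hpos _ hmid)) (Real.exp_pos _), fun z hz => ?_⟩
  rw [hconst _ hmid z hz, hq]
  simp only
  rw [mul_assoc, ← Real.exp_add]
  simp

/-- The eigenvalue equation only differentiates `ρeq f'`; multiplying by the smooth factor `1/ρeq =
A⁻¹ e^{βz}` frees `f'` and gives `f'' = β f' - (N²/c²) f`. -/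
lemma IsModalBasis.hasDerivAt_deriv {H N A β : ℝ} (hA : 0 < A) {ρeq : ℝ → ℝ}
    (hρ : ∀ z ∈ Ioo (-H) 0, ρeq z = A * Real.exp (-β * z)) {c : ℕ → ℝ} {f : ℕ → ℝ → ℝ}
    (hf : IsModalBasis H N ρeq c f) {n : ℕ} (hn : 1 ≤ n) {z : ℝ} (hz : z ∈ Ioo (-H) 0) :
    HasDerivAt (deriv (f n)) (β * deriv (f n) z - N ^ 2 / c n ^ 2 * f n z) z := by
  have h1 := hf.eigen n hn z hz
  have h2 := h1.mul ((hasDerivAt_exp_mul_const β z).mul_const A⁻¹)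
  have hexp : ∀ y, A * Real.exp (-β * y) * (Real.exp (β * y) * A⁻¹) = 1 := by
    intro y
    rw [mul_mul_mul_comm, mul_comm (Real.exp _), mul_mul_mul_comm, ← Real.exp_add,
      mul_inv_cancel₀ hA.ne', one_mul]
    simp
  have hev : (fun y => ρeq y * deriv (f n) y * (Real.exp (β * y) * A⁻¹)) =ᶠ[𝓝 z] deriv (f n) := by
    filter_upwards [isOpen_Ioo.mem_nhds hz] with y hy
    rw [hρ y hy, mul_right_comm, hexp, one_mul]
  refine (h2.congr_of_eventuallyEq hev.symm).congr_deriv ?_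
  rw [hρ z hz]
  linear_combination (β * deriv (f n) z - N ^ 2 / c n ^ 2 * f n z) * hexp z

open NormedSpace in
/-- Solutions of `y'' = β y' - κ y` on an interval extend to smooth functions on the line. -/
lemma exists_contDiff_extension {a b β κ : ℝ} (hab : a < b) {y : ℝ → ℝ}
    (hy : ∀ z ∈ Ioo a b, DifferentiableAt ℝ y z)
    (hy' : ∀ z ∈ Ioo a b, HasDerivAt (deriv y) (β * deriv y z - κ * y z) z) :
    ∃ F : ℝ → ℝ, ContDiff ℝ ∞ F ∧ ∀ z ∈ Ioo a b, y z = F z := by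
  -- Companion matrix: `Y = (y, y')` solves `Y' = M Y`, so `e^{-zM} Y` is a constant vector `Q`. The
  -- extension is the first component of `e^{zM} Q`, which makes sense for every `z`.
  let M : (ℝ × ℝ) →L[ℝ] (ℝ × ℝ) := (ContinuousLinearMap.snd ℝ ℝ ℝ).prod
    (β • ContinuousLinearMap.snd ℝ ℝ ℝ - κ • ContinuousLinearMap.fst ℝ ℝ ℝ)
  have hexp : ContDiff ℝ ∞ fun z : ℝ => exp (z • M) := by
    have h1 : ContDiff ℝ ∞ (exp : ((ℝ × ℝ) →L[ℝ] (ℝ × ℝ)) → _) :=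
      contDiff_iff_contDiffAt.2 fun x => (exp_analytic (𝕂 := ℝ) x).contDiffAt
    exact h1.comp (contDiff_id.smul contDiff_const)
  have hder : ∀ z : ℝ, HasDerivAt (fun z : ℝ => exp (z • (-M))) (exp (z • (-M)) * (-M)) z :=
    fun z => hasDerivAt_exp_smul_const (-M) z
  set Y : ℝ → ℝ × ℝ := fun z => (y z, deriv y z) with hY
  have hYd : ∀ z ∈ Ioo a b, HasDerivAt Y (M (Y z)) z := by
    intro z hz
    exact (hy z hz).hasDerivAt.prodMk (hy' z hz)
  set Q : ℝ → ℝ × ℝ := fun z => exp (z • (-M)) (Y z) with hQ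
  have hQd : ∀ z ∈ Ioo a b, HasDerivAt Q 0 z := by
    intro z hz
    have := (hder z).clm_apply (hYd z hz)
    refine this.congr_deriv ?_
    simp
  have hQc : ∀ z ∈ Ioo a b, Q z = Q ((a + b) / 2) := by
    intro z hz
    refine (convex_Ioo a b).is_const_of_fderivWithin_eq_zero (𝕜 := ℝ) (f := Q) ?_ ?_ hz
      ⟨by linarith, by linarith⟩
    · exact fun w hw => (hQd w hw).differentiableAt.differentiableWithinAt
    · intro w hw
      rw [fderivWithin_of_isOpen isOpen_Ioo hw]
      ext
      · simp [(hQd w hw).hasFDerivAt.fderiv]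
      · simp [(hQd w hw).hasFDerivAt.fderiv]
  refine ⟨fun z => (exp (z • M) (Q ((a + b) / 2))).1,
    contDiff_fst.comp (hexp.clm_apply contDiff_const), fun z hz => ?_⟩
  rw [← hQc z hz, hQ]
  have hinv : exp (z • M) * exp (z • (-M)) = 1 := by
    let +nondep : NormedAlgebra ℚ ((ℝ × ℝ) →L[ℝ] (ℝ × ℝ)) := .restrictScalars ℚ ℝ _
    have h := exp_add_of_commute (Commute.neg_right (Commute.refl (z • M)))
    rw [add_neg_cancel, exp_zero] at h
    rw [smul_neg]
    exact h.symm
  have : exp (z • M) (exp (z • (-M)) (Y z)) = Y z := by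
    rw [← mul_apply_eq_comp, hinv, one_apply_eq_self]
  exact (congrArg Prod.fst this).symm

end Modes

/-! ### Smooth modes and the orthonormality of their derivatives -/

section SmoothModes

lemma setIntegral_Ioo_eq_intervalIntegral {H : ℝ} (hH : 0 < H) (h : ℝ → ℝ) :
    ∫ z, h z ∂(depthMeasure H) = ∫ z in (-H)..0, h z := by
  rw [intervalIntegral.integral_of_le (by linarith), integral_Ioc_eq_integral_Ioo]

lemma memLp_depth_of_continuous {H : ℝ} {κ : ℝ → ℝ} (hκ : Continuous κ) :
    MemLp κ 2 (depthMeasure H) := by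
  obtain ⟨C, hC⟩ := (isCompact_Icc (a := -H) (b := 0)).exists_bound_of_continuousOn
    hκ.continuousOn
  refine MemLp.of_bound hκ.aestronglyMeasurable C ?_
  filter_upwards [ae_restrict_mem measurableSet_Ioo] with z hz
  exact hC z (Ioo_subset_Icc_self hz)

/-- A smooth function on the line which agrees with the mode `f n` on `[-H, 0]`. -/
structure IsSmoothMode (H N A β c : ℝ) (F : ℝ → ℝ) : Prop where
  contDiff : ContDiff ℝ ∞ F
  bottom : F (-H) = 0
  top : F 0 = 0
  eigen : ∀ z ∈ Ioo (-H) 0, HasDerivAt (fun y => A * Real.exp (-β * y) * deriv F y)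
    (-(A * Real.exp (-β * z) * N ^ 2 / c ^ 2 * F z)) z

lemma IsModalBasis.exists_smoothMode {H N A β : ℝ} (hH : 0 < H) (hA : 0 < A) {ρeq : ℝ → ℝ}
    (hρ : ∀ z ∈ Ioo (-H) 0, ρeq z = A * Real.exp (-β * z)) {c : ℕ → ℝ} {f : ℕ → ℝ → ℝ}
    (hf : IsModalBasis H N ρeq c f) {n : ℕ} (hn : 1 ≤ n) :
    ∃ F, IsSmoothMode H N A β (c n) F ∧ (∀ z ∈ Ioo (-H) 0, f n z = F z) ∧
      ∀ z ∈ Ioo (-H) 0, deriv (f n) z = deriv F z := by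
  obtain ⟨F, hF, hfF⟩ := exists_contDiff_extension (by linarith : -H < 0)
    (hf.differentiableAt n hn) (fun z hz => hf.hasDerivAt_deriv hA hρ hn hz)
  have hder : ∀ z ∈ Ioo (-H) 0, deriv (f n) z = deriv F z := by
    intro z hz
    refine Filter.EventuallyEq.deriv_eq ?_
    filter_upwards [isOpen_Ioo.mem_nhds hz] with y hy
    exact hfF y hy
  -- Continuity up to the ends transfers the boundary values from `f n` to `F`.
  have hIcc : EqOn (f n) F (Icc (-H) 0) := by
    have h1 : EqOn (f n) F (Ioo (-H) 0) := hfF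
    refine h1.of_subset_closure (hf.continuousOn n hn) hF.continuous.continuousOn
      Ioo_subset_Icc_self ?_
    rw [closure_Ioo (by linarith)]
  refine ⟨F, ⟨hF, ?_, ?_, fun z hz => ?_⟩, hfF, hder⟩
  · rw [← hIcc ⟨le_rfl, by linarith⟩, hf.bottom n hn]
  · rw [← hIcc ⟨by linarith, le_rfl⟩, hf.top n hn]
  · have h1 := hf.eigen n hn z hz
    rw [hρ z hz, hfF z hz] at h1
    refine h1.congr_of_eventuallyEq ?_
    filter_upwards [isOpen_Ioo.mem_nhds hz] with y hy
    rw [hρ y hy, hder y hy]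

/-- Integration by parts against the eigenvalue equation; the boundary terms vanish because `G`
does. -/
lemma integral_deriv_mul_deriv_mode {H N A β c : ℝ} (hH : 0 < H) {F G : ℝ → ℝ}
    (hF : IsSmoothMode H N A β c F) (hG : ContDiff ℝ ∞ G) (hb : G (-H) = 0) (ht : G 0 = 0) :
    ∫ z, deriv G z * deriv F z * (A * Real.exp (-β * z)) ∂(depthMeasure H)
      = (c ^ 2)⁻¹ * ∫ z, G z * F z * (A * Real.exp (-β * z) * N ^ 2) ∂(depthMeasure H) := by
  rw [setIntegral_Ioo_eq_intervalIntegral hH, setIntegral_Ioo_eq_intervalIntegral hH]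
  have hdF : Continuous (deriv F) := hF.contDiff.continuous_deriv (by simp)
  have hdG : Continuous (deriv G) := hG.continuous_deriv (by simp)
  have hcF := hF.contDiff.continuous
  have hIoo : Ioo (min (-H) 0) (max (-H) 0) = Ioo (-H) 0 := by
    rw [min_eq_left (by linarith), max_eq_right (by linarith)]
  have key := intervalIntegral.integral_mul_deriv_eq_deriv_mul_of_hasDerivAt (a := -H) (b := 0)
    (u := G) (u' := deriv G) (v := fun y => A * Real.exp (-β * y) * deriv F y)
    (v' := fun z => -(A * Real.exp (-β * z) * N ^ 2 / c ^ 2 * F z))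
    hG.continuous.continuousOn (by fun_prop)
    (fun z _ => (hG.differentiable (by simp) z).hasDerivAt)
    (fun z hz => hF.eigen z (hIoo ▸ hz)) (hdG.intervalIntegrable _ _)
    (Continuous.intervalIntegrable (by fun_prop) _ _)
  rw [hb, ht] at key
  simp only [zero_mul, sub_self, zero_sub] at key
  have e1 : ∫ z in (-H)..0, deriv G z * deriv F z * (A * Real.exp (-β * z))
      = ∫ z in (-H)..0, deriv G z * (A * Real.exp (-β * z) * deriv F z) := by
    congr 1 with z
    ring
  rw [e1, ← neg_eq_iff_eq_neg.2 key, ← intervalIntegral.integral_neg,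
    ← intervalIntegral.integral_const_mul]
  congr 1 with z
  ring

/-- The factor `c m * c n / c n ^ 2` left by the integration by parts is `1` when `m = n`, and
multiplies zero otherwise. -/
lemma IsModalBasis.integral_gMode_mul {H N A β : ℝ} (hH : 0 < H) (hA : 0 < A) {ρeq : ℝ → ℝ}
    (hρ : ∀ z ∈ Ioo (-H) 0, ρeq z = A * Real.exp (-β * z)) {c : ℕ → ℝ} {f : ℕ → ℝ → ℝ}
    (hf : IsModalBasis H N ρeq c f) {m n : ℕ} (hm : 1 ≤ m) (hn : 1 ≤ n) :
    ∫ z, gMode H ρeq c f m z * gMode H ρeq c f n z * ρeq z ∂(depthMeasure H)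
      = if m = n then 1 else 0 := by
  obtain ⟨G, hG, hfG, hdG⟩ := hf.exists_smoothMode hH hA hρ hm
  obtain ⟨F, hF, hfF, hdF⟩ := hf.exists_smoothMode hH hA hρ hn
  have h1 : ∫ z, gMode H ρeq c f m z * gMode H ρeq c f n z * ρeq z ∂(depthMeasure H)
      = (c m * c n) * ∫ z, deriv G z * deriv F z * (A * Real.exp (-β * z)) ∂(depthMeasure H) := by
    rw [← integral_const_mul]
    refine setIntegral_congr_fun measurableSet_Ioo fun z hz => ?_
    simp only [gMode, if_neg (Nat.one_le_iff_ne_zero.1 hm), if_neg (Nat.one_le_iff_ne_zero.1 hn)]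
    rw [hρ z hz, hdG z hz, hdF z hz]
    ring
  have h2 : ∫ z, G z * F z * (A * Real.exp (-β * z) * N ^ 2) ∂(depthMeasure H)
      = if m = n then 1 else 0 := by
    rw [← hf.orthonormal m hm n hn]
    refine setIntegral_congr_fun measurableSet_Ioo fun z hz => ?_
    rw [hρ z hz, hfG z hz, hfF z hz]
  rw [h1, integral_deriv_mul_deriv_mode hH hF hG.contDiff hG.bottom hG.top, h2]
  have hc := hf.speed_pos n hn
  split_ifs with h
  · subst h
    field_simp
  · simp

end SmoothModes

/-! ### Vertical cutoffs, and the bound on their derivatives -/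

section Cutoff

/-- A smooth step, `0` on `(-∞, 1]` and `1` on `[2, ∞)`. -/
def smoothStep (y : ℝ) : ℝ := Real.smoothTransition (y - 1)

lemma contDiff_smoothStep : ContDiff ℝ ∞ smoothStep :=
  Real.smoothTransition.contDiff.comp (contDiff_id.sub contDiff_const)

lemma smoothStep_eq_zero {y : ℝ} (h : y ≤ 1) : smoothStep y = 0 :=
  Real.smoothTransition.zero_of_nonpos (by linarith)

lemma smoothStep_eq_one {y : ℝ} (h : 2 ≤ y) : smoothStep y = 1 :=
  Real.smoothTransition.one_of_one_le (by linarith)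

lemma abs_smoothStep_le (y : ℝ) : |smoothStep y| ≤ 1 := by
  rw [smoothStep, abs_of_nonneg (Real.smoothTransition.nonneg _)]
  exact Real.smoothTransition.le_one _

lemma deriv_smoothStep_of_lt {y : ℝ} (h : y < 1) : deriv smoothStep y = 0 := by
  have : smoothStep =ᶠ[𝓝 y] fun _ => 0 := by
    filter_upwards [gt_mem_nhds h] with x hx
    exact smoothStep_eq_zero hx.le
  rw [this.deriv_eq]
  simp

lemma deriv_smoothStep_of_gt {y : ℝ} (h : 2 < y) : deriv smoothStep y = 0 := by
  have : smoothStep =ᶠ[𝓝 y] fun _ => 1 := by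
    filter_upwards [lt_mem_nhds h] with x hx
    exact smoothStep_eq_one hx.le
  rw [this.deriv_eq]
  simp

/-- The step varies only on `[1, 2]`. The quantity `y · step'(y)` is invariant under rescaling the
step, so the bound will hold at every scale `m + 1`. -/
lemma exists_mul_deriv_smoothStep_le : ∃ S : ℝ, ∀ y, |y * deriv smoothStep y| ≤ S := by
  have hc : Continuous fun y => y * deriv smoothStep y :=
    continuous_id.mul (contDiff_smoothStep.continuous_deriv (by simp))
  obtain ⟨S, hS⟩ := (isCompact_Icc (a := (1 : ℝ)) (b := 2)).exists_bound_of_continuousOn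
    hc.continuousOn
  refine ⟨max S 0, fun y => ?_⟩
  by_cases h : y ∈ Icc (1 : ℝ) 2
  · exact (hS y h).trans (le_max_left _ _)
  · have : deriv smoothStep y = 0 := by
      rw [mem_Icc, not_and_or, not_le, not_le] at h
      exact h.elim deriv_smoothStep_of_lt deriv_smoothStep_of_gt
    rw [this, mul_zero, abs_zero]
    exact le_max_right _ _

/-- Cutoff functions exhausting `(-H, 0)`. -/
def cutoff (H : ℝ) (m : ℕ) (z : ℝ) : ℝ :=
  smoothStep ((m + 1) * (z + H)) * smoothStep (-((m + 1) * z))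

lemma contDiff_cutoff (H : ℝ) (m : ℕ) : ContDiff ℝ ∞ (cutoff H m) := by
  refine (contDiff_smoothStep.comp ?_).mul (contDiff_smoothStep.comp ?_) <;> fun_prop

lemma abs_cutoff_le (H : ℝ) (m : ℕ) (z : ℝ) : |cutoff H m z| ≤ 1 := by
  rw [cutoff, abs_mul]
  exact mul_le_one₀ (abs_smoothStep_le _) (abs_nonneg _) (abs_smoothStep_le _)

lemma tsupport_cutoff_subset (H : ℝ) (m : ℕ) :
    tsupport (cutoff H m) ⊆ Icc (-H + (m + 1 : ℝ)⁻¹) (-(m + 1 : ℝ)⁻¹) := by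
  refine closure_minimal (fun z hz => ?_) isClosed_Icc
  have hm : (0 : ℝ) < m + 1 := by positivity
  have h1 : ¬ (m + 1) * (z + H) ≤ 1 := fun h => hz (by simp [cutoff, smoothStep_eq_zero h])
  have h2 : ¬ -((m + 1) * z) ≤ 1 := fun h => hz (by simp [cutoff, smoothStep_eq_zero h])
  rw [not_le] at h1 h2
  have h3 := (inv_lt_iff_one_lt_mul₀' hm).2 h1
  have h4 : (m + 1 : ℝ)⁻¹ < -z := (inv_lt_iff_one_lt_mul₀' hm).2 (by linarith)
  constructor <;> linarith

lemma isTest_mul_cutoff {κ : ℝ → ℝ} (hκ : ContDiff ℝ ∞ κ) (H : ℝ) (m : ℕ) :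
    IsTest (Ioo (-H) 0) (fun z => κ z * cutoff H m z) := by
  have hm : (0 : ℝ) < (m + 1 : ℝ)⁻¹ := by positivity
  have hsub : tsupport (fun z => κ z * cutoff H m z)
      ⊆ Icc (-H + (m + 1 : ℝ)⁻¹) (-(m + 1 : ℝ)⁻¹) :=
    (tsupport_mul_subset_right).trans (tsupport_cutoff_subset H m)
  refine ⟨hκ.mul (contDiff_cutoff H m),
    isCompact_Icc.of_isClosed_subset (isClosed_tsupport _) hsub, hsub.trans fun z hz => ?_⟩
  exact ⟨by linarith [hz.1], by linarith [hz.2]⟩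

/-- Equality holds on a neighbourhood of `z`, which makes derivatives converge as well as values. -/
lemma eventually_cutoff_eq_one {H z : ℝ} (hz : z ∈ Ioo (-H) 0) :
    ∀ᶠ m : ℕ in atTop, cutoff H m =ᶠ[𝓝 z] fun _ => 1 := by
  have h1 : ∀ᶠ m : ℕ in atTop, 2 < ((m : ℝ) + 1) * (z + H) := by
    have : Tendsto (fun m : ℕ => ((m : ℝ) + 1) * (z + H)) atTop atTop :=
      (tendsto_atTop_add_const_right _ _ tendsto_natCast_atTop_atTop).atTop_mul_const
        (by linarith [hz.1])
    exact this.eventually_gt_atTop 2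
  have h2 : ∀ᶠ m : ℕ in atTop, 2 < ((m : ℝ) + 1) * (-z) := by
    have : Tendsto (fun m : ℕ => ((m : ℝ) + 1) * (-z)) atTop atTop :=
      (tendsto_atTop_add_const_right _ _ tendsto_natCast_atTop_atTop).atTop_mul_const
        (by linarith [hz.2])
    exact this.eventually_gt_atTop 2
  filter_upwards [h1, h2] with m h1 h2
  have e1 : ∀ᶠ y in 𝓝 z, 2 < ((m : ℝ) + 1) * (y + H) :=
    (by fun_prop : ContinuousAt (fun y => ((m : ℝ) + 1) * (y + H)) z).eventually (lt_mem_nhds h1)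
  have e2 : ∀ᶠ y in 𝓝 z, 2 < ((m : ℝ) + 1) * (-y) :=
    (by fun_prop : ContinuousAt (fun y => ((m : ℝ) + 1) * (-y)) z).eventually (lt_mem_nhds h2)
  filter_upwards [e1, e2] with y e1 e2
  rw [cutoff, smoothStep_eq_one e1.le, smoothStep_eq_one (by linarith), one_mul]

lemma tendsto_mul_cutoff {H z : ℝ} (hz : z ∈ Ioo (-H) 0) (κ : ℝ → ℝ) :
    Tendsto (fun m => κ z * cutoff H m z) atTop (𝓝 (κ z)) := by
  refine tendsto_const_nhds.congr' ?_
  filter_upwards [eventually_cutoff_eq_one hz] with m hm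
  rw [hm.self_of_nhds, mul_one]

lemma tendsto_deriv_mul_cutoff {H z : ℝ} (hz : z ∈ Ioo (-H) 0) (κ : ℝ → ℝ) :
    Tendsto (fun m => deriv (fun y => κ y * cutoff H m y) z) atTop (𝓝 (deriv κ z)) := by
  refine tendsto_const_nhds.congr' ?_
  filter_upwards [eventually_cutoff_eq_one hz] with m hm
  refine Filter.EventuallyEq.deriv_eq ?_
  filter_upwards [hm] with y hy
  rw [hy, mul_one]

lemma hasDerivAt_cutoff (H : ℝ) (m : ℕ) (z : ℝ) :
    HasDerivAt (cutoff H m)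
      ((m + 1) * deriv smoothStep ((m + 1) * (z + H)) * smoothStep (-((m + 1) * z))
        - smoothStep ((m + 1) * (z + H)) * ((m + 1) * deriv smoothStep (-((m + 1) * z)))) z := by
  have hd : ∀ y, HasDerivAt smoothStep (deriv smoothStep y) y := fun y =>
    (contDiff_smoothStep.differentiable (by simp) y).hasDerivAt
  have h1 : HasDerivAt (fun y : ℝ => ((m : ℝ) + 1) * (y + H)) (m + 1) z := by
    simpa using ((hasDerivAt_id z).add_const H).const_mul ((m : ℝ) + 1)
  have h2 : HasDerivAt (fun y : ℝ => -(((m : ℝ) + 1) * y)) (-(m + 1)) z := by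
    have := ((hasDerivAt_id z).const_mul ((m : ℝ) + 1)).neg
    rw [mul_one] at this
    exact this
  have := ((hd _).comp z h1).mul ((hd _).comp z h2)
  refine this.congr_deriv ?_
  simp only [Function.comp]
  ring

lemma exists_abs_mul_cutoff_le (H : ℝ) {κ : ℝ → ℝ} (hκ : Continuous κ) :
    ∃ C, ∀ m, ∀ z ∈ Ioo (-H) 0, |κ z * cutoff H m z| ≤ C := by
  obtain ⟨C, hC⟩ := (isCompact_Icc (a := -H) (b := 0)).exists_bound_of_continuousOn
    hκ.continuousOn
  refine ⟨C, fun m z hz => ?_⟩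
  rw [abs_mul]
  exact (mul_le_of_le_one_right (abs_nonneg _) (abs_cutoff_le H m z)).trans
    (hC z (Ioo_subset_Icc_self hz))

/-- Here `a` is the distance to one end, `b` a value of `κ` and `k = m + 1`: the bound `|b| ≤ L a`
trades the large factor `k` for the scale invariant `k a · step'(k a)`. -/
lemma abs_mul_deriv_step_le {S : ℝ} (hS : ∀ y, |y * deriv smoothStep y| ≤ S) {L k a b σ : ℝ}
    (ha : 0 < a) (hb : |b| ≤ L * a) (hσ : |σ| ≤ 1) :
    |b * (k * deriv smoothStep (k * a) * σ)| ≤ L * S := by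
  have hL : 0 ≤ L * a := (abs_nonneg _).trans hb
  have hL0 : 0 ≤ L := nonneg_of_mul_nonneg_left hL ha
  calc |b * (k * deriv smoothStep (k * a) * σ)|
      = |b| * (|k * deriv smoothStep (k * a)| * |σ|) := by rw [abs_mul, abs_mul]
    _ ≤ (L * a) * (|k * deriv smoothStep (k * a)| * 1) := by gcongr
    _ = L * |k * a * deriv smoothStep (k * a)| := by
      rw [mul_right_comm k a, abs_mul _ a, abs_of_pos ha]
      ring
    _ ≤ L * S := by gcongr; exact hS _

/-- The derivative of the cutoff is of size `m` on a layer of width `1/m`, where `κ`, vanishing at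
the end, is `O(1/m)`. This uniform bound is what lets the vertical momentum equation be tested with
the modes. -/
lemma exists_abs_deriv_mul_cutoff_le {H : ℝ} {κ : ℝ → ℝ} (hκ : ContDiff ℝ ∞ κ)
    (hb : κ (-H) = 0) (ht : κ 0 = 0) :
    ∃ C, ∀ m, ∀ z ∈ Ioo (-H) 0, |deriv (fun y => κ y * cutoff H m y) z| ≤ C := by
  obtain ⟨L, hL⟩ := (isCompact_Icc (a := -H) (b := 0)).exists_bound_of_continuousOn
    (hκ.continuous_deriv (by simp)).continuousOn
  obtain ⟨S, hS⟩ := exists_mul_deriv_smoothStep_le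
  have hdiff : ∀ z, DifferentiableAt ℝ κ z := hκ.differentiable (by simp)
  refine ⟨L + L * S + L * S, fun m z hz => ?_⟩
  have hmem : z ∈ Icc (-H) 0 := Ioo_subset_Icc_self hz
  have hH0 : -H ≤ 0 := hmem.1.trans hmem.2
  have hb' : |κ z| ≤ L * (z + H) := by
    have := (convex_Icc (-H) 0).norm_image_sub_le_of_norm_deriv_le (fun y _ => hdiff y) hL
      ⟨le_rfl, hH0⟩ hmem
    rw [hb, sub_zero, Real.norm_eq_abs, Real.norm_eq_abs,
      abs_of_nonneg (by linarith [hz.1] : 0 ≤ z - -H)] at this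
    linarith
  have ht' : |κ z| ≤ L * (-z) := by
    have := (convex_Icc (-H) 0).norm_image_sub_le_of_norm_deriv_le (fun y _ => hdiff y) hL
      ⟨hH0, le_rfl⟩ hmem
    rw [ht, sub_zero, sub_zero, Real.norm_eq_abs, Real.norm_eq_abs, abs_of_neg hz.2] at this
    exact this
  have hder := (hdiff z).hasDerivAt.mul (hasDerivAt_cutoff H m z)
  have hval : deriv (fun y => κ y * cutoff H m y) z = deriv κ z * cutoff H m z
      + κ z * ((m + 1) * deriv smoothStep ((m + 1) * (z + H)) * smoothStep (-((m + 1) * z)))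
      + -(κ z * ((m + 1) * deriv smoothStep ((m + 1) * (-z)) * smoothStep ((m + 1) * (z + H)))) := by
    refine hder.deriv.trans ?_
    rw [mul_neg]
    ring
  rw [hval]
  refine (abs_add_le _ _).trans (add_le_add ((abs_add_le _ _).trans (add_le_add ?_ ?_)) ?_)
  · rw [abs_mul]
    exact (mul_le_of_le_one_right (abs_nonneg _) (abs_cutoff_le H m z)).trans (hL z hmem)
  · exact abs_mul_deriv_step_le hS (by linarith [hz.1]) hb' (abs_smoothStep_le _)
  · rw [abs_neg]
    exact abs_mul_deriv_step_le hS (by linarith [hz.2]) ht' (abs_smoothStep_le _)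

end Cutoff

/-! ### Pairings with products `a(x) κ(z)`: measurability, continuity and limits in time -/

section Pairing

variable {d : ℕ}

/-- The pairing of a function on the strip with a product `a(x) κ(z)`. -/
def pair (H : ℝ) (a : Horiz d → ℝ) (κ : ℝ → ℝ) (u : Horiz d × ℝ → ℝ) : ℝ :=
  ∫ q, u q * (a q.1 * κ q.2) ∂(stripMeasure d H)

/-- The vertical average of `u` against `κ`. -/
def avg (H : ℝ) (κ : ℝ → ℝ) (u : Horiz d × ℝ → ℝ) (x : Horiz d) : ℝ :=
  ∫ z, u (x, z) * κ z ∂(depthMeasure H)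

lemma pair_eq_integral_avg {H : ℝ} {u : Horiz d × ℝ → ℝ} (hu : MemLp u 2 (stripMeasure d H))
    {a : Horiz d → ℝ} (ha : MemLp a 2 volume) {κ : ℝ → ℝ} (hκ : Continuous κ) :
    pair H a κ u = ∫ x, avg H κ u x * a x :=
  integral_mul_tensor hu ha (memLp_depth_of_continuous hκ)

lemma memLp_avg {H : ℝ} {u : Horiz d × ℝ → ℝ} (hu : MemLp u 2 (stripMeasure d H))
    {κ : ℝ → ℝ} (hκ : Continuous κ) : MemLp (avg H κ u) 2 volume :=
  memLp_slice_integral hu (memLp_depth_of_continuous hκ)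

lemma ae_strip_mem (H : ℝ) : ∀ᵐ q ∂(stripMeasure d H), q.2 ∈ Ioo (-H) 0 :=
  Measure.quasiMeasurePreserving_snd.ae (ae_restrict_mem measurableSet_Ioo)

/-- The bound `A` is independent of `t`, as needed for dominated convergence in time: a constant on
the spatial projection of the support. -/
lemma exists_memLp_dominating {a : ℝ × Horiz d → ℝ} (ha : Continuous a)
    (hc : HasCompactSupport a) :
    ∃ A : Horiz d → ℝ, MemLp A 2 volume ∧ ∀ t x, |a (t, x)| ≤ A x := by
  obtain ⟨C, hC⟩ := hc.exists_bound_of_continuous ha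
  set K : Set (Horiz d) := Prod.snd '' tsupport a with hK
  have hKc : IsCompact K := hc.isCompact.image continuous_snd
  refine ⟨K.indicator fun _ => C, memLp_indicator_const 2 hKc.measurableSet C
    (Or.inr hKc.measure_lt_top.ne), fun t x => ?_⟩
  by_cases hx : x ∈ K
  · rw [indicator_of_mem hx]
    exact hC (t, x)
  · rw [indicator_of_notMem hx, image_eq_zero_of_notMem_tsupport fun h => hx ⟨_, h, rfl⟩, abs_zero]

lemma memLp_of_dominated {a A : Horiz d → ℝ} (hA : MemLp A 2 volume) (ha : Continuous a)
    (h : ∀ x, |a x| ≤ A x) : MemLp a 2 volume :=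
  hA.mono' ha.aestronglyMeasurable (ae_of_all _ h)

lemma abs_pair_le {H C : ℝ} {u : Horiz d × ℝ → ℝ} (hu : MemLp u 2 (stripMeasure d H))
    {a A : Horiz d → ℝ} (hA : MemLp A 2 volume) (ha : Continuous a) (haA : ∀ x, |a x| ≤ A x)
    {κ : ℝ → ℝ} (hκ : Continuous κ) (hκC : ∀ z ∈ Ioo (-H) 0, |κ z| ≤ C) :
    |pair H a κ u| ≤ (eLpNorm u 2 (stripMeasure d H)).toReal
      * (eLpNorm (fun q : Horiz d × ℝ => A q.1 * C) 2 (stripMeasure d H)).toReal := by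
  have hm : AEStronglyMeasurable (fun q : Horiz d × ℝ => a q.1 * κ q.2) (stripMeasure d H) :=
    (Continuous.aestronglyMeasurable (by fun_prop))
  have hAC : MemLp (fun q : Horiz d × ℝ => A q.1 * C) 2 (stripMeasure d H) :=
    memLp_tensor hA (memLp_const C)
  rw [← ENNReal.toReal_mul, ← Real.norm_eq_abs, ← toReal_enorm]
  refine ENNReal.toReal_mono (ENNReal.mul_ne_top hu.2.ne hAC.2.ne) ?_
  refine (enorm_integral_mul_le hu.1 hm).trans ?_
  gcongr
  refine eLpNorm_mono_ae_real ?_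
  filter_upwards [ae_strip_mem H] with q hq
  rw [norm_mul]
  exact mul_le_mul (haA _) (hκC _ hq) (norm_nonneg _) ((abs_nonneg _).trans (haA _))

/-- Time dependent functions which are integrable in time with values in `L²` of the strip, in the
weak sense: only the pairings with products are assumed measurable in time. -/
structure TimeL2 (H T : ℝ) (Q : ℝ → Horiz d × ℝ → ℝ) : Prop where
  memLp : ∀ᵐ t ∂(volume.restrict (Ioo 0 T)), MemLp (Q t) 2 (stripMeasure d H)
  bound : ∃ b : ℝ → ℝ, Integrable b (volume.restrict (Ioo 0 T)) ∧
    ∀ᵐ t ∂(volume.restrict (Ioo 0 T)), (eLpNorm (Q t) 2 (stripMeasure d H)).toReal ≤ b t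
  meas : ∀ a : ℝ × Horiz d → ℝ, Continuous a → HasCompactSupport a → ∀ κ : ℝ → ℝ, Continuous κ →
    AEStronglyMeasurable (fun t => pair H (fun x => a (t, x)) κ (Q t)) (volume.restrict (Ioo 0 T))

variable {H T : ℝ} {Q : ℝ → Horiz d × ℝ → ℝ}

lemma TimeL2.integrable_pair (hQ : TimeL2 H T Q) {a : ℝ × Horiz d → ℝ} (ha : Continuous a)
    (hc : HasCompactSupport a) {κ : ℝ → ℝ} (hκ : Continuous κ) :
    Integrable (fun t => pair H (fun x => a (t, x)) κ (Q t)) (volume.restrict (Ioo 0 T)) := by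
  obtain ⟨b, hb, hbQ⟩ := hQ.bound
  obtain ⟨A, hA, haA⟩ := exists_memLp_dominating ha hc
  obtain ⟨C, hC⟩ := (isCompact_Icc (a := -H) (b := 0)).exists_bound_of_continuousOn
    hκ.continuousOn
  refine Integrable.mono' (hb.mul_const
    (eLpNorm (fun q : Horiz d × ℝ => A q.1 * C) 2 (stripMeasure d H)).toReal)
    (hQ.meas a ha hc κ hκ) ?_
  filter_upwards [hQ.memLp, hbQ] with t ht hbt
  refine (abs_pair_le ht hA (by fun_prop) (haA t) hκ
    fun z hz => hC z (Ioo_subset_Icc_self hz)).trans ?_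
  gcongr

/-- Dominated convergence twice: on the strip at almost every fixed `t`, then in time under the
integrable bound `b`. -/
lemma TimeL2.tendsto_integral_pair (hQ : TimeL2 H T Q) {a : ℝ × Horiz d → ℝ} (ha : Continuous a)
    (hc : HasCompactSupport a) {κ : ℝ → ℝ} {κs : ℕ → ℝ → ℝ} (hκs : ∀ m, Continuous (κs m)) {C : ℝ}
    (hC : ∀ m, ∀ z ∈ Ioo (-H) 0, |κs m z| ≤ C)
    (hlim : ∀ z ∈ Ioo (-H) 0, Tendsto (fun m => κs m z) atTop (𝓝 (κ z))) :
    Tendsto (fun m => ∫ t in Ioo 0 T, pair H (fun x => a (t, x)) (κs m) (Q t)) atTop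
      (𝓝 (∫ t in Ioo 0 T, pair H (fun x => a (t, x)) κ (Q t))) := by
  obtain ⟨b, hb, hbQ⟩ := hQ.bound
  obtain ⟨A, hA, haA⟩ := exists_memLp_dominating ha hc
  refine tendsto_integral_of_dominated_convergence (fun t => b t
    * (eLpNorm (fun q : Horiz d × ℝ => A q.1 * C) 2 (stripMeasure d H)).toReal)
    (fun m => hQ.meas a ha hc _ (hκs m)) (hb.mul_const _) (fun m => ?_) ?_
  · filter_upwards [hQ.memLp, hbQ] with t ht hbt
    refine (abs_pair_le ht hA (by fun_prop) (haA t) (hκs m) (hC m)).trans ?_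
    gcongr
  · filter_upwards [hQ.memLp] with t ht
    have hdom : Integrable (fun q => ‖Q t q * (A q.1 * C)‖) (stripMeasure d H) :=
      (integrable_mul_tensor ht hA (memLp_const C)).norm
    refine tendsto_integral_of_dominated_convergence _ (fun m => ?_) hdom (fun m => ?_) ?_
    · have := hκs m
      exact ht.1.mul (Continuous.aestronglyMeasurable (by fun_prop))
    · filter_upwards [ae_strip_mem H] with q hq
      simp only [norm_mul]
      exact mul_le_mul_of_nonneg_left (mul_le_mul ((haA t _).trans (le_abs_self _))
        ((hC m _ hq).trans (le_abs_self _)) (norm_nonneg _) (norm_nonneg _)) (norm_nonneg _)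
    · filter_upwards [ae_strip_mem H] with q hq
      exact ((hlim _ hq).const_mul _).const_mul _

lemma tendsto_pair_of_dominated {u : Horiz d × ℝ → ℝ} (hu : MemLp u 2 (stripMeasure d H))
    {a : Horiz d → ℝ} (ha : MemLp a 2 volume) {κ : ℝ → ℝ} {κs : ℕ → ℝ → ℝ}
    (hκs : ∀ m, Continuous (κs m)) {C : ℝ} (hC : ∀ m, ∀ z ∈ Ioo (-H) 0, |κs m z| ≤ C)
    (hlim : ∀ z ∈ Ioo (-H) 0, Tendsto (fun m => κs m z) atTop (𝓝 (κ z))) :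
    Tendsto (fun m => pair H a (κs m) u) atTop (𝓝 (pair H a κ u)) := by
  have hdom : Integrable (fun q => ‖u q * (a q.1 * C)‖) (stripMeasure d H) :=
    (integrable_mul_tensor hu ha (memLp_const C)).norm
  refine tendsto_integral_of_dominated_convergence _ (fun m => ?_) hdom (fun m => ?_) ?_
  · exact hu.1.mul (ha.1.comp_fst.mul (hκs m).aestronglyMeasurable.comp_snd)
  · filter_upwards [ae_strip_mem H] with q hq
    simp only [norm_mul]
    gcongr
    exact (hC m _ hq).trans (le_abs_self _)
  · filter_upwards [ae_strip_mem H] with q hq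
    exact ((hlim _ hq).const_mul _).const_mul _

lemma MemL1L2.timeL2 {P : ℝ → Horiz d × ℝ → ℝ} (hP : MemL1L2 H T P) : TimeL2 H T P := by
  have hm : AEMeasurable (fun t => eLpNorm (P t) 2 (stripMeasure d H))
      (volume.restrict (Ioo 0 T)) := by
    have h1 : AEMeasurable (fun t => ∫⁻ q, ‖P t q‖ₑ ^ 2 ∂(stripMeasure d H))
        (volume.restrict (Ioo 0 T)) := (hP.1.enorm.pow_const 2).lintegral_prod_right'
    have h2 := h1.pow_const (1 / 2 : ℝ)
    refine h2.congr (ae_of_all _ fun t => ?_)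
    simp only
    rw [← eLpNorm_two_sq, ← ENNReal.rpow_natCast, ← ENNReal.rpow_mul]
    simp
  have hfin : ∀ᵐ t ∂(volume.restrict (Ioo 0 T)), eLpNorm (P t) 2 (stripMeasure d H) < ⊤ :=
    ae_lt_top' hm hP.2.ne
  refine ⟨?_, ⟨fun t => (eLpNorm (P t) 2 (stripMeasure d H)).toReal,
    integrable_toReal_of_lintegral_ne_top hm hP.2.ne, ae_of_all _ fun _ => le_rfl⟩, ?_⟩
  · filter_upwards [hfin, hP.1.prodMk_left] with t h1 h2
    exact ⟨h2, h1⟩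
  · intro a ha hc κ hκ
    have h1 : AEStronglyMeasurable
        (fun p : ℝ × (Horiz d × ℝ) => P p.1 p.2 * (a (p.1, p.2.1) * κ p.2.2))
        ((volume.restrict (Ioo 0 T)).prod (stripMeasure d H)) :=
      hP.1.mul (Continuous.aestronglyMeasurable (by fun_prop))
    exact h1.integral_prod_right'

lemma ContHs0.memLp {s : ℝ} {u : ℝ → Horiz d × ℝ → ℝ} (hu : ContHs0 H T s u) {t : ℝ}
    (ht : t ∈ Icc 0 T) : MemLp (u t) 2 (stripMeasure d H) := (hu.1 t ht).1

lemma ContHs0.tendsto_eLpNorm {s : ℝ} (hs : 0 ≤ s) {u : ℝ → Horiz d × ℝ → ℝ}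
    (hu : ContHs0 H T s u) {t₀ : ℝ} (ht₀ : t₀ ∈ Icc 0 T) :
    Tendsto (fun t => eLpNorm (u t - u t₀) 2 (stripMeasure d H)) (𝓝[Icc 0 T] t₀) (𝓝 0) := by
  have h1 : Tendsto (fun t => eLpNorm (u t - u t₀) 2 (stripMeasure d H) ^ 2)
      (𝓝[Icc 0 T] t₀) (𝓝 0) := by
    refine tendsto_of_tendsto_of_tendsto_of_le_of_le' tendsto_const_nhds (hu.2 t₀ ht₀)
      (Eventually.of_forall fun _ => zero_le) ?_
    filter_upwards [self_mem_nhdsWithin] with t ht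
    exact eLpNorm_sq_le_hs0Sq hs ((hu.memLp ht).1.sub (hu.memLp ht₀).1)
  have h2 := ((ENNReal.continuous_rpow_const (y := (1 / 2 : ℝ))).tendsto 0).comp h1
  rw [ENNReal.zero_rpow_of_pos (by norm_num)] at h2
  refine h2.congr fun t => ?_
  simp only [Function.comp]
  rw [← ENNReal.rpow_natCast, ← ENNReal.rpow_mul]
  simp

/-- Both factors move with `t`. The increment `u t - u t₀` is controlled by Cauchy–Schwarz uniformly
in the test function, and the pairing of the fixed `u t₀` with a moving test function by dominated
convergence. -/
lemma ContHs0.continuousOn_pair {s : ℝ} (hs : 0 ≤ s) {u : ℝ → Horiz d × ℝ → ℝ}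
    (hu : ContHs0 H T s u) {a : ℝ × Horiz d → ℝ} (ha : Continuous a) (hc : HasCompactSupport a)
    {κ : ℝ → ℝ} (hκ : Continuous κ) :
    ContinuousOn (fun t => pair H (fun x => a (t, x)) κ (u t)) (Icc 0 T) := by
  obtain ⟨A, hA, haA⟩ := exists_memLp_dominating ha hc
  obtain ⟨C, hC⟩ := (isCompact_Icc (a := -H) (b := 0)).exists_bound_of_continuousOn
    hκ.continuousOn
  have hC' : ∀ z ∈ Ioo (-H) 0, |κ z| ≤ C := fun z hz => hC z (Ioo_subset_Icc_self hz)
  have hat : ∀ t, MemLp (fun x => a (t, x)) 2 (volume : Measure (Horiz d)) := fun t =>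
    memLp_of_dominated hA (by fun_prop) (haA t)
  intro t₀ ht₀
  have hfix : Tendsto (fun t => pair H (fun x => a (t, x)) κ (u t₀)) (𝓝[Icc 0 T] t₀)
      (𝓝 (pair H (fun x => a (t₀, x)) κ (u t₀))) := by
    have hdom : Integrable (fun q => ‖u t₀ q * (A q.1 * C)‖) (stripMeasure d H) :=
      (integrable_mul_tensor (hu.memLp ht₀) hA (memLp_const C)).norm
    have hcont : Continuous fun t => pair H (fun x => a (t, x)) κ (u t₀) := by
      refine continuous_of_dominated (fun t => ?_) (fun t => ?_) hdom ?_
      · exact (hu.memLp ht₀).1.mul (Continuous.aestronglyMeasurable (by fun_prop))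
      · filter_upwards [ae_strip_mem H] with q hq
        simp only [norm_mul]
        exact mul_le_mul_of_nonneg_left (mul_le_mul ((haA t _).trans (le_abs_self _))
          ((hC' _ hq).trans (le_abs_self _)) (norm_nonneg _) (norm_nonneg _)) (norm_nonneg _)
      · exact ae_of_all _ fun q => by fun_prop
    exact hcont.continuousWithinAt
  have hdiff : Tendsto (fun t => pair H (fun x => a (t, x)) κ (u t - u t₀)) (𝓝[Icc 0 T] t₀)
      (𝓝 0) := by
    have h1 : Tendsto (fun t => (eLpNorm (u t - u t₀) 2 (stripMeasure d H)).toReal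
        * (eLpNorm (fun q : Horiz d × ℝ => A q.1 * C) 2 (stripMeasure d H)).toReal)
        (𝓝[Icc 0 T] t₀) (𝓝 0) := by
      have := ((ENNReal.tendsto_toReal ENNReal.zero_ne_top).comp
        (hu.tendsto_eLpNorm hs ht₀)).mul_const
        (eLpNorm (fun q : Horiz d × ℝ => A q.1 * C) 2 (stripMeasure d H)).toReal
      simpa using this
    refine squeeze_zero_norm' ?_ h1
    filter_upwards [self_mem_nhdsWithin] with t ht
    exact abs_pair_le ((hu.memLp ht).sub (hu.memLp ht₀)) hA (by fun_prop) (haA t) hκ hC'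
  have hsum := hdiff.add hfix
  rw [zero_add] at hsum
  refine hsum.congr' ?_
  filter_upwards [self_mem_nhdsWithin] with t ht
  have hκ2 := memLp_depth_of_continuous (H := H) hκ
  unfold pair
  rw [← integral_add (integrable_mul_tensor ((hu.memLp ht).sub (hu.memLp ht₀)) (hat t) hκ2)
    (integrable_mul_tensor (hu.memLp ht₀) (hat t) hκ2)]
  congr 1 with q
  simp only [Pi.sub_apply]
  ring

/-- The `L²` norm is locally bounded by the triangle inequality around each time, hence bounded on
the compact interval. -/
lemma ContHs0.exists_bound {s : ℝ} (hs : 0 ≤ s) {u : ℝ → Horiz d × ℝ → ℝ}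
    (hu : ContHs0 H T s u) :
    ∃ C, ∀ t ∈ Icc 0 T, (eLpNorm (u t) 2 (stripMeasure d H)).toReal ≤ C := by
  refine isCompact_Icc.induction_on (p := fun S => ∃ C, ∀ t ∈ S ∩ Icc 0 T,
    (eLpNorm (u t) 2 (stripMeasure d H)).toReal ≤ C) ?_ ?_ ?_ ?_ |>.imp
    fun C hC t ht => hC t ⟨ht, ht⟩
  · exact ⟨0, by simp⟩
  · rintro S S' hSS' ⟨C, hC⟩
    exact ⟨C, fun t ht => hC t ⟨hSS' ht.1, ht.2⟩⟩
  · rintro S S' ⟨C, hC⟩ ⟨C', hC'⟩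
    refine ⟨max C C', fun t ht => ?_⟩
    rcases ht.1 with h | h
    · exact (hC t ⟨h, ht.2⟩).trans (le_max_left _ _)
    · exact (hC' t ⟨h, ht.2⟩).trans (le_max_right _ _)
  · intro t₀ ht₀
    refine ⟨{t | t ∈ Icc 0 T → eLpNorm (u t - u t₀) 2 (stripMeasure d H) < 1}, ?_,
      (1 + eLpNorm (u t₀) 2 (stripMeasure d H)).toReal, fun t ht => ?_⟩
    · filter_upwards [(hu.tendsto_eLpNorm hs ht₀).eventually (gt_mem_nhds one_pos)] with t ht _
      exact ht
    · refine ENNReal.toReal_mono (by simpa using (hu.memLp ht₀).2.ne) ?_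
      calc eLpNorm (u t) 2 (stripMeasure d H)
          = eLpNorm ((u t - u t₀) + u t₀) 2 (stripMeasure d H) := by rw [sub_add_cancel]
        _ ≤ eLpNorm (u t - u t₀) 2 (stripMeasure d H) + eLpNorm (u t₀) 2 (stripMeasure d H) :=
          eLpNorm_add_le ((hu.memLp ht.2).1.sub (hu.memLp ht₀).1) (hu.memLp ht₀).1 one_le_two
        _ ≤ _ := by gcongr; exact (ht.1 ht.2).le

lemma ContHs0.timeL2 {s : ℝ} (hs : 0 ≤ s) {u : ℝ → Horiz d × ℝ → ℝ} (hu : ContHs0 H T s u) :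
    TimeL2 H T u := by
  obtain ⟨C, hC⟩ := hu.exists_bound hs
  have hmem : ∀ᵐ t ∂(volume.restrict (Ioo 0 T)), t ∈ Icc 0 T := by
    filter_upwards [ae_restrict_mem measurableSet_Ioo] with t ht
    exact Ioo_subset_Icc_self ht
  refine ⟨?_, ⟨fun _ => C, integrable_const _, ?_⟩, fun a ha hc κ hκ => ?_⟩
  · filter_upwards [hmem] with t ht
    exact hu.memLp ht
  · filter_upwards [hmem] with t ht
    exact hC t ht
  · exact ((hu.continuousOn_pair hs ha hc hκ).mono Ioo_subset_Icc_self).aestronglyMeasurable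
      measurableSet_Ioo

end Pairing

/-! ### Calculus of test functions: slices, products and directional derivatives -/

section TestFunctions

variable {E F : Type*} [NormedAddCommGroup E] [NormedSpace ℝ E] [NormedAddCommGroup F]
  [NormedSpace ℝ F]

lemma IsTest.differentiable {Ω : Set E} {φ : E → ℝ} (h : IsTest Ω φ) : Differentiable ℝ φ :=
  h.1.differentiable (by simp)

lemma IsTest.continuous {Ω : Set E} {φ : E → ℝ} (h : IsTest Ω φ) : Continuous φ := h.1.continuous

lemma IsTest.mono {Ω Ω' : Set E} {φ : E → ℝ} (h : IsTest Ω φ) (hΩ : Ω ⊆ Ω') : IsTest Ω' φ :=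
  ⟨h.1, h.2.1, h.2.2.trans hΩ⟩

lemma IsTest.pd {Ω : Set E} {φ : E → ℝ} (h : IsTest Ω φ) (v : E) : IsTest Ω (pd v φ) := by
  have hsub : tsupport (InternalWaves.pd v φ) ⊆ tsupport φ :=
    (closure_mono (Function.support_subset_iff'.2 fun x hx => by
      simp [InternalWaves.pd, Function.notMem_support.1 hx])).trans (tsupport_fderiv_subset ℝ)
  exact ⟨(h.1.fderiv_right (m := ∞) (by simp)).clm_apply contDiff_const,
    h.2.1.isCompact.of_isClosed_subset (isClosed_tsupport _) hsub, hsub.trans h.2.2⟩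

lemma pd_comm {φ : E → ℝ} (h : ContDiff ℝ ∞ φ) (v w : E) : pd v (pd w φ) = pd w (pd v φ) := by
  have hd : Differentiable ℝ (fderiv ℝ φ) :=
    (h.fderiv_right (m := ∞) (by simp)).differentiable (by simp)
  have hpd : ∀ v w p, pd v (pd w φ) p = fderiv ℝ (fderiv ℝ φ) p v w := by
    intro v w p
    have h1 : HasFDerivAt (pd w φ) _ p := (hd p).hasFDerivAt.clm_apply (hasFDerivAt_const w p)
    rw [pd, h1.fderiv]
    simp
  ext p
  rw [hpd, hpd]
  exact ((contDiff_infty.1 h 2).contDiffAt.isSymmSndFDerivAt (by simp)) v w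

lemma pd_comp_prodMk {φ : E × F → ℝ} (h : Differentiable ℝ φ) (t : E) (v x : F) :
    pd v (fun x => φ (t, x)) x = pd (0, v) φ (t, x) := by
  have h1 : HasFDerivAt (fun x => φ (t, x))
      ((fderiv ℝ φ (t, x)).comp (ContinuousLinearMap.inr ℝ E F)) x :=
    (h (t, x)).hasFDerivAt.comp x (hasFDerivAt_prodMk_right t x)
  simp only [pd, h1.fderiv]
  simp

lemma IsTest.slice {I : Set E} {φ : E × F → ℝ} (h : IsTest (I ×ˢ univ) φ) (t : E) :
    IsTest univ fun x => φ (t, x) := by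
  refine ⟨h.1.comp (contDiff_prodMk_right t), ?_, subset_univ _⟩
  refine HasCompactSupport.of_support_subset_isCompact (h.2.1.isCompact.image continuous_snd)
    fun x hx => ⟨(t, x), subset_tsupport _ hx, rfl⟩

lemma IsTest.prod {Ω : Set E} {Ω' : Set F} {φ : E → ℝ} {k : F → ℝ} (hφ : IsTest Ω φ)
    (hk : IsTest Ω' k) : IsTest (Ω ×ˢ Ω') fun q : E × F => φ q.1 * k q.2 := by
  have hsub : tsupport (fun q : E × F => φ q.1 * k q.2) ⊆ tsupport φ ×ˢ tsupport k := by
    refine closure_minimal (fun q hq => ⟨subset_tsupport _ fun h => hq ?_,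
      subset_tsupport _ fun h => hq ?_⟩) ((isClosed_tsupport _).prod (isClosed_tsupport _))
    · simp [h]
    · simp [h]
  exact ⟨(hφ.1.comp contDiff_fst).mul (hk.1.comp contDiff_snd),
    (hφ.2.1.isCompact.prod hk.2.1.isCompact).of_isClosed_subset (isClosed_tsupport _) hsub,
    hsub.trans (prod_mono hφ.2.2 hk.2.2)⟩

lemma pd_prod {φ : E → ℝ} {k : F → ℝ} (hφ : Differentiable ℝ φ) (hk : Differentiable ℝ k)
    (v : E × F) (q : E × F) :
    pd v (fun q : E × F => φ q.1 * k q.2) q = pd v.1 φ q.1 * k q.2 + φ q.1 * pd v.2 k q.2 := by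
  have h1 : HasFDerivAt (fun q : E × F => φ q.1)
      ((fderiv ℝ φ q.1).comp (ContinuousLinearMap.fst ℝ E F)) q :=
    (hφ q.1).hasFDerivAt.comp q hasFDerivAt_fst
  have h2 : HasFDerivAt (fun q : E × F => k q.2)
      ((fderiv ℝ k q.2).comp (ContinuousLinearMap.snd ℝ E F)) q :=
    (hk q.2).hasFDerivAt.comp q hasFDerivAt_snd
  have h3 : HasFDerivAt (fun q : E × F => φ q.1 * k q.2) _ q := h1.mul h2
  rw [pd, h3.fderiv]
  simp [pd]
  ring

lemma pd_real (k : ℝ → ℝ) (z v : ℝ) : pd v k z = v * deriv k z := by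
  simp [pd]

variable {d : ℕ}

/-- `IsTest.prod` does not apply directly: the factors group the variables as `(t,x)` and `z`, the
strip as `t` and `(x,z)`. -/
lemma IsTest.timeProd {I J : Set ℝ} {φ : ℝ × Horiz d → ℝ} {k : ℝ → ℝ}
    (hφ : IsTest (I ×ˢ univ) φ) (hk : IsTest J k) :
    IsTest (I ×ˢ (univ ×ˢ J)) fun q : ℝ × (Horiz d × ℝ) => φ (q.1, q.2.1) * k q.2.2 := by
  set S : Set (ℝ × (Horiz d × ℝ)) := {q | (q.1, q.2.1) ∈ tsupport φ ∧ q.2.2 ∈ tsupport k} with hS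
  have hSc : IsClosed S := ((isClosed_tsupport φ).preimage (by fun_prop)).inter
    ((isClosed_tsupport k).preimage (by fun_prop))
  have hsub : tsupport (fun q : ℝ × (Horiz d × ℝ) => φ (q.1, q.2.1) * k q.2.2) ⊆ S := by
    refine closure_minimal (fun q hq => ⟨subset_tsupport _ fun h => hq ?_,
      subset_tsupport _ fun h => hq ?_⟩) hSc
    · simp [h]
    · simp [h]
  have hK : IsCompact ((Prod.fst '' tsupport φ) ×ˢ ((Prod.snd '' tsupport φ) ×ˢ tsupport k)) :=
    (hφ.2.1.isCompact.image continuous_fst).prod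
      ((hφ.2.1.isCompact.image continuous_snd).prod hk.2.1.isCompact)
  refine ⟨?_, hK.of_isClosed_subset (isClosed_tsupport _) fun q hq => ?_, fun q hq => ?_⟩
  · exact (hφ.1.comp (contDiff_fst.prodMk (contDiff_fst.comp contDiff_snd))).mul
      (hk.1.comp (contDiff_snd.comp contDiff_snd))
  · have h := hsub hq
    exact ⟨⟨_, h.1, rfl⟩, ⟨_, h.1, rfl⟩, h.2⟩
  · have h := hsub hq
    exact ⟨(hφ.2.2 h.1).1, mem_univ _, hk.2.2 h.2⟩

lemma pd_timeProd {φ : ℝ × Horiz d → ℝ} {k : ℝ → ℝ} (hφ : Differentiable ℝ φ)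
    (hk : Differentiable ℝ k) (t τ ζ : ℝ) (v : Horiz d) (q : Horiz d × ℝ) :
    pd (τ, (v, ζ)) (fun q : ℝ × (Horiz d × ℝ) => φ (q.1, q.2.1) * k q.2.2) (t, q)
      = pd (τ, v) φ (t, q.1) * k q.2 + φ (t, q.1) * (ζ * deriv k q.2) := by
  let L₁ : ℝ × (Horiz d × ℝ) →L[ℝ] ℝ × Horiz d := (ContinuousLinearMap.fst ℝ ℝ (Horiz d × ℝ)).prod
    ((ContinuousLinearMap.fst ℝ (Horiz d) ℝ).comp (ContinuousLinearMap.snd ℝ ℝ (Horiz d × ℝ)))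
  let L₂ : ℝ × (Horiz d × ℝ) →L[ℝ] ℝ :=
    (ContinuousLinearMap.snd ℝ (Horiz d) ℝ).comp (ContinuousLinearMap.snd ℝ ℝ (Horiz d × ℝ))
  have h1 : HasFDerivAt (fun q : ℝ × (Horiz d × ℝ) => φ (q.1, q.2.1))
      ((fderiv ℝ φ (t, q.1)).comp L₁) (t, q) :=
    (hφ (t, q.1)).hasFDerivAt.comp (t, q) L₁.hasFDerivAt
  have h2 : HasFDerivAt (fun q : ℝ × (Horiz d × ℝ) => k q.2.2)
      ((fderiv ℝ k q.2).comp L₂) (t, q) :=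
    (hk q.2).hasFDerivAt.comp (t, q) L₂.hasFDerivAt
  have h3 : HasFDerivAt (fun q : ℝ × (Horiz d × ℝ) => φ (q.1, q.2.1) * k q.2.2) _ (t, q) :=
    h1.mul h2
  have h4 := pd_real k q.2 ζ
  rw [pd] at h4
  rw [pd, h3.fderiv, ← h4]
  simp [pd, L₁, L₂]
  ring

end TestFunctions

/-! ### The equations tested with products, up to the boundary -/

section WeakEquations

variable {d : ℕ} {H g T A β : ℝ} {ρeq : ℝ → ℝ} {V : ℝ → Horiz d × ℝ → Horiz d}
  {w ρ P : ℝ → Horiz d × ℝ → ℝ}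

lemma memLp_two_of_isTest {φ : Horiz d → ℝ} {Ω : Set (Horiz d)} (h : IsTest Ω φ) :
    MemLp φ 2 volume := h.continuous.memLp_of_hasCompactSupport h.2.1

/-- The horizontal momentum equation, tested up to the boundary. -/
lemma SolvesLinearized.pair_horizontal (hsol : SolvesLinearized H g T ρeq V w ρ P)
    (hρ : ∀ z ∈ Ioo (-H) 0, ρeq z = A * Real.exp (-β * z)) {j : Fin d}
    (hV : TimeL2 H T fun t q => V t q j) (hP : TimeL2 H T P) {φ : ℝ × Horiz d → ℝ}
    (hφ : IsTest (Ioo 0 T ×ˢ univ) φ) {κ : ℝ → ℝ} (hκ : ContDiff ℝ ∞ κ) :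
    (∫ t in Ioo 0 T, pair H (fun x => pd (1, 0) φ (t, x)) (fun z => A * Real.exp (-β * z) * κ z)
        fun q => V t q j)
      + ∫ t in Ioo 0 T, pair H (fun x => pd (0, unitVec j) φ (t, x)) κ (P t) = 0 := by
  have hκc := hκ.continuous
  have h0 := hφ.pd (1, 0)
  have h1 := hφ.pd (0, unitVec j)
  -- For `k` supported inside `(-H, 0)` the product is a genuine test function; general `κ` follows
  -- by removing the cutoff.
  have step : ∀ k : ℝ → ℝ, IsTest (Ioo (-H) 0) k →
      (∫ t in Ioo 0 T, pair H (fun x => pd (1, 0) φ (t, x)) (fun z => A * Real.exp (-β * z) * k z)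
        fun q => V t q j)
      + ∫ t in Ioo 0 T, pair H (fun x => pd (0, unitVec j) φ (t, x)) k (P t) = 0 := by
    intro k hk
    have hΦ := hφ.timeProd hk
    have hkc := hk.continuous
    have hrk : Continuous fun z => A * Real.exp (-β * z) * k z := by fun_prop
    rw [← integral_add (hV.integrable_pair h0.continuous h0.2.1 hrk)
      (hP.integrable_pair h1.continuous h1.2.1 hkc)]
    refine Eq.trans (integral_congr_ae ?_) (hsol.horizontal_momentum j _ hΦ)
    filter_upwards [hV.memLp, hP.memLp] with t hVt hPt
    unfold pair
    rw [← integral_add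
      (integrable_mul_tensor hVt (memLp_two_of_isTest (h0.slice t))
        (memLp_depth_of_continuous hrk))
      (integrable_mul_tensor hPt (memLp_two_of_isTest (h1.slice t))
        (memLp_depth_of_continuous hkc))]
    refine integral_congr_ae ?_
    filter_upwards [ae_strip_mem H] with q hq
    rw [pd_timeProd hφ.differentiable hk.differentiable,
      pd_timeProd hφ.differentiable hk.differentiable, hρ q.2 hq]
    ring
  have hr : Continuous fun z => A * Real.exp (-β * z) * κ z := by fun_prop
  obtain ⟨C, hC⟩ := exists_abs_mul_cutoff_le H hr
  obtain ⟨C', hC'⟩ := exists_abs_mul_cutoff_le H hκc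
  have l1 := hV.tendsto_integral_pair h0.continuous h0.2.1
    (κs := fun m z => A * Real.exp (-β * z) * κ z * cutoff H m z)
    (fun m => hr.mul (contDiff_cutoff H m).continuous) hC
    (fun z hz => tendsto_mul_cutoff hz fun z => A * Real.exp (-β * z) * κ z)
  have l2 := hP.tendsto_integral_pair h1.continuous h1.2.1
    (κs := fun m z => κ z * cutoff H m z) (fun m => hκc.mul (contDiff_cutoff H m).continuous) hC' (fun z hz => tendsto_mul_cutoff hz κ)
  refine tendsto_nhds_unique (l1.add l2) (tendsto_const_nhds.congr fun m => ?_)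
  simp only [mul_assoc]
  have := step _ (isTest_mul_cutoff hκ H m)
  simp only [mul_assoc] at this
  exact this.symm

/-- The vertical momentum equation, tested with functions vanishing at the boundary. -/
lemma SolvesLinearized.pair_vertical (hsol : SolvesLinearized H g T ρeq V w ρ P)
    (hρeq : ∀ z ∈ Ioo (-H) 0, ρeq z = A * Real.exp (-β * z))
    (hw : TimeL2 H T w) (hP : TimeL2 H T P) (hρ : TimeL2 H T ρ) {φ : ℝ × Horiz d → ℝ}
    (hφ : IsTest (Ioo 0 T ×ˢ univ) φ) {κ : ℝ → ℝ} (hκ : ContDiff ℝ ∞ κ)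
    (hb : κ (-H) = 0) (ht : κ 0 = 0) :
    (∫ t in Ioo 0 T, pair H (fun x => pd (1, 0) φ (t, x)) (fun z => A * Real.exp (-β * z) * κ z)
        (w t))
      + (∫ t in Ioo 0 T, pair H (fun x => φ (t, x)) (deriv κ) (P t))
      - ∫ t in Ioo 0 T, pair H (fun x => φ (t, x)) (fun z => g * κ z) (ρ t) = 0 := by
  have hκc := hκ.continuous
  have h0 := hφ.pd (1, 0)
  have step : ∀ k : ℝ → ℝ, IsTest (Ioo (-H) 0) k →
      (∫ t in Ioo 0 T, pair H (fun x => pd (1, 0) φ (t, x)) (fun z => A * Real.exp (-β * z) * k z)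
        (w t))
      + (∫ t in Ioo 0 T, pair H (fun x => φ (t, x)) (deriv k) (P t))
      - ∫ t in Ioo 0 T, pair H (fun x => φ (t, x)) (fun z => g * k z) (ρ t) = 0 := by
    intro k hk
    have hΦ := hφ.timeProd hk
    have hkc := hk.continuous
    have hdk : Continuous (deriv k) := hk.1.continuous_deriv (by simp)
    have hrk : Continuous fun z => A * Real.exp (-β * z) * k z := by fun_prop
    have hgk : Continuous fun z => g * k z := by fun_prop
    have j1 := hw.integrable_pair h0.continuous h0.2.1 hrk
    have j2 := hP.integrable_pair hφ.continuous hφ.2.1 hdk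
    have j12 : Integrable (fun t => pair H (fun x => pd (1, 0) φ (t, x))
        (fun z => A * Real.exp (-β * z) * k z) (w t) + pair H (fun x => φ (t, x)) (deriv k) (P t))
        (volume.restrict (Ioo 0 T)) := j1.add j2
    rw [← integral_add j1 j2, ← integral_sub j12 (hρ.integrable_pair hφ.continuous hφ.2.1 hgk)]
    refine Eq.trans (integral_congr_ae ?_) (hsol.vertical_momentum _ hΦ)
    filter_upwards [hw.memLp, hP.memLp, hρ.memLp] with t hwt hPt hρt
    have i1 := integrable_mul_tensor hwt (memLp_two_of_isTest (h0.slice t))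
      (memLp_depth_of_continuous hrk)
    have i2 := integrable_mul_tensor hPt (memLp_two_of_isTest (hφ.slice t))
      (memLp_depth_of_continuous hdk)
    have i3 := integrable_mul_tensor hρt (memLp_two_of_isTest (hφ.slice t))
      (memLp_depth_of_continuous hgk)
    unfold pair
    have i12 : Integrable (fun q => w t q * (pd (1, 0) φ (t, q.1)
        * (A * Real.exp (-β * q.2) * k q.2)) + P t q * (φ (t, q.1) * deriv k q.2))
        (stripMeasure d H) := i1.add i2
    rw [← integral_add i1 i2, ← integral_sub i12 i3]
    refine integral_congr_ae ?_
    filter_upwards [ae_strip_mem H] with q hq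
    rw [pd_timeProd hφ.differentiable hk.differentiable,
      pd_timeProd hφ.differentiable hk.differentiable, hρeq q.2 hq]
    have hz : pd ((0 : ℝ), (0 : Horiz d)) φ (t, q.1) = 0 := by
      simp only [pd]
      exact map_zero _
    rw [hz]
    ring
  have hr : Continuous fun z => A * Real.exp (-β * z) * κ z := by fun_prop
  have hgκ : Continuous fun z => g * κ z := by fun_prop
  obtain ⟨C, hC⟩ := exists_abs_mul_cutoff_le H hr
  -- The only place where `κ` must vanish at both ends: the pressure is paired with the derivative
  -- of the cut off function.
  obtain ⟨C', hC'⟩ := exists_abs_deriv_mul_cutoff_le hκ hb ht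
  obtain ⟨C'', hC''⟩ := exists_abs_mul_cutoff_le H hgκ
  have l1 := hw.tendsto_integral_pair h0.continuous h0.2.1
    (κs := fun m z => A * Real.exp (-β * z) * κ z * cutoff H m z)
    (fun m => hr.mul (contDiff_cutoff H m).continuous) hC
    (fun z hz => tendsto_mul_cutoff hz fun z => A * Real.exp (-β * z) * κ z)
  have l2 := hP.tendsto_integral_pair hφ.continuous hφ.2.1
    (fun m => (isTest_mul_cutoff hκ H m).1.continuous_deriv (by simp)) hC'
    (fun z hz => tendsto_deriv_mul_cutoff hz κ)
  have l3 := hρ.tendsto_integral_pair hφ.continuous hφ.2.1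
    (κs := fun m z => g * κ z * cutoff H m z) (fun m => hgκ.mul (contDiff_cutoff H m).continuous) hC''
    (fun z hz => tendsto_mul_cutoff hz fun z => g * κ z)
  refine tendsto_nhds_unique ((l1.add l2).sub l3) (tendsto_const_nhds.congr fun m => ?_)
  simp only [mul_assoc]
  have := step _ (isTest_mul_cutoff hκ H m)
  simp only [mul_assoc] at this
  exact this.symm

lemma deriv_eq_of_eq_exp (hρeq : ∀ z ∈ Ioo (-H) 0, ρeq z = A * Real.exp (-β * z)) {z : ℝ}
    (hz : z ∈ Ioo (-H) 0) : deriv ρeq z = -β * (A * Real.exp (-β * z)) := by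
  have h1 : ρeq =ᶠ[𝓝 z] fun z => A * Real.exp (-β * z) := by
    filter_upwards [isOpen_Ioo.mem_nhds hz] with y hy
    exact hρeq y hy
  rw [h1.deriv_eq, ((hasDerivAt_exp_mul_const (-β) z).const_mul A).deriv]
  ring

/-- The conservation of mass, tested up to the boundary. -/
lemma SolvesLinearized.pair_mass (hsol : SolvesLinearized H g T ρeq V w ρ P)
    (hρeq : ∀ z ∈ Ioo (-H) 0, ρeq z = A * Real.exp (-β * z))
    (hw : TimeL2 H T w) (hρ : TimeL2 H T ρ) {φ : ℝ × Horiz d → ℝ}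
    (hφ : IsTest (Ioo 0 T ×ˢ univ) φ) {κ : ℝ → ℝ} (hκ : ContDiff ℝ ∞ κ) :
    (∫ t in Ioo 0 T, pair H (fun x => pd (1, 0) φ (t, x)) κ (ρ t))
      + ∫ t in Ioo 0 T, pair H (fun x => φ (t, x))
          (fun z => β * (A * Real.exp (-β * z)) * κ z) (w t) = 0 := by
  have hκc := hκ.continuous
  have h0 := hφ.pd (1, 0)
  have step : ∀ k : ℝ → ℝ, IsTest (Ioo (-H) 0) k →
      (∫ t in Ioo 0 T, pair H (fun x => pd (1, 0) φ (t, x)) k (ρ t))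
      + ∫ t in Ioo 0 T, pair H (fun x => φ (t, x))
          (fun z => β * (A * Real.exp (-β * z)) * k z) (w t) = 0 := by
    intro k hk
    have hΦ := hφ.timeProd hk
    have hkc := hk.continuous
    have hrk : Continuous fun z => β * (A * Real.exp (-β * z)) * k z := by fun_prop
    rw [← integral_add (hρ.integrable_pair h0.continuous h0.2.1 hkc)
      (hw.integrable_pair hφ.continuous hφ.2.1 hrk)]
    refine Eq.trans (integral_congr_ae ?_) (hsol.mass _ hΦ)
    filter_upwards [hw.memLp, hρ.memLp] with t hwt hρt
    unfold pair
    rw [← integral_add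
      (integrable_mul_tensor hρt (memLp_two_of_isTest (h0.slice t))
        (memLp_depth_of_continuous hkc))
      (integrable_mul_tensor hwt (memLp_two_of_isTest (hφ.slice t))
        (memLp_depth_of_continuous hrk))]
    refine integral_congr_ae ?_
    filter_upwards [ae_strip_mem H] with q hq
    rw [pd_timeProd hφ.differentiable hk.differentiable, deriv_eq_of_eq_exp hρeq hq]
    ring
  have hr : Continuous fun z => β * (A * Real.exp (-β * z)) * κ z := by fun_prop
  obtain ⟨C, hC⟩ := exists_abs_mul_cutoff_le H hr
  obtain ⟨C', hC'⟩ := exists_abs_mul_cutoff_le H hκc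
  have l1 := hw.tendsto_integral_pair hφ.continuous hφ.2.1
    (κs := fun m z => β * (A * Real.exp (-β * z)) * κ z * cutoff H m z)
    (fun m => hr.mul (contDiff_cutoff H m).continuous) hC
    (fun z hz => tendsto_mul_cutoff hz fun z => β * (A * Real.exp (-β * z)) * κ z)
  have l2 := hρ.tendsto_integral_pair h0.continuous h0.2.1
    (κs := fun m z => κ z * cutoff H m z) (fun m => hκc.mul (contDiff_cutoff H m).continuous) hC' (fun z hz => tendsto_mul_cutoff hz κ)
  refine tendsto_nhds_unique (l2.add l1) (tendsto_const_nhds.congr fun m => ?_)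
  simp only [mul_assoc]
  have := step _ (isTest_mul_cutoff hκ H m)
  simp only [mul_assoc] at this
  exact this.symm

/-- Incompressibility and impermeability, tested against products. -/
lemma SolvesLinearized.pair_incompressible (hH : 0 < H)
    (hsol : SolvesLinearized H g T ρeq V w ρ P) {t : ℝ} (ht : t ∈ Icc 0 T)
    (hV : ∀ j, MemLp (fun q => V t q j) 2 (stripMeasure d H))
    (hw : MemLp (w t) 2 (stripMeasure d H)) {φ : Horiz d → ℝ} (hφ : IsTest univ φ)
    {κ : ℝ → ℝ} (hκ : ContDiff ℝ ∞ κ) :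
    (∑ j, pair H (pd (unitVec j) φ) κ fun q => V t q j) + pair H φ (deriv κ) (w t) = 0 := by
  -- This bump equals `1` on the ball of radius `H` about the midpoint, which contains `(-H, 0)`. It
  -- only supplies compact support in `z`, as `impermeable` imposes no condition at the ends.
  let χ : ContDiffBump (-H / 2 : ℝ) := ⟨H, 2 * H, hH, by linarith⟩
  have hk : IsTest univ fun z => κ z * χ z :=
    ⟨hκ.mul χ.contDiff, χ.hasCompactSupport.mul_left, subset_univ _⟩
  have hone : ∀ z ∈ Ioo (-H) 0, (χ : ℝ → ℝ) =ᶠ[𝓝 z] fun _ => 1 := fun z hz =>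
    χ.eventuallyEq_one_of_mem_ball (by
      rw [Metric.mem_ball, Real.dist_eq, abs_lt]
      change -H < _ ∧ _ < H
      constructor <;> linarith [hz.1, hz.2])
  have hdκ : Continuous (deriv κ) := hκ.continuous_deriv (by simp)
  have i1 : ∀ j : Fin d, Integrable (fun q => V t q j * (pd (unitVec j) φ q.1 * κ q.2))
      (stripMeasure d H) := fun j =>
    integrable_mul_tensor (hV j) (memLp_two_of_isTest (hφ.pd _))
      (memLp_depth_of_continuous hκ.continuous)
  have i2 := integrable_mul_tensor hw (memLp_two_of_isTest hφ) (memLp_depth_of_continuous hdκ)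
  have hΦ : IsTest univ fun q : Horiz d × ℝ => φ q.1 * (κ q.2 * χ q.2) :=
    (hφ.prod hk).mono (subset_univ _)
  rw [← hsol.impermeable t ht _ hΦ]
  unfold pair
  rw [← integral_finsetSum _ (fun j _ => i1 j),
    ← integral_add (integrable_finsetSum _ fun j _ => i1 j) i2]
  refine integral_congr_ae ?_
  filter_upwards [ae_strip_mem H] with q hq
  have e1 : κ q.2 * χ q.2 = κ q.2 := by rw [(hone q.2 hq).self_of_nhds, mul_one]
  have e2 : deriv (fun z => κ z * χ z) q.2 = deriv κ q.2 := by
    refine Filter.EventuallyEq.deriv_eq ?_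
    filter_upwards [hone q.2 hq] with z hz
    rw [hz, mul_one]
  have e3 : ∀ v ζ, pd (v, ζ) (fun q : Horiz d × ℝ => φ q.1 * (κ q.2 * χ q.2)) q
      = pd v φ q.1 * κ q.2 + φ q.1 * (ζ * deriv κ q.2) := by
    intro v ζ
    rw [pd_prod hφ.differentiable hk.differentiable (v, ζ) q, pd_real, e1, e2]
  have hz : pd (0 : Horiz d) φ q.1 = 0 := by
    simp only [pd]
    exact map_zero _
  simp only [e3, hz]
  simp

/-- Vanishing vertical vorticity, tested up to the boundary. -/
lemma ZeroVerticalVorticity.pair_eq {U : Horiz d × ℝ → Horiz d} (h : ZeroVerticalVorticity H U)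
    (hU : ∀ j, MemLp (fun q => U q j) 2 (stripMeasure d H)) (i j : Fin d) {φ : Horiz d → ℝ}
    (hφ : IsTest univ φ) {κ : ℝ → ℝ} (hκ : ContDiff ℝ ∞ κ) :
    pair H (pd (unitVec i) φ) κ (fun q => U q j)
      = pair H (pd (unitVec j) φ) κ fun q => U q i := by
  have hi := memLp_two_of_isTest (hφ.pd (unitVec i))
  have hj := memLp_two_of_isTest (hφ.pd (unitVec j))
  have step : ∀ k : ℝ → ℝ, IsTest (Ioo (-H) 0) k →
      pair H (pd (unitVec i) φ) k (fun q => U q j)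
        = pair H (pd (unitVec j) φ) k fun q => U q i := by
    intro k hk
    have hk2 := memLp_depth_of_continuous (H := H) hk.continuous
    rw [← sub_eq_zero, ← h i j _ (hφ.prod hk)]
    unfold pair
    rw [← integral_sub (integrable_mul_tensor (hU j) hi hk2)
      (integrable_mul_tensor (hU i) hj hk2)]
    congr 1 with q
    rw [pd_prod hφ.differentiable hk.differentiable, pd_prod hφ.differentiable hk.differentiable,
      pd_real]
    ring
  obtain ⟨C, hC⟩ := exists_abs_mul_cutoff_le H hκ.continuous
  have l1 := tendsto_pair_of_dominated (hU j) hi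
    (κs := fun m z => κ z * cutoff H m z) (fun m => hκ.continuous.mul (contDiff_cutoff H m).continuous) hC
    (fun z hz => tendsto_mul_cutoff hz κ)
  have l2 := tendsto_pair_of_dominated (hU i) hj
    (κs := fun m z => κ z * cutoff H m z) (fun m => hκ.continuous.mul (contDiff_cutoff H m).continuous) hC
    (fun z hz => tendsto_mul_cutoff hz κ)
  exact tendsto_nhds_unique l1 (l2.congr fun m => (step _ (isTest_mul_cutoff hκ H m)).symm)

end WeakEquations

/-! ### Functions of time with zero distributional derivative -/

section DuBoisReymond

lemma exists_Icc_of_isCompact_subset_Ioo {a b : ℝ} (hab : a < b) {K : Set ℝ} (hK : IsCompact K)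
    (hKs : K ⊆ Ioo a b) : ∃ α β, a < α ∧ β < b ∧ K ⊆ Icc α β := by
  rcases K.eq_empty_or_nonempty with rfl | hne
  · exact ⟨(a + b) / 2, (a + b) / 2, by linarith, by linarith, empty_subset _⟩
  · exact ⟨sInf K, sSup K, (hKs (hK.sInf_mem hne)).1, (hKs (hK.sSup_mem hne)).2,
      fun x hx => ⟨csInf_le hK.bddBelow hx, le_csSup hK.bddAbove hx⟩⟩

/-- The primitive from `0` vanishes to the left of the support of `h`, and to its right because the
total integral is zero. -/
lemma exists_isTest_primitive {T : ℝ} (hT : 0 < T) {h : ℝ → ℝ} (hh : IsTest (Ioo 0 T) h)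
    (h0 : ∫ t, h t = 0) : ∃ θ, IsTest (Ioo 0 T) θ ∧ deriv θ = h := by
  obtain ⟨α, β, hα, hβ, hsub⟩ := exists_Icc_of_isCompact_subset_Ioo hT hh.2.1.isCompact hh.2.2
  have hzero : ∀ t, t ∉ Icc α β → h t = 0 := fun t ht =>
    image_eq_zero_of_notMem_tsupport fun h' => ht (hsub h')
  set θ : ℝ → ℝ := fun t => ∫ s in (0 : ℝ)..t, h s with hθ
  have hd : ∀ t, HasDerivAt θ (h t) t := fun t =>
    intervalIntegral.integral_hasDerivAt_right (hh.continuous.intervalIntegrable _ _)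
      (hh.continuous.stronglyMeasurableAtFilter _ _) hh.continuous.continuousAt
  have hderiv : deriv θ = h := funext fun t => (hd t).deriv
  have hsupp : Function.support θ ⊆ Icc α β := by
    intro t ht
    by_contra hcon
    refine ht ?_
    rw [mem_Icc, not_and_or, not_le, not_le] at hcon
    rcases hcon with hc | hc
    · have : ∫ s in (0 : ℝ)..t, h s = ∫ s in (0 : ℝ)..t, (0 : ℝ) := by
        refine intervalIntegral.integral_congr fun s hs => hzero s fun hs' => ?_
        have := (mem_uIcc.1 hs)
        rcases this with h1 | h1 <;> linarith [hs'.1, h1.2]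
      simp only [hθ, this]
      simp
    · have h1 : ∫ s in (0 : ℝ)..t, h s = ∫ s, h s := by
        refine intervalIntegral.integral_eq_integral_of_support_subset fun s hs => ?_
        have hs' : s ∈ Icc α β := by
          by_contra hcon
          exact hs (hzero s hcon)
        exact ⟨by linarith [hs'.1], by linarith [hs'.2]⟩
      simp only [hθ, h1, h0]
  have hts : tsupport θ ⊆ Icc α β := closure_minimal hsupp isClosed_Icc
  refine ⟨θ, ⟨?_, isCompact_Icc.of_isClosed_subset (isClosed_tsupport _) hts,
    hts.trans fun t ht => ⟨by linarith [ht.1], by linarith [ht.2]⟩⟩, hderiv⟩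
  rw [contDiff_infty_iff_deriv]
  exact ⟨fun t => (hd t).differentiableAt, hderiv ▸ hh.1⟩

lemma exists_isTest_integral_eq_one {T : ℝ} (hT : 0 < T) :
    ∃ χ : ℝ → ℝ, IsTest (Ioo 0 T) χ ∧ ∫ t, χ t = 1 := by
  let b : ContDiffBump (T / 2 : ℝ) := ⟨T / 8, T / 4, by positivity, by linarith⟩
  refine ⟨b.normed volume, ⟨b.contDiff_normed, b.hasCompactSupport_normed, ?_⟩, b.integral_normed⟩
  rw [b.tsupport_normed_eq]
  intro t ht
  rw [Metric.mem_closedBall, Real.dist_eq, abs_le] at ht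
  change -(T / 4) ≤ _ ∧ _ ≤ T / 4 at ht
  constructor <;> linarith [ht.1, ht.2]

lemma integral_mul_Ioo_eq {T : ℝ} {m ψ : ℝ → ℝ} (hψ : IsTest (Ioo 0 T) ψ) :
    ∫ t in Ioo 0 T, m t * ψ t = ∫ t, m t * ψ t := by
  refine setIntegral_eq_integral_of_forall_compl_eq_zero fun t ht => ?_
  rw [image_eq_zero_of_notMem_tsupport fun h => ht (hψ.2.2 h), mul_zero]

/-- A continuous function on `[0, T]` with vanishing distributional derivative is constant. -/
theorem eq_of_forall_integral_mul_deriv_eq_zero {T : ℝ} (hT : 0 < T) {m : ℝ → ℝ}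
    (hm : ContinuousOn m (Icc 0 T))
    (h : ∀ θ, IsTest (Ioo 0 T) θ → ∫ t in Ioo 0 T, m t * deriv θ t = 0) {t : ℝ}
    (ht : t ∈ Icc 0 T) : m t = m 0 := by
  obtain ⟨χ, hχ, hχ1⟩ := exists_isTest_integral_eq_one hT
  set c := ∫ t in Ioo 0 T, m t * χ t with hc
  have hmi : IntegrableOn m (Ioo 0 T) :=
    (hm.integrableOn_Icc (μ := volume)).mono_set Ioo_subset_Icc_self
  have hint : ∀ ψ, IsTest (Ioo 0 T) ψ → IntegrableOn (fun t => m t * ψ t) (Ioo 0 T) := by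
    intro ψ hψ
    exact ((hm.mul hψ.continuous.continuousOn).integrableOn_Icc (μ := volume)).mono_set
      Ioo_subset_Icc_self
  have hae : ∀ᵐ t, t ∈ Ioo 0 T → m t - c = 0 := by
    refine isOpen_Ioo.ae_eq_zero_of_integral_contDiff_smul_eq_zero
      (f := fun t => m t - c) (μ := volume) ?_ ?_
    · exact (hmi.sub (integrableOn_const (by simp))).locallyIntegrableOn
    · intro ψ h1 h2 h3
      have hψ : IsTest (Ioo 0 T) ψ := ⟨h1, h2, h3⟩
      set k := ∫ t, ψ t with hk
      -- `ψ - k χ` has zero mean, hence is the derivative of a test function and orthogonal to `m`;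
      -- this says that `m - c` is orthogonal to `ψ`.
      have htest : IsTest (Ioo 0 T) fun t => ψ t - k * χ t := by
        have hs : tsupport (fun t => ψ t - k * χ t) ⊆ tsupport ψ ∪ tsupport χ := by
          refine closure_minimal (fun t ht => ?_)
            ((isClosed_tsupport _).union (isClosed_tsupport _))
          by_contra hcon
          rw [mem_union, not_or] at hcon
          refine ht ?_
          simp [image_eq_zero_of_notMem_tsupport hcon.1, image_eq_zero_of_notMem_tsupport hcon.2]
        exact ⟨h1.sub (contDiff_const.mul hχ.1),
          (h2.isCompact.union hχ.2.1.isCompact).of_isClosed_subset (isClosed_tsupport _) hs,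
          hs.trans (union_subset h3 hχ.2.2)⟩
      have hψi : Integrable ψ := hψ.continuous.integrable_of_hasCompactSupport h2
      have hχi : Integrable χ := hχ.continuous.integrable_of_hasCompactSupport hχ.2.1
      obtain ⟨θ, hθ, hθd⟩ := exists_isTest_primitive hT htest (by
        rw [integral_sub hψi (hχi.const_mul k), integral_const_mul, hχ1, mul_one, sub_self])
      have h4 := h θ hθ
      rw [hθd] at h4
      have h5 : ∫ t in Ioo 0 T, m t * (ψ t - k * χ t)
          = (∫ t in Ioo 0 T, m t * ψ t) - k * c := by
        rw [hc, ← integral_const_mul, ← integral_sub (hint ψ hψ) ((hint χ hχ).const_mul k)]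
        congr 1 with t
        ring
      rw [h5] at h4
      have h6 : ∫ t, ψ t • (m t - c) = ∫ t in Ioo 0 T, (m t - c) * ψ t := by
        rw [integral_mul_Ioo_eq (m := fun t => m t - c) hψ]
        simp only [smul_eq_mul, mul_comm]
      have h7 : ∫ t in Ioo 0 T, ψ t = k := by
        simpa using integral_mul_Ioo_eq (m := fun _ => 1) hψ
      rw [h6]
      have h8 : ∫ t in Ioo 0 T, (m t - c) * ψ t
          = (∫ t in Ioo 0 T, m t * ψ t) - c * ∫ t in Ioo 0 T, ψ t := by
        rw [← integral_const_mul, ← integral_sub (hint ψ hψ) (hψi.integrableOn.const_mul c)]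
        congr 1 with t
        ring
      rw [h8, h7]
      linarith
  have hae' : m =ᵐ[volume.restrict (Icc 0 T)] fun _ => c := by
    rw [← restrict_Ioo_eq_restrict_Icc]
    refine (ae_restrict_iff' measurableSet_Ioo).2 ?_
    filter_upwards [hae] with t ht hmem
    exact sub_eq_zero.1 (ht hmem)
  have heq := Measure.eqOn_Icc_of_ae_eq volume hT.ne hae' hm continuousOn_const
  rw [heq ht, heq ⟨le_rfl, hT.le⟩]

end DuBoisReymond

/-! ### A Liouville theorem for harmonic functions in `L²` -/

section Liouville

variable {d : ℕ}

open SchwartzMap LineDeriv Laplacian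

/-- The cutoffs are `b(x/(m+1))` for one fixed bump `b`; each derivative brings a factor `1/(m+1)`,
so the derivatives are bounded and tend to zero. -/
lemma exists_scaled_cutoff (d : ℕ) :
    ∃ χ : ℕ → Horiz d → ℝ, (∀ m, IsTest univ (χ m)) ∧ (∀ m x, |χ m x| ≤ 1) ∧
      (∀ x, Tendsto (fun m => χ m x) atTop (𝓝 1)) ∧
      ∀ v : Horiz d, ∃ C, (∀ m x, |pd v (χ m) x| ≤ C ∧ |pd v (pd v (χ m)) x| ≤ C) ∧
        ∀ x, Tendsto (fun m => pd v (χ m) x) atTop (𝓝 0) ∧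
          Tendsto (fun m => pd v (pd v (χ m)) x) atTop (𝓝 0) := by
  let b : ContDiffBump (0 : Horiz d) := ⟨1, 2, one_pos, one_lt_two⟩
  have hb : IsTest univ (b : Horiz d → ℝ) := ⟨b.contDiff, b.hasCompactSupport, subset_univ _⟩
  set ε : ℕ → ℝ := fun m => (m + 1 : ℝ)⁻¹ with hε
  have hε0 : ∀ m, 0 < ε m := fun m => by positivity
  have hε1 : ∀ m, ε m ≤ 1 := fun m => inv_le_one_of_one_le₀ (by linarith [m.cast_nonneg (α := ℝ)])
  have hεlim : Tendsto ε atTop (𝓝 0) := by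
    simpa [hε, one_div] using tendsto_one_div_add_atTop_nhds_zero_nat (𝕜 := ℝ)
  have hpd : ∀ (φ : Horiz d → ℝ), Differentiable ℝ φ → ∀ m v x,
      pd v (fun x => φ (ε m • x)) x = ε m * pd v φ (ε m • x) := by
    intro φ hφ m v x
    have h1 : HasFDerivAt (fun x => φ (ε m • x))
        ((fderiv ℝ φ (ε m • x)).comp (ε m • ContinuousLinearMap.id ℝ (Horiz d))) x :=
      (hφ (ε m • x)).hasFDerivAt.comp x ((hasFDerivAt_id x).const_smul (ε m))
    simp [pd, h1.fderiv]
  have hpd2 : ∀ m v x, pd v (pd v fun x => b (ε m • x)) x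
      = ε m * (ε m * pd v (pd v b) (ε m • x)) := by
    intro m v x
    have h1 : pd v (fun x => b (ε m • x)) = fun x => ε m * pd v b (ε m • x) :=
      funext fun x => hpd _ hb.differentiable m v x
    rw [h1]
    have h2 := hpd _ (hb.pd v).differentiable m v x
    have h3 : DifferentiableAt ℝ (fun x => pd v b (ε m • x)) x :=
      ((hb.pd v).differentiable _).comp x (differentiableAt_id.const_smul (ε m))
    rw [pd, fderiv_const_mul h3, ← h2]
    rfl
  have hscale : ∀ m, IsTest univ fun x => b (ε m • x) := by
    intro m
    refine ⟨b.contDiff.comp (contDiff_const_smul _), ?_, subset_univ _⟩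
    exact b.hasCompactSupport.comp_smul (hε0 m).ne'
  refine ⟨fun m x => b (ε m • x), hscale, fun m x => ?_, fun x => ?_, fun v => ?_⟩
  · rw [abs_of_nonneg b.nonneg]
    exact b.le_one
  · have h1 : Tendsto (fun m => b (ε m • x)) atTop (𝓝 (b ((0 : ℝ) • x))) :=
      (b.continuous.tendsto _).comp (hεlim.smul_const x)
    rw [zero_smul, b.one_of_mem_closedBall (Metric.mem_closedBall_self zero_le_one)] at h1
    exact h1
  · obtain ⟨C₁, hC₁⟩ := (hb.pd v).2.1.exists_bound_of_continuous (hb.pd v).continuous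
    obtain ⟨C₂, hC₂⟩ := ((hb.pd v).pd v).2.1.exists_bound_of_continuous
      ((hb.pd v).pd v).continuous
    have hC₁0 : 0 ≤ C₁ := (norm_nonneg _).trans (hC₁ 0)
    have hC₂0 : 0 ≤ C₂ := (norm_nonneg _).trans (hC₂ 0)
    have e1 : ∀ m x, |pd v (fun x => b (ε m • x)) x| ≤ ε m * C₁ := by
      intro m x
      rw [hpd _ hb.differentiable, abs_mul, abs_of_pos (hε0 m)]
      exact mul_le_mul_of_nonneg_left (hC₁ _) (hε0 m).le
    have e2 : ∀ m x, |pd v (pd v fun x => b (ε m • x)) x| ≤ ε m * C₂ := by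
      intro m x
      rw [hpd2, abs_mul, abs_mul, abs_of_pos (hε0 m)]
      refine mul_le_mul_of_nonneg_left ?_ (hε0 m).le
      exact (mul_le_of_le_one_left (abs_nonneg _) (hε1 m)).trans (hC₂ _)
    refine ⟨max C₁ C₂, fun m x => ⟨?_, ?_⟩, fun x => ⟨?_, ?_⟩⟩
    · exact (e1 m x).trans ((mul_le_of_le_one_left hC₁0 (hε1 m)).trans (le_max_left _ _))
    · exact (e2 m x).trans ((mul_le_of_le_one_left hC₂0 (hε1 m)).trans (le_max_right _ _))
    · refine squeeze_zero_norm (fun m => e1 m x) ?_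
      simpa using hεlim.mul_const C₁
    · refine squeeze_zero_norm (fun m => e2 m x) ?_
      simpa using hεlim.mul_const C₂

lemma pd_mul {E : Type*} [NormedAddCommGroup E] [NormedSpace ℝ E] {φ ψ : E → ℝ}
    (hφ : Differentiable ℝ φ) (hψ : Differentiable ℝ ψ) (v x : E) :
    pd v (fun x => φ x * ψ x) x = pd v φ x * ψ x + φ x * pd v ψ x := by
  have h : HasFDerivAt (fun x => φ x * ψ x) _ x := (hφ x).hasFDerivAt.mul (hψ x).hasFDerivAt
  rw [pd, h.fderiv]
  simp [pd]
  ring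

lemma contDiff_pd {E : Type*} [NormedAddCommGroup E] [NormedSpace ℝ E] {φ : E → ℝ}
    (hφ : ContDiff ℝ ∞ φ) (v : E) : ContDiff ℝ ∞ (pd v φ) :=
  (hφ.fderiv_right (m := ∞) (by simp)).clm_apply contDiff_const

lemma pd_pd_mul {E : Type*} [NormedAddCommGroup E] [NormedSpace ℝ E] {φ ψ : E → ℝ}
    (hφ : ContDiff ℝ ∞ φ) (hψ : ContDiff ℝ ∞ ψ) (v x : E) :
    pd v (pd v fun x => φ x * ψ x) x
      = pd v (pd v φ) x * ψ x + 2 * (pd v φ x * pd v ψ x) + φ x * pd v (pd v ψ) x := by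
  have dφ := hφ.differentiable (by simp)
  have dψ := hψ.differentiable (by simp)
  have dφ' := (contDiff_pd hφ v).differentiable (by simp)
  have dψ' := (contDiff_pd hψ v).differentiable (by simp)
  have h1 : (pd v fun x => φ x * ψ x) = fun x => pd v φ x * ψ x + φ x * pd v ψ x :=
    funext fun x => pd_mul dφ dψ v x
  have h2 : HasFDerivAt (fun x => pd v φ x * ψ x + φ x * pd v ψ x) _ x :=
    ((dφ' x).hasFDerivAt.mul (dψ x).hasFDerivAt).add ((dφ x).hasFDerivAt.mul (dψ' x).hasFDerivAt)
  rw [h1, pd, h2.fderiv]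
  simp [pd]
  ring

/-- Weakly harmonic `L²` functions may be tested with rapidly decreasing functions. -/
lemma integral_mul_laplacian_eq_zero {v : Horiz d → ℝ} (hv : MemLp v 2 volume)
    (h : ∀ φ, IsTest univ φ → ∫ x, v x * ∑ k, pd (unitVec k) (pd (unitVec k) φ) x = 0)
    {ψ : Horiz d → ℝ} (hψ : ContDiff ℝ ∞ ψ) (h0 : MemLp ψ 2 volume)
    (h1 : ∀ k : Fin d, MemLp (pd (unitVec k) ψ) 2 volume)
    (h2 : ∀ k : Fin d, MemLp (pd (unitVec k) (pd (unitVec k) ψ)) 2 volume) :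
    ∫ x, v x * ∑ k, pd (unitVec k) (pd (unitVec k) ψ) x = 0 := by
  obtain ⟨χ, hχ, hχ1, hχlim, hχd⟩ := exists_scaled_cutoff d
  choose C hC hClim using fun k : Fin d => hχd (unitVec k)
  have htest : ∀ m, IsTest univ fun x => χ m x * ψ x := fun m =>
    ⟨(hχ m).1.mul hψ, (hχ m).2.1.mul_right, subset_univ _⟩
  have hexp : ∀ m x, v x * ∑ k, pd (unitVec k) (pd (unitVec k) fun x => χ m x * ψ x) x
      = v x * ∑ k : Fin d, (pd (unitVec k) (pd (unitVec k) (χ m)) x * ψ x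
        + 2 * (pd (unitVec k) (χ m) x * pd (unitVec k) ψ x)
        + χ m x * pd (unitVec k) (pd (unitVec k) ψ) x) := fun m x => by
    congr 1
    exact Finset.sum_congr rfl fun k _ => pd_pd_mul (hχ m).1 hψ _ x
  have hlim : Tendsto (fun m => ∫ x, v x * ∑ k, pd (unitVec k)
      (pd (unitVec k) fun x => χ m x * ψ x) x) atTop
      (𝓝 (∫ x, v x * ∑ k, pd (unitVec k) (pd (unitVec k) ψ) x)) := by
    -- By Leibniz, all terms in which a derivative hits the cutoff tend to zero, and each is
    -- dominated since `v` and the derivatives of `ψ` up to order two are in `L²`.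
    refine tendsto_integral_of_dominated_convergence
      (fun x => ∑ k : Fin d, (C k * ‖v x * ψ x‖ + 2 * (C k * ‖v x * pd (unitVec k) ψ x‖)
        + ‖v x * pd (unitVec k) (pd (unitVec k) ψ) x‖)) (fun m => ?_) ?_ (fun m => ?_) ?_
    · refine hv.1.mul (Continuous.aestronglyMeasurable ?_)
      exact continuous_finsetSum _ fun k _ => (((htest m).pd _).pd _).continuous
    · refine integrable_finsetSum _ fun k _ => Integrable.add (Integrable.add ?_ ?_) ?_
      · exact (integrable_mul_of_memLp_two hv h0).norm.const_mul _
      · exact ((integrable_mul_of_memLp_two hv (h1 k)).norm.const_mul _).const_mul _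
      · exact (integrable_mul_of_memLp_two hv (h2 k)).norm
    · refine ae_of_all _ fun x => ?_
      rw [hexp, Finset.mul_sum]
      refine (norm_sum_le _ _).trans (Finset.sum_le_sum fun k _ => ?_)
      have b1 := (hC k m x).1
      have b2 := (hC k m x).2
      have b3 := hχ1 m x
      have e : v x * (pd (unitVec k) (pd (unitVec k) (χ m)) x * ψ x
          + 2 * (pd (unitVec k) (χ m) x * pd (unitVec k) ψ x)
          + χ m x * pd (unitVec k) (pd (unitVec k) ψ) x)
          = pd (unitVec k) (pd (unitVec k) (χ m)) x * (v x * ψ x)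
          + 2 * (pd (unitVec k) (χ m) x * (v x * pd (unitVec k) ψ x))
          + χ m x * (v x * pd (unitVec k) (pd (unitVec k) ψ) x) := by ring
      rw [e]
      refine (norm_add_le _ _).trans (add_le_add ((norm_add_le _ _).trans (add_le_add ?_ ?_)) ?_)
      · rw [norm_mul]
        exact mul_le_mul_of_nonneg_right b2 (norm_nonneg _)
      · rw [norm_mul, norm_mul, Real.norm_ofNat]
        exact mul_le_mul_of_nonneg_left (mul_le_mul_of_nonneg_right b1 (norm_nonneg _)) zero_le_two
      · rw [norm_mul]
        exact mul_le_of_le_one_left (norm_nonneg _) b3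
    · refine ae_of_all _ fun x => ?_
      simp only [hexp]
      refine Tendsto.const_mul _ (tendsto_finsetSum _ fun k _ => ?_)
      have t1 := (hClim k x).2.mul_const (ψ x)
      have t2 := ((hClim k x).1.mul_const (pd (unitVec k) ψ x)).const_mul 2
      have t3 := (hχlim x).mul_const (pd (unitVec k) (pd (unitVec k) ψ) x)
      have := (t1.add t2).add t3
      simpa using this
  exact tendsto_nhds_unique hlim (tendsto_const_nhds.congr fun m => (h _ (htest m)).symm)

lemma pd_clm_comp_schwartz (L : ℂ →L[ℝ] ℝ) (u : 𝓢(Horiz d, ℂ)) (v : Horiz d) :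
    pd v (fun x => L (u x)) = fun x => L ((∂_{v} u : 𝓢(Horiz d, ℂ)) x) := by
  ext x
  have h : HasFDerivAt (fun x => L (u x)) (L.comp (fderiv ℝ u x)) x :=
    L.hasFDerivAt.comp x (u.differentiableAt.hasFDerivAt)
  rw [pd, h.fderiv, SchwartzMap.lineDerivOp_apply_eq_fderiv]
  rfl

/-- `L` will be the real or the imaginary part: this passes from real test functions to the complex
Schwartz functions that define tempered distributions. -/
lemma integral_mul_clm_laplacian_eq_zero {v : Horiz d → ℝ} (hv : MemLp v 2 volume)
    (h : ∀ φ, IsTest univ φ → ∫ x, v x * ∑ k, pd (unitVec k) (pd (unitVec k) φ) x = 0)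
    (L : ℂ →L[ℝ] ℝ) (u : 𝓢(Horiz d, ℂ)) : ∫ x, v x * L ((Δ u) x) = 0 := by
  have hLp : ∀ u : 𝓢(Horiz d, ℂ), MemLp (fun x => L (u x)) 2 (volume : Measure (Horiz d)) :=
    fun u => L.comp_memLp' (u.memLp 2)
  have h1 : ∀ k : Fin d, pd (unitVec k) (fun x => L (u x))
      = fun x => L ((∂_{unitVec k} u : 𝓢(Horiz d, ℂ)) x) := fun k => pd_clm_comp_schwartz L u _
  have h2 : ∀ k : Fin d, pd (unitVec k) (pd (unitVec k) fun x => L (u x))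
      = fun x => L ((∂_{unitVec k} (∂_{unitVec k} u) : 𝓢(Horiz d, ℂ)) x) := fun k => by
    rw [h1, pd_clm_comp_schwartz]
  have key := integral_mul_laplacian_eq_zero hv h (ψ := fun x => L (u x))
    (L.contDiff.comp (u.smooth ⊤)) (hLp u) (fun k => by rw [h1]; exact hLp _)
    (fun k => by rw [h2]; exact hLp _)
  rw [← key]
  congr 1 with x
  congr 1
  rw [SchwartzMap.laplacian_eq_sum (EuclideanSpace.basisFun (Fin d) ℝ) u, sum_apply,
    map_sum]
  refine Finset.sum_congr rfl fun k _ => ?_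
  rw [h2, EuclideanSpace.basisFun_apply]
  rfl

open TemperedDistribution in
/-- A weakly harmonic function in `L²(ℝ^d)`, `d ≥ 1`, vanishes. -/
theorem ae_eq_zero_of_weakly_harmonic (hd : 0 < d) {v : Horiz d → ℝ} (hv : MemLp v 2 volume)
    (h : ∀ φ, IsTest univ φ → ∫ x, v x * ∑ k, pd (unitVec k) (pd (unitVec k) φ) x = 0) :
    v =ᵐ[volume] 0 := by
  have : Nonempty (Fin d) := ⟨⟨0, hd⟩⟩
  have hvc : MemLp (fun x => (v x : ℂ)) 2 (volume : Measure (Horiz d)) := hv.ofReal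
  set W : Lp ℂ 2 (volume : Measure (Horiz d)) := hvc.toLp _ with hW
  have hΔ : Δ (W : 𝓢'(Horiz d, ℂ)) = 0 := by
    ext u
    rw [TemperedDistribution.laplacian_apply_apply, Lp.toTemperedDistribution_apply]
    have hae : (fun x => (Δ u) x • W x) =ᵐ[volume] fun x => (Δ u) x * (v x : ℂ) := by
      filter_upwards [hvc.coeFn_toLp] with x hx
      rw [hx, smul_eq_mul]
    rw [integral_congr_ae hae]
    have hint : Integrable (fun x => (Δ u) x * (v x : ℂ)) (volume : Measure (Horiz d)) :=
      integrable_mul_of_memLp_two ((Δ u).memLp 2) hvc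
    refine Complex.ext ?_ ?_
    · have := integral_mul_clm_laplacian_eq_zero hv h Complex.reCLM u
      rw [← Complex.reCLM_apply, ← ContinuousLinearMap.integral_comp_comm _ hint]
      simpa [mul_comm] using this
    · have := integral_mul_clm_laplacian_eq_zero hv h Complex.imCLM u
      rw [← Complex.imCLM_apply, ← ContinuousLinearMap.integral_comp_comm _ hint]
      simpa [mul_comm] using this
  -- On the Fourier side the equation reads `|ξ|² Ŵ = 0`, first as a distribution and then almost
  -- everywhere, `Ŵ` being a function.
  rw [TemperedDistribution.laplacian_eq_fourierMultiplierCLM, smul_eq_zero] at hΔ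
  have hpi : ¬ (-(2 * Real.pi) ^ 2 : ℝ) = 0 := by
    have := Real.pi_pos
    simp [this.ne']
  have hmul := hΔ.resolve_left hpi
  rw [TemperedDistribution.fourierMultiplierCLM_apply] at hmul
  have hmul2 := congrArg (fun S : 𝓢'(Horiz d, ℂ) => 𝓕 S) hmul
  simp only [FourierTransform.fourier_fourierInv_eq] at hmul2
  rw [Lp.fourier_toTemperedDistribution_eq] at hmul2
  set Ŵ : Lp ℂ 2 (volume : Measure (Horiz d)) := 𝓕 W with hŴ
  have hzero : ∀ᵐ ξ : Horiz d, (((‖ξ‖ ^ 2 : ℝ) : ℂ)) * Ŵ ξ = 0 := by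
    refine ae_eq_zero_of_integral_contDiff_smul_eq_zero ?_ fun χ hχ hχc => ?_
    · have h1 : LocallyIntegrable Ŵ (volume : Measure (Horiz d)) :=
        (Lp.memLp Ŵ).locallyIntegrable (by norm_num)
      rw [← locallyIntegrableOn_univ] at h1 ⊢
      exact h1.continuousOn_mul (Continuous.continuousOn (by fun_prop)) isOpen_univ.isLocallyClosed
    · have c1 : HasCompactSupport (Complex.ofRealCLM ∘ χ) := hχc.comp_left rfl
      have c2 : ContDiff ℝ ∞ (Complex.ofRealCLM ∘ χ) := by fun_prop
      have h1 := congrArg (fun S : 𝓢'(Horiz d, ℂ) => S (c1.toSchwartzMap c2)) hmul2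
      have hg : (fun x : Horiz d => ((‖x‖ ^ 2 : ℝ) : ℂ)).HasTemperateGrowth := by fun_prop
      have h0 : (𝓕 (0 : 𝓢'(Horiz d, ℂ))) = 0 := FourierTransform.fourier_zero
      simp only [TemperedDistribution.smulLeftCLM_apply_apply, Lp.toTemperedDistribution_apply,
        h0, SchwartzMap.smulLeftCLM_apply_apply hg] at h1
      refine Eq.trans (integral_congr_ae (ae_of_all _ fun ξ => ?_)) h1
      simp
      ring
  have hW0 : Ŵ = 0 := by
    rw [Lp.eq_zero_iff_ae_eq_zero]
    -- Here `d ≥ 1` enters: the origin is a null set.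
    have hne : ∀ᵐ ξ : Horiz d, ξ ≠ 0 := by simp [ae_iff]
    filter_upwards [hzero, hne] with ξ h1 h2
    simpa [h2] using h1
  have : W = 0 := by
    rw [← norm_eq_zero, ← Lp.norm_fourier_eq, ← hŴ, hW0, norm_zero]
  have hcoe := hvc.coeFn_toLp
  rw [← hW, this] at hcoe
  filter_upwards [hcoe, Lp.coeFn_zero ℂ 2 (volume : Measure (Horiz d))] with x h1 h2
  rw [h2] at h1
  simpa using h1.symm

end Liouville

/-! ### Modal coefficients in `H^s`: continuity and summability -/

section ModalCoefficients

variable {d : ℕ} {H : ℝ}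

lemma coeff_eq_avg {ϖ e κ : ℝ → ℝ} (h : ∀ z ∈ Ioo (-H) 0, e z * ϖ z = κ z)
    (u : Horiz d × ℝ → ℝ) : coeff H ϖ e u = avg H κ u := by
  ext x
  refine setIntegral_congr_fun measurableSet_Ioo fun z hz => ?_
  rw [← h z hz, mul_assoc]

/-- A family `(e_n)_{n ≥ 1}` of functions, continuous up to the boundary, which is orthonormal for
the weight `ϖ`. -/
structure OrthoFamily (H : ℝ) (ϖ : ℝ → ℝ) (e : ℕ → ℝ → ℝ) : Prop where
  weight : ∃ W : ℝ → ℝ, Continuous W ∧ (∀ z, 0 ≤ W z) ∧ ∀ z ∈ Ioo (-H) 0, ϖ z = W z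
  continuous : ∀ n ≥ 1, ∃ E : ℝ → ℝ, Continuous E ∧ ∀ z ∈ Ioo (-H) 0, e n z = E z
  orthonormal : ∀ m ≥ 1, ∀ n ≥ 1,
    ∫ z, e m z * e n z * ϖ z ∂(depthMeasure H) = if m = n then 1 else 0

variable {ϖ : ℝ → ℝ} {e : ℕ → ℝ → ℝ}

lemma OrthoFamily.exists_continuous (h : OrthoFamily H ϖ e) {n : ℕ} (hn : 1 ≤ n) :
    ∃ κ : ℝ → ℝ, Continuous κ ∧ ∀ z ∈ Ioo (-H) 0, e n z * ϖ z = κ z := by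
  obtain ⟨W, hW, -, hWϖ⟩ := h.weight
  obtain ⟨E, hE, hEe⟩ := h.continuous n hn
  exact ⟨fun z => E z * W z, hE.mul hW, fun z hz => by rw [hWϖ z hz, hEe z hz]⟩

lemma OrthoFamily.exists_sum_le (h : OrthoFamily H ϖ e) : ∃ C : ℝ, ∀ (s : ℝ)
    (u : Horiz d × ℝ → ℝ), MemLp u 2 (stripMeasure d H) → ∀ S : Finset ℕ, (∀ n ∈ S, 1 ≤ n) →
    ∑ n ∈ S, hsSq s (coeff H ϖ (e n) u) ≤ ENNReal.ofReal C * hs0Sq H s u := by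
  obtain ⟨W, hW, hW0, hWϖ⟩ := h.weight
  obtain ⟨C, hC⟩ := (isCompact_Icc (a := -H) (b := 0)).exists_bound_of_continuousOn
    hW.continuousOn
  have hmem : ∀ᵐ z ∂(depthMeasure H), z ∈ Ioo (-H) 0 := ae_restrict_mem measurableSet_Ioo
  refine ⟨C, fun s u hu S hS => sum_hsSq_coeff_le hu S ?_ ?_ e ?_ ?_
    fun m hm n hn => h.orthonormal m (hS m hm) n (hS n hn)⟩
  · filter_upwards [hmem] with z hz
    rw [hWϖ z hz]
    exact hW0 z
  · filter_upwards [hmem] with z hz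
    rw [hWϖ z hz]
    exact (le_abs_self _).trans (hC z (Ioo_subset_Icc_self hz))
  · intro n hn
    obtain ⟨κ, hκ, hκe⟩ := h.exists_continuous (hS n hn)
    refine (memLp_congr_ae ?_).2 (memLp_depth_of_continuous (H := H) hκ)
    filter_upwards [hmem] with z hz
    exact hκe z hz
  · intro m hm n hn
    obtain ⟨κ, hκ, hκe⟩ := h.exists_continuous (hS n hn)
    obtain ⟨E, hE, hEe⟩ := h.continuous m (hS m hm)
    refine (integrable_congr ?_).2 (integrable_mul_of_memLp_two
      (memLp_depth_of_continuous (H := H) hE) (memLp_depth_of_continuous (H := H) hκ))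
    filter_upwards [hmem] with z hz
    rw [mul_assoc, hκe z hz, hEe z hz]

lemma OrthoFamily.tsum_lt_top (h : OrthoFamily H ϖ e) {s : ℝ} {u : Horiz d × ℝ → ℝ}
    (hu : MemHs0 H s u) : ∑' n : ℕ, hsSq s (coeff H ϖ (e (n + 1)) u) < ⊤ := by
  obtain ⟨C, hC⟩ := h.exists_sum_le (d := d)
  refine lt_of_le_of_lt ?_ (ENNReal.mul_lt_top (ENNReal.ofReal_lt_top (r := C)) hu.2)
  rw [ENNReal.tsum_eq_iSup_nat]
  refine iSup_le fun M => ?_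
  have := hC s u hu.1 ((Finset.range M).map ⟨(· + 1), add_left_injective 1⟩) (by
    intro n hn
    obtain ⟨k, -, rfl⟩ := Finset.mem_map.1 hn
    exact Nat.le_add_left 1 k)
  rwa [Finset.sum_map] at this

lemma avg_sub_ae {κ : ℝ → ℝ} (hκ : Continuous κ) {u v : Horiz d × ℝ → ℝ}
    (hu : MemLp u 2 (stripMeasure d H)) (hv : MemLp v 2 (stripMeasure d H)) :
    avg H κ (u - v) =ᵐ[volume] avg H κ u - avg H κ v := by
  have hκ2 := memLp_depth_of_continuous (H := H) hκ
  filter_upwards [memLp_slice_right hu, memLp_slice_right hv] with x h1 h2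
  rw [Pi.sub_apply, avg, avg, avg, ← integral_sub (integrable_mul_of_memLp_two h1 hκ2)
    (integrable_mul_of_memLp_two h2 hκ2)]
  congr 1 with z
  simp only [Pi.sub_apply]
  ring

lemma avg_congr_ae {κ : ℝ → ℝ} {u v : Horiz d × ℝ → ℝ} (huv : u =ᵐ[stripMeasure d H] v) :
    avg H κ u =ᵐ[volume] avg H κ v := by
  filter_upwards [Measure.ae_ae_of_ae_prod huv] with x hx
  refine integral_congr_ae ?_
  filter_upwards [hx] with z hz
  rw [hz]

/-- The modal coefficients of a function in `C([0,T]; H^{s,0})` are in `C([0,T]; H^s)`. -/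
theorem OrthoFamily.contHs (h : OrthoFamily H ϖ e) {T s : ℝ} {u : ℝ → Horiz d × ℝ → ℝ}
    (hu : ContHs0 H T s u) {n : ℕ} (hn : 1 ≤ n) :
    ContHs T s fun t => coeff H ϖ (e n) (u t) := by
  obtain ⟨C, hC⟩ := h.exists_sum_le (d := d)
  obtain ⟨κ, hκ, hκe⟩ := h.exists_continuous hn
  have hle : ∀ v : Horiz d × ℝ → ℝ, MemLp v 2 (stripMeasure d H) →
      hsSq s (coeff H ϖ (e n) v) ≤ ENNReal.ofReal C * hs0Sq H s v := fun v hv => by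
    simpa using hC s v hv {n} (by simpa using hn)
  refine ⟨fun t ht => lt_of_le_of_lt (hle _ (hu.memLp ht))
    (ENNReal.mul_lt_top ENNReal.ofReal_lt_top (hu.1 t ht).2), fun t₀ ht₀ => ?_⟩
  have hlim : Tendsto (fun t => ENNReal.ofReal C * hs0Sq H s (u t - u t₀)) (𝓝[Icc 0 T] t₀)
      (𝓝 0) := by
    have := ENNReal.Tendsto.const_mul (a := ENNReal.ofReal C) (hu.2 t₀ ht₀)
      (Or.inr ENNReal.ofReal_ne_top)
    rwa [mul_zero] at this
  refine tendsto_of_tendsto_of_tendsto_of_le_of_le' tendsto_const_nhds hlim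
    (Eventually.of_forall fun _ => zero_le) ?_
  filter_upwards [self_mem_nhdsWithin] with t ht
  refine le_trans (le_of_eq ?_) (hle _ ((hu.memLp ht).sub (hu.memLp ht₀)))
  -- The coefficient is additive only almost everywhere, on the slices where both integrands are
  -- integrable; `hsSq` does not see the difference.
  simp only [coeff_eq_avg hκe]
  exact hsSq_congr s (avg_sub_ae hκ (hu.memLp ht) (hu.memLp ht₀)).symm

section Families

variable {g N A β : ℝ} {ρeq : ℝ → ℝ} {c : ℕ → ℝ} {f : ℕ → ℝ → ℝ}

lemma orthoFamily_gMode (hH : 0 < H) (hA : 0 < A)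
    (hρ : ∀ z ∈ Ioo (-H) 0, ρeq z = A * Real.exp (-β * z)) (hf : IsModalBasis H N ρeq c f) :
    OrthoFamily H ρeq (gMode H ρeq c f) := by
  refine ⟨⟨_, by fun_prop, fun z => by positivity, hρ⟩, fun n hn => ?_,
    fun m hm n hn => hf.integral_gMode_mul hH hA hρ hm hn⟩
  obtain ⟨F, hF, -, hdF⟩ := hf.exists_smoothMode hH hA hρ hn
  refine ⟨fun z => c n * deriv F z, continuous_const.mul (hF.contDiff.continuous_deriv (by simp)),
    fun z hz => ?_⟩
  rw [gMode, if_neg (Nat.one_le_iff_ne_zero.1 hn), hdF z hz]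

lemma orthoFamily_f (hH : 0 < H) (hA : 0 < A)
    (hρ : ∀ z ∈ Ioo (-H) 0, ρeq z = A * Real.exp (-β * z)) (hf : IsModalBasis H N ρeq c f) :
    OrthoFamily H (fun z => ρeq z * N ^ 2) f := by
  refine ⟨⟨fun z => A * Real.exp (-β * z) * N ^ 2, by fun_prop, fun z => by positivity,
    fun z hz => by rw [hρ z hz]⟩, fun n hn => ?_, hf.orthonormal⟩
  obtain ⟨F, hF, hfF, -⟩ := hf.exists_smoothMode hH hA hρ hn
  exact ⟨F, hF.contDiff.continuous, hfF⟩

/-- `ρₙ` is a coefficient of `gρ`, whereas `OrthoFamily` treats coefficients of `ρ` itself. Dividing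
the basis by `g` and multiplying the weight by `g²` keeps orthonormality and puts the factor `g` in
the coefficient. -/
lemma orthoFamily_density (hH : 0 < H) (hA : 0 < A) (hg : 0 < g) (hN : 0 < N)
    (hρ : ∀ z ∈ Ioo (-H) 0, ρeq z = A * Real.exp (-β * z)) (hf : IsModalBasis H N ρeq c f) :
    OrthoFamily H (fun z => g ^ 2 * (ρeq z * N ^ 2)⁻¹)
      (fun n z => g⁻¹ * (ρeq z * N ^ 2 * f n z)) := by
  have hpos : ∀ z, 0 < A * Real.exp (-β * z) * N ^ 2 := fun z => by positivity
  refine ⟨⟨fun z => g ^ 2 * (A * Real.exp (-β * z) * N ^ 2)⁻¹, ?_, fun z => by positivity,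
    fun z hz => by rw [hρ z hz]⟩, fun n hn => ?_, fun m hm n hn => ?_⟩
  · exact continuous_const.mul (Continuous.inv₀ (by fun_prop) fun z => (hpos z).ne')
  · obtain ⟨F, hF, hfF, -⟩ := hf.exists_smoothMode hH hA hρ hn
    have hFc := hF.contDiff.continuous
    exact ⟨fun z => g⁻¹ * (A * Real.exp (-β * z) * N ^ 2 * F z), by fun_prop,
      fun z hz => by simp only [hρ z hz, hfF z hz]⟩
  · rw [← hf.orthonormal m hm n hn]
    refine setIntegral_congr_fun measurableSet_Ioo fun z hz => ?_
    have h1 : ρeq z * N ^ 2 ≠ 0 := by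
      rw [hρ z hz]
      exact (hpos z).ne'
    generalize ρeq z * N ^ 2 = b at h1
    field_simp

lemma coeffR_eq_coeff (hg : 0 < g) (n : ℕ) (ρ : Horiz d × ℝ → ℝ) :
    coeffR H g N ρeq f n ρ = coeff H (fun z => g ^ 2 * (ρeq z * N ^ 2)⁻¹)
      (fun z => g⁻¹ * (ρeq z * N ^ 2 * f n z)) ρ := by
  ext x
  simp only [coeffR, coeff]
  congr 1 with z
  field_simp

end Families

end ModalCoefficients

/-! ### Equations for vertical averages, curl, and the barotropic mode -/

section AveragedEquations

variable {d : ℕ} {H g T A β : ℝ} {ρeq : ℝ → ℝ} {V : ℝ → Horiz d × ℝ → Horiz d}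
  {w ρ P : ℝ → Horiz d × ℝ → ℝ}

lemma pd_slice {φ : ℝ × Horiz d → ℝ} {Ω : Set (ℝ × Horiz d)} (h : IsTest Ω φ) (t : ℝ)
    (v : Horiz d) : pd v (fun x => φ (t, x)) = fun x => pd (0, v) φ (t, x) :=
  funext fun x => pd_comp_prodMk h.differentiable t v x

lemma TimeL2.integral_pair_eq {Q : ℝ → Horiz d × ℝ → ℝ} (hQ : TimeL2 H T Q)
    {φ : ℝ × Horiz d → ℝ} (hφ : IsTest (Ioo 0 T ×ˢ univ) φ) {κ : ℝ → ℝ} (hκ : Continuous κ) :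
    (fun t => pair H (fun x => φ (t, x)) κ (Q t)) =ᵐ[volume.restrict (Ioo 0 T)]
      fun t => ∫ x, avg H κ (Q t) x * φ (t, x) := by
  filter_upwards [hQ.memLp] with t ht
  exact pair_eq_integral_avg ht (memLp_two_of_isTest (hφ.slice t)) hκ

lemma TimeL2.integrable_avg {Q : ℝ → Horiz d × ℝ → ℝ} (hQ : TimeL2 H T Q)
    {φ : ℝ × Horiz d → ℝ} (hφ : IsTest (Ioo 0 T ×ˢ univ) φ) {κ : ℝ → ℝ} (hκ : Continuous κ) :
    Integrable (fun t => ∫ x, avg H κ (Q t) x * φ (t, x)) (volume.restrict (Ioo 0 T)) :=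
  (hQ.integrable_pair hφ.continuous hφ.2.1 hκ).congr (hQ.integral_pair_eq hφ hκ)

lemma SolvesLinearized.avg_horizontal (hsol : SolvesLinearized H g T ρeq V w ρ P)
    (hρ : ∀ z ∈ Ioo (-H) 0, ρeq z = A * Real.exp (-β * z)) {j : Fin d}
    (hV : TimeL2 H T fun t q => V t q j) (hP : TimeL2 H T P) {φ : ℝ × Horiz d → ℝ}
    (hφ : IsTest (Ioo 0 T ×ˢ univ) φ) {κ : ℝ → ℝ} (hκ : ContDiff ℝ ∞ κ) :
    (∫ t in Ioo 0 T, ∫ x, avg H (fun z => A * Real.exp (-β * z) * κ z) (fun q => V t q j) x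
        * pd (1, 0) φ (t, x))
      + ∫ t in Ioo 0 T, ∫ x, avg H κ (P t) x * pd (0, unitVec j) φ (t, x) = 0 := by
  have hκc := hκ.continuous
  rw [← integral_congr_ae (hV.integral_pair_eq (hφ.pd (1, 0)) (by fun_prop)),
    ← integral_congr_ae (hP.integral_pair_eq (hφ.pd (0, unitVec j)) hκc)]
  exact hsol.pair_horizontal hρ hV hP hφ hκ

lemma SolvesLinearized.avg_vertical (hsol : SolvesLinearized H g T ρeq V w ρ P)
    (hρeq : ∀ z ∈ Ioo (-H) 0, ρeq z = A * Real.exp (-β * z))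
    (hw : TimeL2 H T w) (hP : TimeL2 H T P) (hρ : TimeL2 H T ρ) {φ : ℝ × Horiz d → ℝ}
    (hφ : IsTest (Ioo 0 T ×ˢ univ) φ) {κ : ℝ → ℝ} (hκ : ContDiff ℝ ∞ κ)
    (hb : κ (-H) = 0) (ht : κ 0 = 0) :
    (∫ t in Ioo 0 T, ∫ x, avg H (fun z => A * Real.exp (-β * z) * κ z) (w t) x
        * pd (1, 0) φ (t, x))
      + (∫ t in Ioo 0 T, ∫ x, avg H (deriv κ) (P t) x * φ (t, x))
      - ∫ t in Ioo 0 T, ∫ x, avg H (fun z => g * κ z) (ρ t) x * φ (t, x) = 0 := by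
  have hκc := hκ.continuous
  rw [← integral_congr_ae (hw.integral_pair_eq (hφ.pd (1, 0)) (by fun_prop)),
    ← integral_congr_ae (hP.integral_pair_eq hφ (hκ.continuous_deriv (by simp))),
    ← integral_congr_ae (hρ.integral_pair_eq hφ (by fun_prop))]
  exact hsol.pair_vertical hρeq hw hP hρ hφ hκ hb ht

lemma SolvesLinearized.avg_mass (hsol : SolvesLinearized H g T ρeq V w ρ P)
    (hρeq : ∀ z ∈ Ioo (-H) 0, ρeq z = A * Real.exp (-β * z))
    (hw : TimeL2 H T w) (hρ : TimeL2 H T ρ) {φ : ℝ × Horiz d → ℝ}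
    (hφ : IsTest (Ioo 0 T ×ˢ univ) φ) {κ : ℝ → ℝ} (hκ : ContDiff ℝ ∞ κ) :
    (∫ t in Ioo 0 T, ∫ x, avg H κ (ρ t) x * pd (1, 0) φ (t, x))
      + ∫ t in Ioo 0 T, ∫ x, avg H (fun z => β * (A * Real.exp (-β * z)) * κ z) (w t) x
          * φ (t, x) = 0 := by
  have hκc := hκ.continuous
  rw [← integral_congr_ae (hρ.integral_pair_eq (hφ.pd (1, 0)) hκc),
    ← integral_congr_ae (hw.integral_pair_eq hφ (by fun_prop))]
  exact hsol.pair_mass hρeq hw hρ hφ hκ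

lemma SolvesLinearized.avg_incompressible (hH : 0 < H)
    (hsol : SolvesLinearized H g T ρeq V w ρ P) {t : ℝ} (ht : t ∈ Icc 0 T)
    (hV : ∀ j, MemLp (fun q => V t q j) 2 (stripMeasure d H))
    (hw : MemLp (w t) 2 (stripMeasure d H)) {φ : Horiz d → ℝ} (hφ : IsTest univ φ)
    {κ : ℝ → ℝ} (hκ : ContDiff ℝ ∞ κ) :
    (∑ j, ∫ x, avg H κ (fun q => V t q j) x * pd (unitVec j) φ x)
      + ∫ x, avg H (deriv κ) (w t) x * φ x = 0 := by
  rw [← pair_eq_integral_avg hw (memLp_two_of_isTest hφ) (hκ.continuous_deriv (by simp)),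
    ← hsol.pair_incompressible hH ht hV hw hφ hκ]
  congr 1
  exact Finset.sum_congr rfl fun j _ =>
    (pair_eq_integral_avg (hV j) (memLp_two_of_isTest (hφ.pd _)) hκ.continuous).symm

/-- The averaged horizontal velocities remain curl free. -/
theorem SolvesLinearized.avg_curl {s : ℝ} (hs : 0 ≤ s) (hT : 0 < T)
    (hsol : SolvesLinearized H g T ρeq V w ρ P)
    (hρ : ∀ z ∈ Ioo (-H) 0, ρeq z = A * Real.exp (-β * z))
    (hV : ∀ j, ContHs0 H T s fun t q => V t q j) (hP : TimeL2 H T P)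
    (hcurl : ZeroVerticalVorticity H (V 0)) {κ : ℝ → ℝ} (hκ : ContDiff ℝ ∞ κ)
    {t : ℝ} (ht : t ∈ Icc 0 T) (i j : Fin d) {χ : Horiz d → ℝ} (hχ : IsTest univ χ) :
    ∫ x, avg H (fun z => A * Real.exp (-β * z) * κ z) (fun q => V t q j) x * pd (unitVec i) χ x
      = ∫ x, avg H (fun z => A * Real.exp (-β * z) * κ z) (fun q => V t q i) x
          * pd (unitVec j) χ x := by
  have hκc := hκ.continuous
  set κ' : ℝ → ℝ := fun z => A * Real.exp (-β * z) * κ z with hκ'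
  have hκ'c : Continuous κ' := by fun_prop
  have hκ'd : ContDiff ℝ ∞ κ' := by fun_prop
  have hχ2 : ∀ k : Fin d, MemLp (pd (unitVec k) χ) 2 volume := fun k =>
    memLp_two_of_isTest (hχ.pd _)
  have hcont : ∀ k l : Fin d, ContinuousOn
      (fun t => ∫ x, avg H κ' (fun q => V t q k) x * pd (unitVec l) χ x) (Icc 0 T) := by
    intro k l
    -- A bump in time, equal to `1` on `[0, T]`: the continuity lemma asks for compact support in
    -- `(t, x)`, and the test function here does not depend on `t`.
    let b : ContDiffBump (T / 2 : ℝ) := ⟨T, 2 * T, hT, by linarith⟩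
    have hb : IsTest univ (b : ℝ → ℝ) := ⟨b.contDiff, b.hasCompactSupport, subset_univ _⟩
    have ha := hb.prod (hχ.pd (unitVec l))
    refine ((hV k).continuousOn_pair hs ha.continuous ha.2.1 hκ'c).congr fun t ht => ?_
    simp only
    rw [← pair_eq_integral_avg ((hV k).memLp ht) (hχ2 l) hκ'c]
    have hone : b t = 1 := b.one_of_mem_closedBall (by
      rw [Metric.mem_closedBall, Real.dist_eq, abs_le]
      change -T ≤ _ ∧ _ ≤ T
      constructor <;> linarith [ht.1, ht.2])
    simp only [hone, one_mul]
  set m : ℝ → ℝ := fun t => (∫ x, avg H κ' (fun q => V t q j) x * pd (unitVec i) χ x)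
    - ∫ x, avg H κ' (fun q => V t q i) x * pd (unitVec j) χ x with hm
  have hmc : ContinuousOn m (Icc 0 T) := (hcont j i).sub (hcont i j)
  have hm0 : m 0 = 0 := by
    have h0 : (0 : ℝ) ∈ Icc 0 T := ⟨le_rfl, hT.le⟩
    have := hcurl.pair_eq (fun k => (hV k).memLp h0) i j hχ hκ'd
    rw [pair_eq_integral_avg ((hV j).memLp h0) (hχ2 i) hκ'c,
      pair_eq_integral_avg ((hV i).memLp h0) (hχ2 j) hκ'c] at this
    exact sub_eq_zero.2 this
  have hder : ∀ θ, IsTest (Ioo 0 T) θ → ∫ t in Ioo 0 T, m t * deriv θ t = 0 := by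
    intro θ hθ
    -- The `k`-th momentum equation tested with `θ ∂ₗχ`. The instances `(j, i)` and `(i, j)` have
    -- the same pressure term because second derivatives commute, so their difference leaves only `m
    -- θ'`.
    have hone : ∀ k l : Fin d,
        (∫ t in Ioo 0 T, (∫ x, avg H κ' (fun q => V t q k) x * pd (unitVec l) χ x) * deriv θ t)
        + ∫ t in Ioo 0 T, ∫ x, avg H κ (P t) x
          * (θ t * pd (unitVec k) (pd (unitVec l) χ) x) = 0 := by
      intro k l
      have hφ := hθ.prod (hχ.pd (unitVec l))
      refine Eq.trans ?_ (hsol.avg_horizontal hρ ((hV k).timeL2 hs) hP hφ hκ)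
      congr 1
      · congr 1 with t
        rw [← integral_mul_const]
        congr 1 with x
        rw [pd_prod hθ.differentiable (hχ.pd _).differentiable, pd_real]
        have hz : pd (0 : Horiz d) (pd (unitVec l) χ) x = 0 := by
          rw [pd]
          exact map_zero _
        simp only [hz]
        ring
      · congr 1 with t
        congr 1 with x
        rw [pd_prod hθ.differentiable (hχ.pd _).differentiable, pd_real]
        ring
    have hint : ∀ k l : Fin d, IntegrableOn (fun t =>
        (∫ x, avg H κ' (fun q => V t q k) x * pd (unitVec l) χ x) * deriv θ t) (Ioo 0 T) := by
      intro k l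
      have hdθ : Continuous (deriv θ) := hθ.1.continuous_deriv (by simp)
      exact (((hcont k l).mul hdθ.continuousOn).integrableOn_Icc (μ := volume)).mono_set
        Ioo_subset_Icc_self
    have h1 := hone j i
    have h2 := hone i j
    rw [pd_comm hχ.1 (unitVec j) (unitVec i)] at h1
    simp only [hm, sub_mul]
    rw [integral_sub (hint j i) (hint i j)]
    linarith
  have hfin := eq_of_forall_integral_mul_deriv_eq_zero hT hmc hder ht
  rw [hm0] at hfin
  exact sub_eq_zero.1 hfin

/-- The exceptional set of times depends on `f`. As `L²` is separable, countably many classes are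
dense among those of `D`; outside the union of their null sets the condition, closed in `L²`, holds
on all of `D`. -/
lemma ae_forall_integral_mul_eq_zero {p : ℝ → Horiz d → ℝ} {ν : Measure ℝ}
    (hp : ∀ᵐ t ∂ν, MemLp (p t) 2 volume) {D : Set (Horiz d → ℝ)} (hD : ∀ f ∈ D, MemLp f 2 volume)
    (h : ∀ f ∈ D, ∀ᵐ t ∂ν, ∫ x, p t x * f x = 0) :
    ∀ᵐ t ∂ν, ∀ f ∈ D, ∫ x, p t x * f x = 0 := by
  set E : Set (Lp ℝ 2 (volume : Measure (Horiz d))) :=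
    {F | ∃ f ∈ D, f =ᵐ[volume] F} with hE
  have : Fact ((2 : ℝ≥0∞) ≠ ⊤) := ⟨by norm_num⟩
  obtain ⟨S, hSE, hSc, hSd⟩ := (TopologicalSpace.IsSeparable.of_separableSpace
    E).exists_countable_dense_subset
  have hS : ∀ᵐ t ∂ν, ∀ F ∈ S, ∫ x, p t x * F x = 0 := by
    refine (ae_ball_iff hSc).2 fun F hF => ?_
    obtain ⟨f, hfD, hfF⟩ := hSE hF
    filter_upwards [h f hfD] with t ht
    rw [← ht]
    refine integral_congr_ae ?_
    filter_upwards [hfF] with x hx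
    rw [hx]
  filter_upwards [hS, hp] with t ht hpt f hf
  have hinner : ∀ F : Lp ℝ 2 (volume : Measure (Horiz d)),
      inner ℝ (hpt.toLp _) F = ∫ x, p t x * F x := by
    intro F
    rw [L2.inner_def]
    refine integral_congr_ae ?_
    filter_upwards [hpt.coeFn_toLp] with x hx
    rw [hx]
    simp [mul_comm]
  have hcl : IsClosed {F : Lp ℝ 2 (volume : Measure (Horiz d)) | inner ℝ (hpt.toLp _) F = 0} :=
    isClosed_eq (by fun_prop) continuous_const
  have hsub : S ⊆ {F | inner ℝ (hpt.toLp _) F = 0} := fun F hF => by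
    rw [mem_ofPred_eq, hinner, ht F hF]
  have hmem : (hD f hf).toLp f ∈ closure S :=
    hSd ⟨f, hf, (hD f hf).coeFn_toLp.symm⟩
  have := closure_minimal hsub hcl hmem
  rw [mem_ofPred_eq, hinner] at this
  rw [← this]
  refine integral_congr_ae ?_
  filter_upwards [(hD f hf).coeFn_toLp] with x hx
  rw [hx]

/-- An average of the pressure with vanishing horizontal gradient vanishes. -/
theorem TimeL2.avg_ae_eq_zero (hd : 0 < d) (hT : 0 < T) (hP : TimeL2 H T P) {κ : ℝ → ℝ}
    (hκ : Continuous κ)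
    (h : ∀ j : Fin d, ∀ φ : ℝ × Horiz d → ℝ, IsTest (Ioo 0 T ×ˢ univ) φ →
      ∫ t in Ioo 0 T, ∫ x, avg H κ (P t) x * pd (0, unitVec j) φ (t, x) = 0) :
    ∀ᵐ t ∂(volume.restrict (Ioo 0 T)), avg H κ (P t) =ᵐ[volume] 0 := by
  have hp : ∀ᵐ t ∂(volume.restrict (Ioo 0 T)), MemLp (avg H κ (P t)) 2 volume := by
    filter_upwards [hP.memLp] with t ht
    exact memLp_avg ht hκ
  have hgrad : ∀ (j : Fin d) (ψ : Horiz d → ℝ), IsTest univ ψ →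
      ∀ᵐ t ∂(volume.restrict (Ioo 0 T)), ∫ x, avg H κ (P t) x * pd (unitVec j) ψ x = 0 := by
    intro j ψ hψ
    let b : ContDiffBump (T / 2 : ℝ) := ⟨T, 2 * T, hT, by linarith⟩
    have hb : IsTest univ (b : ℝ → ℝ) := ⟨b.contDiff, b.hasCompactSupport, subset_univ _⟩
    have ha := hb.prod (hψ.pd (unitVec j))
    have hint : IntegrableOn (fun t => ∫ x, avg H κ (P t) x * pd (unitVec j) ψ x) (Ioo 0 T) := by
      refine (hP.integrable_pair ha.continuous ha.2.1 hκ).congr ?_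
      filter_upwards [hP.memLp, ae_restrict_mem measurableSet_Ioo] with t ht hmem
      rw [← pair_eq_integral_avg ht (memLp_two_of_isTest (hψ.pd _)) hκ]
      have hone : b t = 1 := b.one_of_mem_closedBall (by
        rw [Metric.mem_closedBall, Real.dist_eq, abs_le]
        change -T ≤ _ ∧ _ ≤ T
        constructor <;> linarith [hmem.1, hmem.2])
      simp only [hone, one_mul]
    refine (ae_restrict_iff' measurableSet_Ioo).2 ?_
    refine isOpen_Ioo.ae_eq_zero_of_integral_contDiff_smul_eq_zero (μ := volume)
      hint.locallyIntegrableOn fun θ h1 h2 h3 => ?_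
    have hθ : IsTest (Ioo 0 T) θ := ⟨h1, h2, h3⟩
    have h4 := h j _ (hθ.prod hψ)
    have h5 := integral_mul_Ioo_eq (m := fun t => ∫ x, avg H κ (P t) x * pd (unitVec j) ψ x) hθ
    simp only [smul_eq_mul]
    simp only [mul_comm (θ _)]
    rw [← h5]
    refine Eq.trans ?_ h4
    congr 1 with t
    rw [← integral_mul_const]
    congr 1 with x
    rw [pd_prod hθ.differentiable hψ.differentiable, pd_real]
    ring
  have hsum : ∀ ψ : Horiz d → ℝ, IsTest univ ψ → ∀ k : Fin d,
      MemLp (pd (unitVec k) (pd (unitVec k) ψ)) 2 volume := fun ψ hψ k =>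
    memLp_two_of_isTest ((hψ.pd _).pd _)
  have hall := ae_forall_integral_mul_eq_zero hp
    (D := {f | ∃ ψ : Horiz d → ℝ, IsTest univ ψ ∧
      f = fun x => ∑ k, pd (unitVec k) (pd (unitVec k) ψ) x})
    (by
      rintro f ⟨ψ, hψ, rfl⟩
      exact memLp_finsetSum _ fun k _ => hsum ψ hψ k)
    (by
      rintro f ⟨ψ, hψ, rfl⟩
      have h1 : ∀ᵐ t ∂(volume.restrict (Ioo 0 T)), ∀ k : Fin d,
          ∫ x, avg H κ (P t) x * pd (unitVec k) (pd (unitVec k) ψ) x = 0 :=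
        ae_all_iff.2 fun k => hgrad k _ (hψ.pd _)
      filter_upwards [h1, hp] with t ht hpt
      simp only [Finset.mul_sum]
      rw [integral_finsetSum _ fun k _ => integrable_mul_of_memLp_two hpt (hsum ψ hψ k)]
      exact Finset.sum_eq_zero fun k _ => ht k)
  filter_upwards [hall, hp] with t ht hpt
  exact ae_eq_zero_of_weakly_harmonic hd hpt fun ψ hψ => ht _ ⟨ψ, hψ, rfl⟩

/-- A curl free and divergence free field in `L²(ℝ^d)` vanishes. -/
theorem ae_eq_zero_of_curl_div (hd : 0 < d) {v : Fin d → Horiz d → ℝ}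
    (hv : ∀ j, MemLp (v j) 2 volume)
    (hcurl : ∀ i j : Fin d, ∀ χ : Horiz d → ℝ, IsTest univ χ →
      ∫ x, v j x * pd (unitVec i) χ x = ∫ x, v i x * pd (unitVec j) χ x)
    (hdiv : ∀ χ : Horiz d → ℝ, IsTest univ χ → ∑ j, ∫ x, v j x * pd (unitVec j) χ x = 0)
    (j : Fin d) : v j =ᵐ[volume] 0 := by
  refine ae_eq_zero_of_weakly_harmonic hd (hv j) fun φ hφ => ?_
  simp only [Finset.mul_sum]
  rw [integral_finsetSum _ fun k _ => integrable_mul_of_memLp_two (hv j)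
    (memLp_two_of_isTest ((hφ.pd _).pd _)), ← hdiv _ (hφ.pd (unitVec j))]
  refine Finset.sum_congr rfl fun k _ => ?_
  -- `∫ vⱼ ∂ₖ∂ₖφ = ∫ vₖ ∂ⱼ∂ₖφ`; summed over `k`, the right side is the divergence tested with `∂ⱼφ`.
  rw [hcurl k j _ (hφ.pd (unitVec k)), pd_comm hφ.1]

end AveragedEquations

/-! ### From the averaged system to the Boussinesq system -/

section ModalSystem

variable {d : ℕ}

lemma avg_const_mul (H a : ℝ) (κ : ℝ → ℝ) (u : Horiz d × ℝ → ℝ) :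
    avg H (fun z => a * κ z) u = fun x => a * avg H κ u x := by
  ext x
  simp only [avg]
  rw [← integral_const_mul]
  congr 1 with z
  ring

/-- The equations satisfied by the vertical averages of a solution against one mode. -/
structure ModalSystem (T g β N c : ℝ) (v : ℝ → Fin d → Horiz d → ℝ)
    (y r p : ℝ → Horiz d → ℝ) : Prop where
  memLp_v : ∀ t ∈ Icc 0 T, ∀ j, MemLp (v t j) 2 volume
  memLp_y : ∀ t ∈ Icc 0 T, MemLp (y t) 2 volume
  memLp_r : ∀ t ∈ Icc 0 T, MemLp (r t) 2 volume
  integrable_v : ∀ j, ∀ φ : ℝ × Horiz d → ℝ, IsTest (Ioo 0 T ×ˢ univ) φ →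
    IntegrableOn (fun t => ∫ x, v t j x * φ (t, x)) (Ioo 0 T)
  integrable_y : ∀ φ : ℝ × Horiz d → ℝ, IsTest (Ioo 0 T ×ˢ univ) φ →
    IntegrableOn (fun t => ∫ x, y t x * φ (t, x)) (Ioo 0 T)
  integrable_r : ∀ φ : ℝ × Horiz d → ℝ, IsTest (Ioo 0 T ×ˢ univ) φ →
    IntegrableOn (fun t => ∫ x, r t x * φ (t, x)) (Ioo 0 T)
  horizontal : ∀ j, ∀ φ : ℝ × Horiz d → ℝ, IsTest (Ioo 0 T ×ˢ univ) φ →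
    (∫ t in Ioo 0 T, ∫ x, v t j x * pd (1, 0) φ (t, x))
      + ∫ t in Ioo 0 T, ∫ x, p t x * pd (0, unitVec j) φ (t, x) = 0
  vertical : ∀ φ : ℝ × Horiz d → ℝ, IsTest (Ioo 0 T ×ˢ univ) φ →
    (∫ t in Ioo 0 T, ∫ x, y t x * pd (1, 0) φ (t, x))
      + (∫ t in Ioo 0 T, ∫ x, p t x * φ (t, x))
      - g * ∫ t in Ioo 0 T, ∫ x, r t x * φ (t, x) = 0
  mass : ∀ φ : ℝ × Horiz d → ℝ, IsTest (Ioo 0 T ×ˢ univ) φ →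
    (∫ t in Ioo 0 T, ∫ x, r t x * pd (1, 0) φ (t, x))
      + β * ∫ t in Ioo 0 T, ∫ x, y t x * φ (t, x) = 0
  divergence : ∀ t ∈ Icc 0 T, ∀ φ : Horiz d → ℝ, IsTest univ φ →
    ∫ x, y t x * φ x = c ^ 2 / N ^ 2 * ∑ j, ∫ x, v t j x * pd (unitVec j) φ x
  curl : ∀ t ∈ Icc 0 T, ∀ i j, ∀ χ : Horiz d → ℝ, IsTest univ χ →
    ∫ x, v t j x * pd (unitVec i) χ x = ∫ x, v t i x * pd (unitVec j) χ x

variable {T g β N c : ℝ} {v : ℝ → Fin d → Horiz d → ℝ} {y r p : ℝ → Horiz d → ℝ}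

lemma ModalSystem.eqMulDiv (h : ModalSystem T g β N c v y r p) (hN : N ≠ 0) {t : ℝ}
    (ht : t ∈ Icc 0 T) :
    EqMulDiv (-c) (fun j x => c * v t j x) (fun x => N ^ 2 * y t x) := by
  intro φ hφ
  simp only [mul_assoc, ← Finset.mul_sum]
  rw [integral_const_mul, integral_const_mul, h.divergence t ht φ hφ,
    integral_finsetSum _ fun j _ => integrable_mul_of_memLp_two (h.memLp_v t ht j)
      (memLp_two_of_isTest (hφ.pd _))]
  field_simp

/-- This is `c` times the averaged vertical momentum equation. -/
lemma ModalSystem.pressureLaw (h : ModalSystem T g β N c v y r p) (hN : N ≠ 0) :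
    PressureLaw T N c (fun t x => g * r t x) (fun t x => N ^ 2 * y t x)
      (fun t x => c * p t x) := by
  intro φ hφ
  have h1 : ∀ t ∈ Ioo 0 T, ∫ x, (c * (g * r t x) * φ (t, x)
      - c / N ^ 2 * (N ^ 2 * y t x) * pd (1, 0) φ (t, x))
      = c * g * (∫ x, r t x * φ (t, x)) - c * ∫ x, y t x * pd (1, 0) φ (t, x) := by
    intro t ht
    have ht' := Ioo_subset_Icc_self ht
    rw [← integral_const_mul, ← integral_const_mul, ← integral_sub
      ((integrable_mul_of_memLp_two (h.memLp_r t ht')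
        (memLp_two_of_isTest (hφ.slice t))).const_mul _)
      ((integrable_mul_of_memLp_two (h.memLp_y t ht')
        (memLp_two_of_isTest ((hφ.pd (1, 0)).slice t))).const_mul _)]
    congr 1 with x
    field_simp
  rw [setIntegral_congr_fun measurableSet_Ioo h1,
    integral_sub ((h.integrable_r φ hφ).const_mul _) ((h.integrable_y _ (hφ.pd _)).const_mul _),
    integral_const_mul, integral_const_mul]
  simp only [mul_assoc, integral_const_mul]
  linear_combination c * h.vertical φ hφ

/-- Subtracting the vertical equation tested with `∂ⱼφ` from the horizontal one tested with `φ`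
eliminates `p`. The term in `y` becomes a Laplacian of `vⱼ` by the divergence relation and the
absence of curl. In the mass equation `β g = N²` cancels the `N²` of the divergence relation. -/
lemma ModalSystem.solvesBoussinesq (h : ModalSystem T g β N c v y r p) (hN : N ≠ 0)
    (hβ : β * g = N ^ 2) :
    SolvesBoussinesq T N c (fun t j x => c * v t j x) (fun t x => g * r t x) where
  momentum j φ hφ := by
    have h1 : ∀ t ∈ Ioo 0 T, ∫ x, (c * v t j x * (pd (1, 0) φ (t, x)
        - c ^ 2 / N ^ 2 * ∑ k, pd (0, unitVec k) (pd (0, unitVec k) (pd (1, 0) φ)) (t, x))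
        + c * (g * r t x) * pd (0, unitVec j) φ (t, x))
        = c * (∫ x, v t j x * pd (1, 0) φ (t, x))
          - c * (∫ x, y t x * pd (1, 0) (pd (0, unitVec j) φ) (t, x))
          + c * g * ∫ x, r t x * pd (0, unitVec j) φ (t, x) := by
      intro t ht
      have ht' := Ioo_subset_Icc_self ht
      have hI : ∀ χ : ℝ × Horiz d → ℝ, IsTest (Ioo 0 T ×ˢ univ) χ →
          Integrable fun x => v t j x * χ (t, x) := fun χ hχ =>
        integrable_mul_of_memLp_two (h.memLp_v t ht' j) (memLp_two_of_isTest (hχ.slice t))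
      -- Weak form of `y = -(c²/N²) ∇·v` together with `∂ⱼ∇·v = Δvⱼ`.
      have hlap : ∫ x, y t x * pd (1, 0) (pd (0, unitVec j) φ) (t, x)
          = c ^ 2 / N ^ 2 * ∑ k, ∫ x, v t j x
            * pd (0, unitVec k) (pd (0, unitVec k) (pd (1, 0) φ)) (t, x) := by
        rw [pd_comm hφ.1, h.divergence t ht' _ (((hφ.pd (1, 0)).pd (0, unitVec j)).slice t)]
        congr 1
        refine Finset.sum_congr rfl fun k _ => ?_
        have hk := h.curl t ht' k j _ (((hφ.pd (1, 0)).pd (0, unitVec k)).slice t)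
        rw [pd_slice ((hφ.pd (1, 0)).pd (0, unitVec k)),
          pd_slice ((hφ.pd (1, 0)).pd (0, unitVec k))] at hk
        rw [hk, pd_slice ((hφ.pd (1, 0)).pd (0, unitVec j)), pd_comm (hφ.pd (1, 0)).1]
      rw [hlap, ← integral_finsetSum _ fun k _ =>
          hI _ (((hφ.pd (1, 0)).pd (0, unitVec k)).pd (0, unitVec k)),
        ← integral_const_mul, ← integral_const_mul, ← integral_const_mul, ← integral_const_mul,
        ← integral_sub, ← integral_add]
      · congr 1 with x
        rw [← Finset.mul_sum]
        ring
      · refine ((hI _ (hφ.pd (1, 0))).const_mul c).sub (((integrable_finsetSum _ fun k _ =>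
          hI _ (((hφ.pd (1, 0)).pd (0, unitVec k)).pd (0, unitVec k))).const_mul _).const_mul _)
      · exact (integrable_mul_of_memLp_two (h.memLp_r t ht')
          (memLp_two_of_isTest ((hφ.pd (0, unitVec j)).slice t))).const_mul _
      · exact (hI _ (hφ.pd (1, 0))).const_mul c
      · exact ((integrable_finsetSum _ fun k _ =>
          hI _ (((hφ.pd (1, 0)).pd (0, unitVec k)).pd (0, unitVec k))).const_mul _).const_mul _
    have hv := (h.integrable_v j _ (hφ.pd (1, 0))).const_mul c
    have hy := (h.integrable_y _ ((hφ.pd (0, unitVec j)).pd (1, 0))).const_mul c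
    have hr := (h.integrable_r _ (hφ.pd (0, unitVec j))).const_mul (c * g)
    rw [setIntegral_congr_fun measurableSet_Ioo h1, integral_add (f := fun t => c * (∫ x, v t j x * pd (1, 0) φ (t, x))
        - c * ∫ x, y t x * pd (1, 0) (pd (0, unitVec j) φ) (t, x)) (hv.sub hy) hr,
      integral_sub hv hy, integral_const_mul, integral_const_mul, integral_const_mul]
    linear_combination c * h.horizontal j φ hφ - c * h.vertical _ (hφ.pd (0, unitVec j))
  mass φ hφ := by
    have h1 : ∀ t ∈ Ioo 0 T, ∫ x, (g * r t x * pd (1, 0) φ (t, x)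
        + c * ∑ j, c * v t j x * pd (0, unitVec j) φ (t, x))
        = g * (∫ x, r t x * pd (1, 0) φ (t, x)) + N ^ 2 * ∫ x, y t x * φ (t, x) := by
      intro t ht
      have ht' := Ioo_subset_Icc_self ht
      have hI : ∀ j, Integrable fun x => v t j x * pd (0, unitVec j) φ (t, x) := fun j =>
        integrable_mul_of_memLp_two (h.memLp_v t ht' j)
          (memLp_two_of_isTest ((hφ.pd (0, unitVec j)).slice t))
      have hdiv := h.divergence t ht' _ (hφ.slice t)
      simp only [pd_slice hφ] at hdiv
      rw [hdiv, ← integral_finsetSum _ fun j _ => hI j, ← integral_const_mul, ← integral_const_mul,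
        ← integral_const_mul, ← integral_add]
      · congr 1 with x
        simp only [mul_assoc, ← Finset.mul_sum]
        field_simp
      · exact (integrable_mul_of_memLp_two (h.memLp_r t ht')
          (memLp_two_of_isTest ((hφ.pd (1, 0)).slice t))).const_mul _
      · exact ((integrable_finsetSum _ fun j _ => hI j).const_mul _).const_mul _
    rw [setIntegral_congr_fun measurableSet_Ioo h1,
      integral_add ((h.integrable_r _ (hφ.pd _)).const_mul _) ((h.integrable_y φ hφ).const_mul _),
      integral_const_mul, integral_const_mul, ← hβ]
    linear_combination g * h.mass φ hφ

end ModalSystem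

/-! ### Averages of a solution against one mode -/

section ModalAverages

variable {d : ℕ} {H g T A β N c s : ℝ} {ρeq : ℝ → ℝ} {V : ℝ → Horiz d × ℝ → Horiz d}
  {w ρ P : ℝ → Horiz d × ℝ → ℝ} {F : ℝ → ℝ}

/-- The averages of a solution against a mode solve the modal system. -/
theorem SolvesLinearized.modalSystem (hH : 0 < H) (hT : 0 < T) (hs : 0 ≤ s) (hN : N ≠ 0)
    (hc : c ≠ 0) (hsol : SolvesLinearized H g T ρeq V w ρ P)
    (hρeq : ∀ z ∈ Ioo (-H) 0, ρeq z = A * Real.exp (-β * z))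
    (hV : ∀ j, ContHs0 H T s fun t q => V t q j) (hw : ContHs0 H T s w) (hρ : ContHs0 H T s ρ)
    (hP : TimeL2 H T P) (hcurl : ZeroVerticalVorticity H (V 0))
    (hF : IsSmoothMode H N A β c F) :
    ModalSystem T g β N c
      (fun t j => avg H (fun z => A * Real.exp (-β * z) * deriv F z) fun q => V t q j)
      (fun t => avg H (fun z => A * Real.exp (-β * z) * F z) (w t))
      (fun t => avg H F (ρ t)) (fun t => avg H (deriv F) (P t)) := by
  have hFc := hF.contDiff.continuous
  have hdF : ContDiff ℝ ∞ (deriv F) := (contDiff_infty_iff_deriv.1 hF.contDiff).2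
  have hdFc := hdF.continuous
  have hE : ContDiff ℝ ∞ fun z => A * Real.exp (-β * z) * deriv F z := by fun_prop
  have hVt := fun j => (hV j).timeL2 hs
  have hwt := hw.timeL2 hs
  have hρt := hρ.timeL2 hs
  refine ⟨fun t ht j => memLp_avg ((hV j).memLp ht) (by fun_prop),
    fun t ht => memLp_avg (hw.memLp ht) (by fun_prop),
    fun t ht => memLp_avg (hρ.memLp ht) hFc,
    fun j φ hφ => (hVt j).integrable_avg hφ (by fun_prop),
    fun φ hφ => hwt.integrable_avg hφ (by fun_prop),
    fun φ hφ => hρt.integrable_avg hφ hFc,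
    fun j φ hφ => hsol.avg_horizontal hρeq (hVt j) hP hφ hdF,
    fun φ hφ => ?_, fun φ hφ => ?_, fun t ht φ hφ => ?_,
    fun t ht i j χ hχ => hsol.avg_curl hs hT hρeq hV hP hcurl hdF ht i j hχ⟩
  · have h := hsol.avg_vertical hρeq hwt hP hρt hφ hF.contDiff hF.bottom hF.top
    simpa only [avg_const_mul, mul_assoc, integral_const_mul] using h
  · have h := hsol.avg_mass hρeq hwt hρt hφ hF.contDiff
    have h2 : (fun z => β * (A * Real.exp (-β * z)) * F z)
        = fun z => β * (A * Real.exp (-β * z) * F z) := by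
      ext z
      ring
    rw [h2] at h
    simpa only [avg_const_mul H β fun z => A * Real.exp (-β * z) * F z, mul_assoc β,
      integral_const_mul] using h
  · have h := hsol.avg_incompressible hH ht (fun j => (hV j).memLp ht) (hw.memLp ht) hφ hE
    -- Incompressibility is tested with `κ = ρeq F'`, and the eigenvalue equation turns `κ'` into a
    -- multiple of the weight `ρeq F` that defines `y`.
    have h2 : avg H (deriv fun z => A * Real.exp (-β * z) * deriv F z) (w t)
        = avg H (fun z => -(N ^ 2 / c ^ 2) * (A * Real.exp (-β * z) * F z)) (w t) := by
      ext x
      refine setIntegral_congr_fun measurableSet_Ioo fun z hz => ?_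
      simp only [(hF.eigen z hz).deriv]
      ring
    rw [h2] at h
    simp only [avg_const_mul H (-(N ^ 2 / c ^ 2)) fun z => A * Real.exp (-β * z) * F z,
      mul_assoc (-(N ^ 2 / c ^ 2)), integral_const_mul] at h
    rw [eq_neg_of_add_eq_zero_left h]
    field_simp

end ModalAverages

/-! ### Coefficients as averages, and the vanishing of the barotropic mode -/

section Coefficients

variable {d : ℕ} {H g T A β N s : ℝ} {ρeq : ℝ → ℝ} {c : ℕ → ℝ} {f : ℕ → ℝ → ℝ} {n : ℕ}
  {F : ℝ → ℝ} {V : ℝ → Horiz d × ℝ → Horiz d} {w ρ P : ℝ → Horiz d × ℝ → ℝ}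

lemma coeffV_eq_avg (hρ : ∀ z ∈ Ioo (-H) 0, ρeq z = A * Real.exp (-β * z)) (hn : 1 ≤ n)
    (hF : ∀ z ∈ Ioo (-H) 0, deriv (f n) z = deriv F z) (U : Horiz d × ℝ → Horiz d) (j : Fin d) :
    coeffV H ρeq c f n U j
      = fun x => c n * avg H (fun z => A * Real.exp (-β * z) * deriv F z) (fun q => U q j) x := by
  rw [← avg_const_mul, coeffV]
  refine coeff_eq_avg (fun z hz => ?_) _
  rw [gMode, if_neg (Nat.one_le_iff_ne_zero.1 hn), hρ z hz, hF z hz]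
  ring

lemma coeffP_eq_avg (hA : 0 < A) (hρ : ∀ z ∈ Ioo (-H) 0, ρeq z = A * Real.exp (-β * z))
    (hn : 1 ≤ n) (hF : ∀ z ∈ Ioo (-H) 0, deriv (f n) z = deriv F z) (p : Horiz d × ℝ → ℝ) :
    coeffP H ρeq c f n p = fun x => c n * avg H (deriv F) p x := by
  rw [← avg_const_mul, coeffP]
  refine coeff_eq_avg (fun z hz => ?_) _
  rw [gMode, if_neg (Nat.one_le_iff_ne_zero.1 hn), hρ z hz, hF z hz]
  field_simp

lemma coeffW_eq_avg (hρ : ∀ z ∈ Ioo (-H) 0, ρeq z = A * Real.exp (-β * z))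
    (hF : ∀ z ∈ Ioo (-H) 0, f n z = F z) (u : Horiz d × ℝ → ℝ) :
    coeffW H N ρeq f n u
      = fun x => N ^ 2 * avg H (fun z => A * Real.exp (-β * z) * F z) u x := by
  rw [← avg_const_mul, coeffW]
  refine coeff_eq_avg (fun z hz => ?_) _
  rw [hρ z hz, hF z hz]
  ring

lemma coeffR_eq_avg (hA : 0 < A) (hg : 0 < g) (hN : 0 < N)
    (hρ : ∀ z ∈ Ioo (-H) 0, ρeq z = A * Real.exp (-β * z))
    (hF : ∀ z ∈ Ioo (-H) 0, f n z = F z) (u : Horiz d × ℝ → ℝ) :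
    coeffR H g N ρeq f n u = fun x => g * avg H F u x := by
  rw [← avg_const_mul, coeffR_eq_coeff hg]
  refine coeff_eq_avg (fun z hz => ?_) _
  rw [hρ z hz, hF z hz]
  field_simp

/-- The kernel is identically `1`, but it is kept as `ρeq · ρeq⁻¹`, the form which the momentum
equation tested with `κ = ρeq⁻¹` produces. -/
lemma coeffV_zero_eq_avg (hA : 0 < A) (hρ : ∀ z ∈ Ioo (-H) 0, ρeq z = A * Real.exp (-β * z))
    (U : Horiz d × ℝ → Horiz d) (j : Fin d) :
    coeffV H ρeq c f 0 U j = fun x => (√(∫ y, (ρeq y)⁻¹ ∂(depthMeasure H)))⁻¹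
      * avg H (fun z => A * Real.exp (-β * z) * (A * Real.exp (-β * z))⁻¹) (fun q => U q j) x := by
  rw [← avg_const_mul, coeffV]
  refine coeff_eq_avg (fun z hz => ?_) _
  rw [gMode, if_pos rfl, hρ z hz]
  field_simp

lemma coeffP_zero_eq_avg (hA : 0 < A) (hρ : ∀ z ∈ Ioo (-H) 0, ρeq z = A * Real.exp (-β * z))
    (p : Horiz d × ℝ → ℝ) :
    coeffP H ρeq c f 0 p = fun x => (√(∫ y, (ρeq y)⁻¹ ∂(depthMeasure H)))⁻¹
      * avg H (fun z => (A * Real.exp (-β * z))⁻¹) p x := by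
  rw [← avg_const_mul, coeffP]
  refine coeff_eq_avg (fun z hz => ?_) _
  rw [gMode, if_pos rfl, hρ z hz]
  field_simp

/-- The barotropic velocity vanishes. -/
theorem SolvesLinearized.avg_velocity_eq_zero (hd : 0 < d) (hH : 0 < H) (hT : 0 < T) (hs : 0 ≤ s)
    (hA : 0 < A) (hsol : SolvesLinearized H g T ρeq V w ρ P)
    (hρ : ∀ z ∈ Ioo (-H) 0, ρeq z = A * Real.exp (-β * z))
    (hV : ∀ j, ContHs0 H T s fun t q => V t q j) (hw : ContHs0 H T s w) (hP : TimeL2 H T P)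
    (hcurl : ZeroVerticalVorticity H (V 0)) {t : ℝ} (ht : t ∈ Icc 0 T) (j : Fin d) :
    avg H (fun z => A * Real.exp (-β * z) * (A * Real.exp (-β * z))⁻¹) (fun q => V t q j)
      =ᵐ[volume] 0 := by
  have hpos : ∀ z, A * Real.exp (-β * z) ≠ 0 := fun z => by positivity
  have hinv : ContDiff ℝ ∞ fun z => (A * Real.exp (-β * z))⁻¹ :=
    ContDiff.inv (by fun_prop) hpos
  have hcontd : ContDiff ℝ ∞ fun z => A * Real.exp (-β * z) * (A * Real.exp (-β * z))⁻¹ :=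
    ContDiff.mul (by fun_prop) hinv
  refine ae_eq_zero_of_curl_div hd
    (v := fun j => avg H (fun z => A * Real.exp (-β * z) * (A * Real.exp (-β * z))⁻¹)
      fun q => V t q j) (fun j => memLp_avg ((hV j).memLp ht) hcontd.continuous)
    (fun i j χ hχ => hsol.avg_curl hs hT hρ hV hP hcurl hinv ht i j hχ) (fun χ hχ => ?_) j
  have h := hsol.avg_incompressible hH ht (fun j => (hV j).memLp ht) (hw.memLp ht) hχ hcontd
  -- The kernel is constant, so `w` drops out of the averaged divergence.
  have h0 : (deriv fun z => A * Real.exp (-β * z) * (A * Real.exp (-β * z))⁻¹) = fun _ => 0 := by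
    simp only [mul_inv_cancel₀ (hpos _), deriv_const']
  have h1 : avg H (fun _ => 0) (w t) = 0 := by
    ext x
    simp [avg]
  rw [h0, h1] at h
  simpa using h

/-- The barotropic pressure vanishes. -/
theorem SolvesLinearized.avg_pressure_ae_eq_zero (hd : 0 < d) (hH : 0 < H) (hT : 0 < T)
    (hs : 0 ≤ s) (hA : 0 < A) (hsol : SolvesLinearized H g T ρeq V w ρ P)
    (hρ : ∀ z ∈ Ioo (-H) 0, ρeq z = A * Real.exp (-β * z))
    (hV : ∀ j, ContHs0 H T s fun t q => V t q j) (hw : ContHs0 H T s w) (hP : TimeL2 H T P)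
    (hcurl : ZeroVerticalVorticity H (V 0)) :
    ∀ᵐ t ∂(volume.restrict (Ioo 0 T)),
      avg H (fun z => (A * Real.exp (-β * z))⁻¹) (P t) =ᵐ[volume] 0 := by
  have hpos : ∀ z, A * Real.exp (-β * z) ≠ 0 := fun z => by positivity
  have hinv : ContDiff ℝ ∞ fun z => (A * Real.exp (-β * z))⁻¹ :=
    ContDiff.inv (by fun_prop) hpos
  refine hP.avg_ae_eq_zero hd hT hinv.continuous fun j φ hφ => ?_
  have h := hsol.avg_horizontal hρ ((hV j).timeL2 hs) hP hφ hinv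
  -- The velocity average vanishes, so the horizontal equation reduces to a zero pressure gradient.
  have h0 : ∀ t ∈ Ioo 0 T, ∫ x, avg H (fun z => A * Real.exp (-β * z)
      * (A * Real.exp (-β * z))⁻¹) (fun q => V t q j) x * pd (1, 0) φ (t, x) = 0 := by
    intro t ht
    refine integral_eq_zero_of_ae ?_
    filter_upwards [hsol.avg_velocity_eq_zero hd hH hT hs hA hρ hV hw hP hcurl
      (Ioo_subset_Icc_self ht) j] with x hx
    rw [hx]
    simp
  rwa [setIntegral_eq_zero_of_forall_eq_zero h0, zero_add] at h

lemma ZeroVerticalVorticity.congr {U U' : Horiz d × ℝ → Horiz d} (h : ZeroVerticalVorticity H U)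
    (hU : U' =ᵐ[stripMeasure d H] U) : ZeroVerticalVorticity H U' := by
  intro i j φ hφ
  refine Eq.trans ?_ (h i j φ hφ)
  refine integral_congr_ae ?_
  filter_upwards [hU] with q hq
  rw [hq]

end Coefficients


end InternalWaves

end

/-! ### Assembly of the modal system, the barotropic mode and the Sobolev bounds -/

theorem mainTheorem3 {d : ℕ} (hd : d = 1 ∨ d = 2)
    {H g N T s : ℝ} (hH : 0 < H) (hg : 0 < g) (hN : 0 < N) (hT : 0 < T) (hs : 0 ≤ s)
    {ρeq : ℝ → ℝ} (hρeq : IsStratification H g N ρeq)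
    {c : ℕ → ℝ} {f : ℕ → ℝ → ℝ} (hf : IsModalBasis H N ρeq c f)
    {V : ℝ → Horiz d × ℝ → Horiz d} {w ρ P : ℝ → Horiz d × ℝ → ℝ}
    {V₀ : Horiz d × ℝ → Horiz d} {ρ₀ : Horiz d × ℝ → ℝ}
    (hV : ∀ j, ContHs0 H T s (fun t q => V t q j)) (hw : ContHs0 H T s w)
    (hρ : ContHs0 H T s ρ) (hP : MemL1L2 H T P)
    (hsol : SolvesLinearized H g T ρeq V w ρ P)
    (hV₀ : V 0 =ᵐ[stripMeasure d H] V₀) (hρ₀ : ρ 0 =ᵐ[stripMeasure d H] ρ₀)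
    (hcurl : ZeroVerticalVorticity H V₀) :
    (∀ n ≥ 1,
      (∀ j, ContHs T s (fun t => coeffV H ρeq c f n (V t) j)) ∧
      ContHs T s (fun t => coeffW H N ρeq f n (w t)) ∧
      ContHs T s (fun t => coeffR H g N ρeq f n (ρ t)) ∧
      SolvesBoussinesq T N (c n) (fun t j => coeffV H ρeq c f n (V t) j)
        (fun t => coeffR H g N ρeq f n (ρ t)) ∧
      (∀ j, coeffV H ρeq c f n (V 0) j =ᵐ[volume] coeffV H ρeq c f n V₀ j) ∧
      coeffR H g N ρeq f n (ρ 0) =ᵐ[volume] coeffR H g N ρeq f n ρ₀ ∧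
      (∀ t ∈ Icc 0 T, EqMulDiv (-c n) (fun j => coeffV H ρeq c f n (V t) j)
        (coeffW H N ρeq f n (w t))) ∧
      PressureLaw T N (c n) (fun t => coeffR H g N ρeq f n (ρ t))
        (fun t => coeffW H N ρeq f n (w t)) (fun t => coeffP H ρeq c f n (P t))) ∧
    (∀ᵐ t ∂(volume.restrict (Ioo 0 T)), coeffP H ρeq c f 0 (P t) =ᵐ[volume] 0) ∧
    (∀ t ∈ Icc 0 T, ∀ j, coeffV H ρeq c f 0 (V t) j =ᵐ[volume] 0) ∧
    (∀ t ∈ Icc 0 T, ∑' n : ℕ,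
      (hsSq s (coeffR H g N ρeq f (n + 1) (ρ t))
        + ∑ j, hsSq s (coeffV H ρeq c f (n + 1) (V t) j)
        + hsSq s (coeffW H N ρeq f (n + 1) (w t))) < ⊤) := by
  have hd0 : 0 < d := by omega
  obtain ⟨A, hA, hexp⟩ := hρeq.exists_eq_exp hH hg
  have hβ : N ^ 2 / g * g = N ^ 2 := by field_simp
  have hPt := hP.timeL2
  have hcurl0 : ZeroVerticalVorticity H (V 0) := hcurl.congr hV₀
  have hfamV := orthoFamily_gMode hH hA hexp hf
  have hfamW := orthoFamily_f hH hA hexp hf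
  have hfamR := orthoFamily_density hH hA hg hN hexp hf
  refine ⟨fun n hn => ?_, ?_, fun t ht j => ?_, fun t ht => ?_⟩
  · obtain ⟨F, hF, hfF, hdF⟩ := hf.exists_smoothMode hH hA hexp hn
    have hsys := hsol.modalSystem hH hT hs hN.ne' (hf.speed_pos n hn).ne' hexp hV hw hρ hPt
      hcurl0 hF
    have hcV := coeffV_eq_avg (c := c) (d := d) hexp hn hdF
    have hcP := coeffP_eq_avg (c := c) (d := d) hA hexp hn hdF
    have hcW := coeffW_eq_avg (N := N) (d := d) hexp hfF
    have hcR := coeffR_eq_avg (d := d) hA hg hN hexp hfF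
    refine ⟨fun j => hfamV.contHs (hV j) hn, hfamW.contHs hw hn, ?_, ?_, fun j => ?_, ?_,
      fun t ht => ?_, ?_⟩
    · simp only [coeffR_eq_coeff hg]
      exact hfamR.contHs hρ hn
    · simp only [hcV, hcR]
      exact hsys.solvesBoussinesq hN.ne' hβ
    · rw [hcV, hcV]
      filter_upwards [avg_congr_ae (κ := fun z => A * Real.exp (-(N ^ 2 / g) * z) * deriv F z)
        (hV₀.fun_comp fun v : Horiz d => v j)] with x hx
      exact congrArg (c n * ·) hx
    · rw [hcR, hcR]
      filter_upwards [avg_congr_ae (κ := F) hρ₀] with x hx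
      rw [hx]
    · simp only [hcV, hcW]
      exact hsys.eqMulDiv hN.ne' ht
    · simp only [hcR, hcW, hcP]
      exact hsys.pressureLaw hN.ne'
  · filter_upwards [hsol.avg_pressure_ae_eq_zero hd0 hH hT hs hA hexp hV hw hPt hcurl0] with t ht
    rw [coeffP_zero_eq_avg hA hexp]
    filter_upwards [ht] with x hx
    rw [hx, Pi.zero_apply, mul_zero]
  · rw [coeffV_zero_eq_avg hA hexp]
    filter_upwards [hsol.avg_velocity_eq_zero hd0 hH hT hs hA hexp hV hw hPt hcurl0 ht j]
      with x hx
    rw [hx, Pi.zero_apply, mul_zero]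
  · simp only [coeffR_eq_coeff hg, coeffV, coeffW]
    rw [ENNReal.tsum_add, ENNReal.tsum_add, Summable.tsum_finsetSum fun j _ => ENNReal.summable]
    exact ENNReal.add_lt_top.2 ⟨ENNReal.add_lt_top.2 ⟨hfamR.tsum_lt_top (hρ.1 t ht),
      ENNReal.sum_lt_top.2 fun j _ => hfamV.tsum_lt_top ((hV j).1 t ht)⟩,
      hfamW.tsum_lt_top (hw.1 t ht)⟩
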